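/- **Notation.** Let $\mathbb H=\{z\in\mathbb C:\operatorname{Im}z>0\}$ and $\widehat\varphi(\xi)=\int_{\mathbb R}\varphi(x)e^{-2\pi i x\xi}\,dx$. A holomorphic $g:\mathbb H\to\mathbb C$ is *almost periodic*, $g\in\mathrm{AP}(\mathbb H)$, if for all $0<\alpha<\beta<\infty$ and $\varepsilon>0$ there is a relatively dense set $\tau\subset\mathbb R$ (i.e. for some $l>0$ it meets every interval $(x,x+l)$) with $\sup_{\alpha<\operatorname{Im}z<\beta}|g(z)-g(z+t)|\le\varepsilon$ for all $t\in\tau$. A holomorphic function on $\mathbb H$ is of *bounded type* if it is a quotient of two bounded holomorphic functions on $\mathbb H$. A function $a:\mathbb R\to\mathbb C$ is *locally summable* if its support is at most countable and $\sum_{|\lambda|\le T}|a(\lambda)|<\infty$ for every $T>0$. A real-valued locally finite measure $\mu$ on $\mathbb R$ is a difference of two nonnegative locally finite Borel measures; its *degree* is the least $n\in\mathbb Z$ with $\int(1+t^2)^{-n/2}\,d|\mu|(t)<\infty$ (and $-\infty$ if all integers $n$ qualify). The pair $(\mu,a)$ is a *real-antipodal FS-pair* if $\mu$ is real-valued, every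 Schwartz function is $|\mu|$-integrable, $a$ is locally summable, $a(-\lambda)=\overline{a(\lambda)}$ for all $\lambda$, and $\int\widehat\varphi\,d\mu=\sum_{\lambda\in\mathbb R}a(\lambda)\varphi(\lambda)$ for all $\varphi\in C_c^\infty(\mathbb R)$. **Theorem.** Let $f:\mathbb H\to\mathbb C$ be holomorphic and suppose that * (II) $c_1>0$ and $f(\cdot+ic_1)\in\mathrm{AP}(\mathbb H)$; * (IV) $\exp(f)$ is of bounded type and $\limsup_{y\to\infty}\operatorname{Re}f(iy)/y=0$. Consider the condition * (III*) there is $c_2\ge c_1$, and for every $M>0$ there is $B_M>0$, such that for every trigonometric polynomial $p(x)=\sum_{n=1}^N p_ne^{2\pi i\theta_nx}$ with distinct frequencies $\theta_n\in[0,M]$, $$\limsup_{T\to\infty}\left|\frac1{2T}\int_{-T}^Tf(x+ic_2)\overline{p(x)}\,dx\right|\le B_M\max_n|p_n|.$$ If (III*) holds, then there is $c\ge0$ such that $$\mathcal Ef(\lambda)=\lim_{T\to\infty}\frac1{2T}\int_{-T+iy}^{T+iy}f(z)e^{-2\pi i\lambda z}\,dz$$ exists for all $\lambda\in\mathbb R$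 and $y>c$, is independent of $y$, vanishes for $\lambda<0$, and is locally summable in $\lambda$. Moreover, there is a unique real-valued locally finite measure $\mu$ of degree at most $2$ such that $$\frac{f(z)+\overline{f(w)}}{z-\overline w}=\frac1{2\pi i}\int_{\mathbb R}\frac{d\mu(t)}{(z-t)(\overline w-t)}\qquad\text{for all }z,w\in\mathbb H.$$ If we put $a(\lambda)=\mathcal Ef(\lambda)$ for $\lambda>0$, $a(0)=2\operatorname{Re}\mathcal Ef(0)$ and $a(\lambda)=\overline{\mathcal Ef(-\lambda)}$ for $\lambda<0$, then $(\mu,a)$ is a real-antipodal FS-pair, and $$f(z)=i\operatorname{Im}\mathcal Ef(0)+\tfrac12a(0)+\lim_{T\to\infty}\sum_{0<\lambda<T}a(\lambda)\,(1-\lambda/T)\,e^{2\pi i\lambda z}$$ uniformly for $z$ in compact subsets of $\mathbb H$. Furthermore, under (II) and (IV) alone there is $c\ge0$ such that the limit $\mathcal Ef(\lambda)$ exists for all $\lambda\in\mathbb R$ and $y>c$ and is independent of $y$, and (III*) holds if and only if $\mathcal Ef$ is locally summable. -/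

import Mathlib

open Complex Filter Topology MeasureTheory
open scoped FourierTransform ContDiff ComplexConjugate

noncomputable section

namespace FourierSummation

/-- The open upper half-plane as a subset of `ℂ`. -/
def upperHalf : Set ℂ := {z : ℂ | 0 < z.im}

/-! ### Real-valued locally finite measures -/

/-- A real-valued locally finite (not necessarily finite) Borel measure on `ℝ`, given by its
Jordan decomposition: it is `pos - neg` with `pos`, `neg` nonnegative, locally finite and mutually
singular. Every difference of two nonnegative locally finite Borel measures has exactly one such
decomposition, so that equality of structures is equality of measures. -/
@[ext]
structure RealMeasure where
  pos : Measure ℝ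
  neg : Measure ℝ
  pos_locallyFinite : IsLocallyFiniteMeasure pos
  neg_locallyFinite : IsLocallyFiniteMeasure neg
  mutuallySingular : Measure.MutuallySingular pos neg

namespace RealMeasure

/-- The total variation `|μ|`. -/
def variation (μ : RealMeasure) : Measure ℝ := μ.pos + μ.neg

/-- The integral `∫ g dμ` of a complex-valued function. -/
def integral (μ : RealMeasure) (g : ℝ → ℂ) : ℂ := (∫ t, g t ∂μ.pos) - ∫ t, g t ∂μ.neg

/-- The integral of `(1 + t²)^(-n/2)` against `|μ|`, in `[0, ∞]`. -/
def decayIntegral (μ : RealMeasure) (n : ℤ) : ENNReal :=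
  ∫⁻ t, ENNReal.ofReal ((1 + t ^ 2) ^ (-(n : ℝ) / 2)) ∂μ.variation

/-- The degree of `μ`: the least integer `n` such that `(1 + t²)^(-n/2)` is integrable against
`|μ|`. It is `⊤` when there is no such integer and `⊥` when every integer is one. -/
def degree (μ : RealMeasure) : EReal :=
  sInf ((fun n : ℤ => ((n : ℝ) : EReal)) '' {n : ℤ | μ.decayIntegral n < ⊤})

/-- `μ` is strongly tempered: every Schwartz function is integrable against `|μ|`. -/
def StronglyTempered (μ : RealMeasure) : Prop :=
  ∀ φ : SchwartzMap ℝ ℂ, Integrable (fun t => φ t) μ.variation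

theorem decayIntegral_anti (μ : RealMeasure) {m n : ℤ} (h : m ≤ n) :
    μ.decayIntegral n ≤ μ.decayIntegral m := by
  refine lintegral_mono fun t => ENNReal.ofReal_le_ofReal ?_
  refine Real.rpow_le_rpow_of_exponent_le (by nlinarith [sq_nonneg t]) ?_
  have : (m : ℝ) ≤ n := by exact_mod_cast h
  linarith

/-- The degree is at most `k` exactly when `(1 + t²)^(-k/2)` is integrable against `|μ|`. -/
theorem degree_le_iff (μ : RealMeasure) (k : ℤ) :
    μ.degree ≤ ((k : ℝ) : EReal) ↔ μ.decayIntegral k < ⊤ := by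
  constructor
  · intro h
    have h1 : μ.degree < (((k + 1 : ℤ) : ℝ) : EReal) :=
      lt_of_le_of_lt h (by exact_mod_cast Int.lt_succ k)
    obtain ⟨_, ⟨n, hn, rfl⟩, hlt⟩ := sInf_lt_iff.1 h1
    have hnk : n < k + 1 := by
      have h2 : (n : ℝ) < ((k + 1 : ℤ) : ℝ) := EReal.coe_lt_coe_iff.1 hlt
      exact_mod_cast h2
    exact lt_of_le_of_lt (μ.decayIntegral_anti (by omega)) hn
  · intro h
    exact sInf_le ⟨k, h, rfl⟩

end RealMeasure

/-! ### Fourier summation pairs -/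

/-- `a` has at most countable support and is absolutely summable on `[-T, T]` for all `T > 0`. -/
def LocallySummable (a : ℝ → ℂ) : Prop :=
  (Function.support a).Countable ∧
    ∀ T : ℝ, 0 < T → Summable fun l : Set.Icc (-T) T => ‖a l‖

/-- `a` is antipodal. -/
def Antipodal (a : ℝ → ℂ) : Prop := ∀ l : ℝ, a (-l) = conj (a l)

/-- `(μ, a)` is a Fourier summation pair (for a real-valued `μ`). -/
def IsFSPair (μ : RealMeasure) (a : ℝ → ℂ) : Prop :=
  μ.StronglyTempered ∧ LocallySummable a ∧
    ∀ φ : ℝ → ℂ, ContDiff ℝ ∞ φ → HasCompactSupport φ →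
      HasSum (fun l : ℝ => a l * φ l) (μ.integral (𝓕 φ))

/-- `(μ, a)` is a real-antipodal Fourier summation pair (`μ` is real-valued by its type). -/
def IsRealAntipodalFSPair (μ : RealMeasure) (a : ℝ → ℂ) : Prop :=
  IsFSPair μ a ∧ Antipodal a

/-! ### Almost periodic and bounded type functions on the upper half-plane -/

/-- A set of reals is relatively dense. -/
def RelativelyDense (τ : Set ℝ) : Prop :=
  ∃ l : ℝ, 0 < l ∧ ∀ x : ℝ, (Set.Ioo x (x + l) ∩ τ).Nonempty

/-- `f` is a holomorphic almost periodic function on the upper half-plane. -/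
def AlmostPeriodicUpper (f : ℂ → ℂ) : Prop :=
  DifferentiableOn ℂ f upperHalf ∧
    ∀ α β ε : ℝ, 0 < α → α < β → 0 < ε →
      ∃ τ : Set ℝ, RelativelyDense τ ∧
        ∀ t ∈ τ, ∀ z : ℂ, α < z.im → z.im < β → ‖f z - f (z + t)‖ ≤ ε

/-- `P` is holomorphic and bounded on the upper half-plane. -/
def BoundedHolomorphic (P : ℂ → ℂ) : Prop :=
  DifferentiableOn ℂ P upperHalf ∧ ∃ C : ℝ, ∀ z ∈ upperHalf, ‖P z‖ ≤ C

/-- `g` is the quotient of two bounded holomorphic functions on the upper half-plane, the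
denominator not vanishing identically. -/
def BoundedType (g : ℂ → ℂ) : Prop :=
  ∃ P Q : ℂ → ℂ, BoundedHolomorphic P ∧ BoundedHolomorphic Q ∧
    (∃ z ∈ upperHalf, Q z ≠ 0) ∧ ∀ z ∈ upperHalf, g z * Q z = P z

/-! ### Conditions on `f` and objects built from `f` -/

/-- The trigonometric polynomial with frequencies `θ n` and coefficients `p n`. -/
def trigPoly {N : ℕ} (θ : Fin N → ℝ) (p : Fin N → ℂ) (x : ℝ) : ℂ :=
  ∑ n, p n * exp (2 * Real.pi * I * θ n * x)

/-- For every `M > 0` there is `B > 0` such that, for all trigonometric polynomials `p` with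
(distinct) frequencies in `[0, M]`, the upper mean value of `f (· + i c) * conj p` is at most
`B` times the largest modulus of a coefficient of `p` (which is the sup norm of the
coefficient vector). -/
def LocalMeanBound (f : ℂ → ℂ) (c : ℝ) : Prop :=
  ∀ M : ℝ, 0 < M → ∃ B : ℝ, 0 < B ∧
    ∀ (N : ℕ) (θ : Fin N → ℝ) (p : Fin N → ℂ), Function.Injective θ →
      (∀ n, θ n ∈ Set.Icc 0 M) →
      limsup (fun T : ℝ => ((‖(1 / (2 * T) : ℂ) *
          ∫ x in (-T)..T, f (x + c * I) * conj (trigPoly θ p x)‖ : ℝ) : EReal)) atTop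
        ≤ ((B * ‖p‖ : ℝ) : EReal)

/-- `exp f` is of bounded type and `limsup_{y → ∞} Re f(iy) / y = 0`. -/
def ExpBoundedTypeZero (f : ℂ → ℂ) : Prop :=
  BoundedType (fun z => exp (f z)) ∧
    limsup (fun y : ℝ => (((f (y * I)).re / y : ℝ) : EReal)) atTop = 0

/-- For every real `l` and every `y > c`, the limit as `T → ∞` of `1/(2T)` times the integral of
`f(z) e^{-2π i l z}` over the segment from `-T + iy` to `T + iy` exists and equals `E l`
(in particular it does not depend on `y`). -/
def HasFourierBohrCoeffs (f : ℂ → ℂ) (c : ℝ) (E : ℝ → ℂ) : Prop :=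
  ∀ l y : ℝ, c < y →
    Tendsto (fun T : ℝ => (1 / (2 * T) : ℂ) *
      ∫ x in (-T)..T, f (x + y * I) * exp (-2 * Real.pi * I * l * (x + y * I)))
      atTop (𝓝 (E l))

/-- The function equal to `E l` for `l > 0`, to `2 Re E 0` at `0`, and to the conjugate of
`E (-l)` for `l < 0`. -/
def antipodalCoeffs (E : ℝ → ℂ) (l : ℝ) : ℂ :=
  if 0 < l then E l else if l = 0 then ((2 * (E 0).re : ℝ) : ℂ) else conj (E (-l))

/-- The kernel identity between `f` and `μ` on the upper half-plane. -/
def KernelIdentity (f : ℂ → ℂ) (μ : RealMeasure) : Prop :=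
  ∀ z ∈ upperHalf, ∀ w ∈ upperHalf,
    (f z + conj (f w)) / (z - conj w) =
      1 / (2 * Real.pi * I) * μ.integral fun t : ℝ => 1 / ((z - t) * (conj w - t))

/-- The sum of `a l (1 - l/T) e^{2π i l z}` over `0 < l < T`. -/
def cesaroSum (a : ℝ → ℂ) (T : ℝ) (z : ℂ) : ℂ :=
  ∑' l : Set.Ioo (0 : ℝ) T,
    a l * (1 - ((l : ℝ) : ℂ) / T) * exp (2 * Real.pi * I * ((l : ℝ) : ℂ) * z)

end FourierSummation

end

/-! Bounded type of `exp f` means that |Re f| is dominated by -log|PQ| for two holomorphic functions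
P, Q bounded by 1. In the unit disc Jensen's formula then bounds the circle averages of |Re f|,
weak-* compactness yields a Herglotz representation by a difference of finite measures, and the
Cayley transform turns it into the kernel identity on the line, plus a linear term coming from the
mass at infinity. The condition on Re f(iy)/y kills that term (`exists_tame_kernelIdentity`). The
measure is the boundary value of 2 Re f, hence unique.

The representation forces at most quadratic growth in every half-plane Im z ≥ η > 0.
Phragmén–Lindelöf therefore bounds f above each height exceeding c₁, and the three lines theorem
leaves only square-root growth at height c₁ itself. Contour shifts make the Fourier–Bohr
coefficients independent of the height, c₁ included, and letting the height tend to infinity removes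
the negative frequencies. The mean of f times a conjugate trigonometric polynomial is a finite
linear combination of these coefficients, so the bound (III*), tested on unimodular coefficients,
amounts to local summability (`localMeanBound_iff`).

For a test function φ, the horizontal average of f against 𝓕 φ and the absolutely convergent series
Σ E(λ) φ(λ) e^{2πiλz} are almost periodic above height c₁ with equal coefficients. The uniqueness
theorem `eq_zero_of_coeff_eq_zero` identifies them there, and analytic continuation does so in the
whole half-plane (`smear_eq_expSeries`). Letting Im z tend to 0, and adding the conjugate identity,
gives the summation formula.

After mollification the formula applies to a tent on [-T, T] multiplied by e^{2πiλz} on the right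
and e^{2πiλ conj w} on the left. Its Fourier transform is the kernel of the representation up to
O(1/T), so f(z) + conj f(w) is a Cesàro limit with rate 1/T. Sending w = iY to infinity isolates
f(z). -/

noncomputable section

namespace FourierSummation

/-! ### Integration against real-valued measures -/

namespace RealMeasure

variable {μ : RealMeasure} {g h : ℝ → ℂ}

theorem integrable_pos (hg : Integrable g μ.variation) : Integrable g μ.pos :=
  hg.mono_measure (Measure.le_add_right le_rfl)

theorem integrable_neg (hg : Integrable g μ.variation) : Integrable g μ.neg :=
  hg.mono_measure (Measure.le_add_left le_rfl)

theorem integral_add' (hg : Integrable g μ.variation) (hh : Integrable h μ.variation) :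
    μ.integral (fun t => g t + h t) = μ.integral g + μ.integral h := by
  unfold integral
  rw [integral_add (integrable_pos hg) (integrable_pos hh),
    integral_add (integrable_neg hg) (integrable_neg hh)]
  ring

theorem integral_const_mul' (c : ℂ) (g : ℝ → ℂ) :
    μ.integral (fun t => c * g t) = c * μ.integral g := by
  unfold integral
  rw [integral_const_mul, integral_const_mul]
  ring

theorem norm_integral_le (hg : Integrable g μ.variation) :
    ‖μ.integral g‖ ≤ ∫ t, ‖g t‖ ∂μ.variation := by
  unfold integral variation
  rw [integral_add_measure (integrable_pos hg).norm (integrable_neg hg).norm]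
  exact (norm_sub_le _ _).trans (add_le_add (norm_integral_le_integral_norm _)
    (norm_integral_le_integral_norm _))

theorem tendsto_integral_of_dominated {ι : Type*} {l : Filter ι} [l.IsCountablyGenerated]
    {F : ι → ℝ → ℂ} {b : ℝ → ℝ} (hF : ∀ᶠ i in l, AEStronglyMeasurable (F i) μ.variation)
    (hb : Integrable b μ.variation) (hle : ∀ᶠ i in l, ∀ t, ‖F i t‖ ≤ b t)
    (hlim : ∀ t, Tendsto (fun i => F i t) l (𝓝 (g t))) :
    Tendsto (fun i => μ.integral (F i)) l (𝓝 (μ.integral g)) := by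
  have hp : μ.pos ≤ μ.variation := Measure.le_add_right le_rfl
  have hn : μ.neg ≤ μ.variation := Measure.le_add_left le_rfl
  refine Tendsto.sub ?_ ?_
  · exact tendsto_integral_filter_of_dominated_convergence b
      (hF.mono fun i hi => hi.mono_measure hp)
      (hle.mono fun i hi => Eventually.of_forall hi) (hb.mono_measure hp)
      (Eventually.of_forall hlim)
  · exact tendsto_integral_filter_of_dominated_convergence b
      (hF.mono fun i hi => hi.mono_measure hn)
      (hle.mono fun i hi => Eventually.of_forall hi) (hb.mono_measure hn)
      (Eventually.of_forall hlim)

/-- The weight `(1 + t²)⁻¹` is integrable against `|μ|`. -/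
def Tame (μ : RealMeasure) : Prop := Integrable (fun t : ℝ => (1 + t ^ 2)⁻¹) μ.variation

theorem continuous_weight : Continuous fun t : ℝ => (1 + t ^ 2)⁻¹ :=
  (by fun_prop : Continuous fun t : ℝ => 1 + t ^ 2).inv₀ fun t => by positivity

theorem decayIntegral_two (μ : RealMeasure) :
    μ.decayIntegral 2 = ∫⁻ t, ENNReal.ofReal ((1 + t ^ 2)⁻¹) ∂μ.variation := by
  unfold decayIntegral
  congr 1
  ext t
  congr 1
  rw [show (-((2 : ℤ) : ℝ) / 2) = -1 by norm_num, Real.rpow_neg_one]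

theorem tame_iff (μ : RealMeasure) : μ.Tame ↔ μ.degree ≤ 2 := by
  have h2 : (2 : EReal) = (((2 : ℤ) : ℝ) : EReal) := by norm_cast
  rw [h2, degree_le_iff, decayIntegral_two, Tame]
  constructor
  · intro h
    have := h.2
    rw [hasFiniteIntegral_iff_ofReal (Eventually.of_forall fun t => by positivity)] at this
    exact this
  · intro h
    refine ⟨continuous_weight.aestronglyMeasurable, ?_⟩
    rw [hasFiniteIntegral_iff_ofReal (Eventually.of_forall fun t => by positivity)]
    exact h

theorem Tame.integrable_of_le (hμ : μ.Tame) (hg : Continuous g) {C : ℝ}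
    (hC : ∀ t, ‖g t‖ ≤ C * (1 + t ^ 2)⁻¹) : Integrable g μ.variation :=
  (Integrable.const_mul hμ C).mono' hg.aestronglyMeasurable (Eventually.of_forall hC)

theorem Tame.norm_integral_le (hμ : μ.Tame) (hg : Continuous g) {C : ℝ}
    (hC : ∀ t, ‖g t‖ ≤ C * (1 + t ^ 2)⁻¹) :
    ‖μ.integral g‖ ≤ C * ∫ t, (1 + t ^ 2)⁻¹ ∂μ.variation := by
  refine (RealMeasure.norm_integral_le (hμ.integrable_of_le hg hC)).trans ?_
  rw [← integral_const_mul]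
  exact integral_mono (hμ.integrable_of_le hg hC).norm (Integrable.const_mul hμ C) hC

end RealMeasure

/-! ### Elementary kernel estimates -/

theorem sub_ofReal_ne_zero {z : ℂ} (hz : z.im ≠ 0) (t : ℝ) : z - t ≠ 0 := by
  intro h
  apply hz
  have := congrArg Complex.im h
  simpa using this

/-- With x = Re z one has t² ≤ 2(x - t)² + 2x²; what remains, 2|z|² + 1, is absorbed by |z - t| ≥ Im
z. -/
theorem one_add_sq_le {z : ℂ} (hz : 0 < z.im) (t : ℝ) :
    1 + t ^ 2 ≤ (2 + (2 * ‖z‖ ^ 2 + 1) / z.im ^ 2) * ‖z - t‖ ^ 2 := by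
  have h1 : ‖z - t‖ ^ 2 = (z.re - t) ^ 2 + z.im ^ 2 := by
    rw [← Complex.normSq_eq_norm_sq, Complex.normSq_apply]; simp; ring
  have h2 : ‖z‖ ^ 2 = z.re ^ 2 + z.im ^ 2 := by
    rw [← Complex.normSq_eq_norm_sq, Complex.normSq_apply]; ring
  have h3 : (2 * ‖z‖ ^ 2 + 1) ≤ (2 * ‖z‖ ^ 2 + 1) / z.im ^ 2 * ‖z - t‖ ^ 2 := by
    rw [div_mul_eq_mul_div, le_div_iff₀ (by positivity)]
    rw [h1]
    exact mul_le_mul_of_nonneg_left (by nlinarith [sq_nonneg (z.re - t)]) (by positivity)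
  rw [add_mul]
  nlinarith [sq_nonneg (2 * z.re - t), sq_nonneg z.im]

theorem inv_norm_sub_sq_le {z : ℂ} (hz : 0 < z.im) (t : ℝ) :
    (‖z - t‖ ^ 2)⁻¹ ≤ (2 + (2 * ‖z‖ ^ 2 + 1) / z.im ^ 2) * (1 + t ^ 2)⁻¹ := by
  have h0 : 0 < ‖z - t‖ := norm_pos_iff.2 (sub_ofReal_ne_zero hz.ne' t)
  rw [← div_eq_mul_inv, le_div_iff₀ (by positivity), inv_mul_le_iff₀ (by positivity), mul_comm]
  exact one_add_sq_le hz t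

theorem norm_conj_sub (w : ℂ) (t : ℝ) : ‖conj w - t‖ = ‖w - t‖ := by
  rw [← Complex.norm_conj (w - t)]; simp

theorem conj_sub_ofReal_ne_zero {z : ℂ} (hz : z.im ≠ 0) (t : ℝ) : conj z - t ≠ 0 :=
  sub_ofReal_ne_zero (by simpa using hz) t

theorem continuous_kernel {z w : ℂ} (hz : 0 < z.im) (hw : 0 < w.im) :
    Continuous fun t : ℝ => 1 / ((z - t) * (conj w - t)) := by
  refine continuous_const.div (by fun_prop) fun t => ?_
  exact mul_ne_zero (sub_ofReal_ne_zero hz.ne' t) (conj_sub_ofReal_ne_zero hw.ne' t)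

/-- The constant in the comparison of `|z - t|⁻²` with `(1 + t²)⁻¹`. -/
def kernelConst (z : ℂ) : ℝ := 2 + (2 * ‖z‖ ^ 2 + 1) / z.im ^ 2

theorem kernelConst_pos (z : ℂ) : 0 < kernelConst z := by unfold kernelConst; positivity

theorem norm_kernel_le {z w : ℂ} (hz : 0 < z.im) (hw : 0 < w.im) (t : ℝ) :
    ‖1 / ((z - t) * (conj w - t))‖ ≤ (kernelConst z + kernelConst w) * (1 + t ^ 2)⁻¹ := by
  have h1 := inv_norm_sub_sq_le hz t
  have h2 := inv_norm_sub_sq_le hw t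
  rw [norm_div, norm_mul, norm_conj_sub, norm_one, one_div, mul_inv, kernelConst, kernelConst,
    add_mul]
  rw [← inv_pow] at h1 h2
  nlinarith [sq_nonneg (‖z - t‖⁻¹ - ‖w - t‖⁻¹), sq_nonneg (‖z - t‖⁻¹), sq_nonneg (‖w - t‖⁻¹)]

/-- Here z enters only through |z - conj w| / Im z, which is linear in |z| for fixed w and Im z
bounded below; the symmetric constant of `norm_kernel_le` would cost one more power of |z|. The gain
comes from |w - t| ≤ |z - t| + |z - conj w| and |z - t| ≥ Im z. -/
theorem norm_kernel_le' {z w : ℂ} (hz : 0 < z.im) (hw : 0 < w.im) (t : ℝ) :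
    ‖1 / ((z - t) * (conj w - t))‖ ≤
      (1 + ‖z - conj w‖ / z.im) * kernelConst w * (1 + t ^ 2)⁻¹ := by
  have h2 := inv_norm_sub_sq_le hw t
  have hz0 : 0 < ‖z - t‖ := norm_pos_iff.2 (sub_ofReal_ne_zero hz.ne' t)
  have hw0 : 0 < ‖w - t‖ := norm_pos_iff.2 (sub_ofReal_ne_zero hw.ne' t)
  rw [norm_div, norm_mul, norm_conj_sub, norm_one, one_div, mul_inv, mul_assoc]
  have h3 : ‖w - t‖ ≤ (1 + ‖z - conj w‖ / z.im) * ‖z - t‖ := by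
    have h4 : z.im ≤ ‖z - t‖ := by
      have := Complex.abs_im_le_norm (z - t)
      simp only [sub_im, ofReal_im, sub_zero] at this
      exact (le_abs_self _).trans this
    have h5 : ‖z - conj w‖ ≤ ‖z - conj w‖ / z.im * ‖z - t‖ := by
      rw [div_mul_eq_mul_div, le_div_iff₀ hz]; gcongr
    have h6 : ‖w - t‖ ≤ ‖z - t‖ + ‖z - conj w‖ := by
      rw [← norm_conj_sub]
      calc ‖conj w - t‖ = ‖(z - t) - (z - conj w)‖ := by congr 1; ring
        _ ≤ _ := norm_sub_le _ _
    rw [add_mul, one_mul]; linarith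
  have h7 : ‖z - t‖⁻¹ ≤ (1 + ‖z - conj w‖ / z.im) * ‖w - t‖⁻¹ := by
    rw [← div_eq_mul_inv, le_div_iff₀ hw0, inv_mul_le_iff₀ hz0, mul_comm]; exact h3
  calc ‖z - t‖⁻¹ * ‖w - t‖⁻¹ ≤ (1 + ‖z - conj w‖ / z.im) * ‖w - t‖⁻¹ * ‖w - t‖⁻¹ := by gcongr
    _ = (1 + ‖z - conj w‖ / z.im) * (‖w - t‖ ^ 2)⁻¹ := by rw [sq, mul_inv]; ring
    _ ≤ _ := by
      have : 0 ≤ 1 + ‖z - conj w‖ / z.im := by positivity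
      exact mul_le_mul_of_nonneg_left h2 this

/-- A function represented by a tame measure has at most quadratic growth away from `ℝ`. -/
theorem KernelIdentity.growth {f : ℂ → ℂ} {μ : RealMeasure} (hμ : μ.Tame)
    (hK : KernelIdentity f μ) {η : ℝ} (hη : 0 < η) :
    ∃ C : ℝ, 0 < C ∧ ∀ z : ℂ, η ≤ z.im → ‖f z‖ ≤ C * (1 + ‖z‖) ^ 2 := by
  set W := ∫ t, (1 + t ^ 2)⁻¹ ∂μ.variation with hW
  have hW0 : 0 ≤ W := integral_nonneg fun t => by positivity
  have hI : (I : ℂ) ∈ upperHalf := by simp [upperHalf]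
  refine ⟨‖f I‖ + 1 + (1 + 1 / η) * kernelConst I * W, by
    have := kernelConst_pos I; positivity, fun z hz => ?_⟩
  have hz0 : 0 < z.im := hη.trans_le hz
  have hne : z - conj I ≠ 0 := by
    intro h
    have := congrArg Complex.im h
    simp at this; linarith
  have h1 := hK z hz0 I hI
  rw [div_eq_iff hne] at h1
  have h2 : ‖μ.integral fun t : ℝ => 1 / ((z - t) * (conj I - t))‖ ≤
      (1 + ‖z - conj I‖ / z.im) * kernelConst I * W :=
    hμ.norm_integral_le (continuous_kernel hz0 hI) (norm_kernel_le' hz0 hI)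
  have h3 : ‖z - conj I‖ ≤ 1 + ‖z‖ := by
    have := norm_sub_le z (conj I)
    simp at this ⊢; linarith
  have h4 : ‖f z + conj (f I)‖ ≤ ((1 + (1 + ‖z‖) / η) * kernelConst I * W) * (1 + ‖z‖) := by
    rw [h1, norm_mul]
    have h5 : ‖(1 / (2 * Real.pi * I) : ℂ)‖ ≤ 1 := by
      simp only [one_div, norm_inv, norm_mul, norm_I, mul_one]
      apply inv_le_one_of_one_le₀
      simp [abs_of_pos Real.pi_pos]
      linarith [Real.pi_gt_three]
    have hk := kernelConst_pos I
    rw [norm_mul]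
    have hzη : ‖z - conj I‖ / z.im ≤ (1 + ‖z‖) / η := by gcongr
    refine mul_le_mul ?_ h3 (norm_nonneg _) (by positivity)
    calc _ ≤ 1 * ((1 + ‖z - conj I‖ / z.im) * kernelConst I * W) :=
          mul_le_mul h5 h2 (norm_nonneg _) zero_le_one
      _ ≤ _ := by rw [one_mul]; gcongr
  have h6 : ‖f z‖ ≤ ‖f z + conj (f I)‖ + ‖f I‖ := by
    have := norm_sub_le (f z + conj (f I)) (conj (f I))
    simpa using this
  have hk := kernelConst_pos I
  have h8 : (1 + (1 + ‖z‖) / η) * (1 + ‖z‖) ≤ (1 + 1 / η) * (1 + ‖z‖) ^ 2 := by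
    have e : (1 + (1 + ‖z‖) / η) * (1 + ‖z‖) = (1 + ‖z‖) + 1 / η * (1 + ‖z‖) ^ 2 := by
      field_simp
    have h10 : 1 / η * (1 + ‖z‖) ^ 2 + (1 + ‖z‖) ^ 2 = (1 + 1 / η) * (1 + ‖z‖) ^ 2 := by ring
    rw [e, ← h10]
    nlinarith [norm_nonneg z]
  have h9 : 1 ≤ (1 + ‖z‖) ^ 2 := by nlinarith [norm_nonneg z]
  calc ‖f z‖ ≤ (1 + (1 + ‖z‖) / η) * (1 + ‖z‖) * (kernelConst I * W) + ‖f I‖ := by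
        refine h6.trans (add_le_add (h4.trans (le_of_eq (by ring))) le_rfl)
    _ ≤ (1 + 1 / η) * (1 + ‖z‖) ^ 2 * (kernelConst I * W) + (‖f I‖ + 1) * (1 + ‖z‖) ^ 2 := by
        gcongr
        nlinarith [norm_nonneg (f I)]
    _ = _ := by ring

/-! ### Poisson means and boundary values -/

/-- The Poisson mean of height `y` of `φ` at `t`. -/
def poissonMean (φ : ℝ → ℂ) (y t : ℝ) : ℂ :=
  ∫ s : ℝ, ((Real.pi⁻¹ * (1 + s ^ 2)⁻¹ : ℝ) : ℂ) * φ (t + y * s)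

theorem integrable_cauchyDensity : Integrable fun s : ℝ => Real.pi⁻¹ * (1 + s ^ 2)⁻¹ :=
  integrable_inv_one_add_sq.const_mul _

theorem integral_cauchyDensity : ∫ s : ℝ, Real.pi⁻¹ * (1 + s ^ 2)⁻¹ = 1 := by
  rw [integral_const_mul, integral_univ_inv_one_add_sq, inv_mul_cancel₀ Real.pi_ne_zero]

theorem cauchyDensity_nonneg (s : ℝ) : 0 ≤ Real.pi⁻¹ * (1 + s ^ 2)⁻¹ := by positivity

variable {φ : ℝ → ℂ} {C : ℝ}

theorem norm_le_of_weight (hC0 : 0 ≤ C) (hC : ∀ x, ‖φ x‖ ≤ C * (1 + x ^ 2)⁻¹) (x : ℝ) :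
    ‖φ x‖ ≤ C := by
  refine (hC x).trans (mul_le_of_le_one_right hC0 (inv_le_one_of_one_le₀ ?_))
  nlinarith [sq_nonneg x]

theorem weight_const_nonneg (hC : ∀ x, ‖φ x‖ ≤ C * (1 + x ^ 2)⁻¹) : 0 ≤ C := by
  have := (norm_nonneg _).trans (hC 0)
  simpa using this

theorem continuous_cauchyDensity : Continuous fun s : ℝ => Real.pi⁻¹ * (1 + s ^ 2)⁻¹ :=
  continuous_const.mul RealMeasure.continuous_weight

theorem norm_poissonIntegrand_le (hC : ∀ x, ‖φ x‖ ≤ C * (1 + x ^ 2)⁻¹) (y t s : ℝ) :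
    ‖((Real.pi⁻¹ * (1 + s ^ 2)⁻¹ : ℝ) : ℂ) * φ (t + y * s)‖ ≤
      Real.pi⁻¹ * (1 + s ^ 2)⁻¹ * C := by
  rw [norm_mul, Complex.norm_real, Real.norm_of_nonneg (cauchyDensity_nonneg s)]
  exact mul_le_mul_of_nonneg_left (norm_le_of_weight (weight_const_nonneg hC) hC _)
    (cauchyDensity_nonneg s)

theorem continuous_poissonMean (hφ : Continuous φ) (hC : ∀ x, ‖φ x‖ ≤ C * (1 + x ^ 2)⁻¹)
    (y : ℝ) : Continuous (poissonMean φ y) := by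
  refine continuous_of_dominated (bound := fun s => Real.pi⁻¹ * (1 + s ^ 2)⁻¹ * C) ?_ ?_ ?_ ?_
  · intro t
    exact ((continuous_ofReal.comp continuous_cauchyDensity).mul
      (hφ.comp (by fun_prop))).aestronglyMeasurable
  · exact fun t => Eventually.of_forall (norm_poissonIntegrand_le hC y t)
  · exact integrable_cauchyDensity.mul_const C
  · exact Eventually.of_forall fun s => continuous_const.mul (hφ.comp (by fun_prop))

theorem tendsto_poissonMean (hφ : Continuous φ) (hC : ∀ x, ‖φ x‖ ≤ C * (1 + x ^ 2)⁻¹) (t : ℝ) :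
    Tendsto (fun y => poissonMean φ y t) (𝓝[>] 0) (𝓝 (φ t)) := by
  have h1 : Tendsto (fun y => poissonMean φ y t) (𝓝[>] 0)
      (𝓝 (∫ s : ℝ, ((Real.pi⁻¹ * (1 + s ^ 2)⁻¹ : ℝ) : ℂ) * φ t)) := by
    refine tendsto_integral_filter_of_dominated_convergence
      (fun s => Real.pi⁻¹ * (1 + s ^ 2)⁻¹ * C) ?_ ?_ (integrable_cauchyDensity.mul_const C) ?_
    · exact Eventually.of_forall fun y => ((continuous_ofReal.comp continuous_cauchyDensity).mul
        (hφ.comp (by fun_prop))).aestronglyMeasurable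
    · exact Eventually.of_forall fun y => Eventually.of_forall (norm_poissonIntegrand_le hC y t)
    · refine Eventually.of_forall fun s => Tendsto.const_mul _ ?_
      have : Continuous fun y : ℝ => φ (t + y * s) := hφ.comp (by fun_prop)
      have := (this.tendsto 0).mono_left (nhdsWithin_le_nhds (s := Set.Ioi 0))
      simpa using this
  have h2 : ∫ s : ℝ, ((Real.pi⁻¹ * (1 + s ^ 2)⁻¹ : ℝ) : ℂ) * φ t = φ t := by
    rw [integral_mul_const, integral_complex_ofReal, integral_cauchyDensity]; simp
  rwa [h2] at h1

theorem integral_weight_comp {y : ℝ} (hy : 0 < y) (t : ℝ) :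
    ∫ s : ℝ, (1 + (t + y * s) ^ 2)⁻¹ = Real.pi / y := by
  have h := Measure.integral_comp_mul_left (fun x : ℝ => (1 + (t + x) ^ 2)⁻¹) y
  rw [h, integral_add_left_eq_self (fun x : ℝ => (1 + x ^ 2)⁻¹), integral_univ_inv_one_add_sq,
    abs_of_pos (inv_pos.2 hy), smul_eq_mul, div_eq_inv_mul]

theorem integrable_weight_comp {y : ℝ} (hy : 0 < y) (t : ℝ) :
    Integrable fun s : ℝ => (1 + (t + y * s) ^ 2)⁻¹ :=
  (integrable_inv_one_add_sq.comp_add_left t).comp_mul_left' hy.ne'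

/-- With u = t + ys one has 1 + t² ≤ 2(1 + u²) + 2y²(1 + s²), so the product of the weights in s and
u is at most (1 + t²)⁻¹ times a sum whose integral is 2 + 2y after normalisation. This serves both
Fubini's theorem and the domination as y tends to 0. -/
theorem integral_norm_poissonIntegrand_le
    (hC : ∀ x, ‖φ x‖ ≤ C * (1 + x ^ 2)⁻¹) {y : ℝ} (hy : 0 < y) (t : ℝ) :
    ∫ s : ℝ, ‖((Real.pi⁻¹ * (1 + s ^ 2)⁻¹ : ℝ) : ℂ) * φ (t + y * s)‖ ≤
      C * (2 + 2 * y) * (1 + t ^ 2)⁻¹ := by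
  have hC0 := weight_const_nonneg hC
  have h1 : ∀ s : ℝ, ‖((Real.pi⁻¹ * (1 + s ^ 2)⁻¹ : ℝ) : ℂ) * φ (t + y * s)‖ ≤
      C * (1 + t ^ 2)⁻¹ * (2 * (Real.pi⁻¹ * (1 + s ^ 2)⁻¹) +
        2 * y ^ 2 * Real.pi⁻¹ * (1 + (t + y * s) ^ 2)⁻¹) := by
    intro s
    rw [norm_mul, Complex.norm_real, Real.norm_of_nonneg (cauchyDensity_nonneg s)]
    have hp := Real.pi_pos
    set u := t + y * s with hu
    have e1 : 0 < 1 + s ^ 2 := by positivity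
    have e2 : 0 < 1 + u ^ 2 := by positivity
    have e3 : 0 < 1 + t ^ 2 := by positivity
    have key : (1 + s ^ 2)⁻¹ * (1 + u ^ 2)⁻¹ ≤
        (1 + t ^ 2)⁻¹ * (2 * (1 + s ^ 2)⁻¹ + 2 * y ^ 2 * (1 + u ^ 2)⁻¹) := by
      have e4 : 1 + t ^ 2 ≤ 2 * (1 + u ^ 2) + 2 * y ^ 2 * (1 + s ^ 2) := by
        have : t = u - y * s := by rw [hu]; ring
        rw [this]
        nlinarith [sq_nonneg (u + y * s), sq_nonneg y]
      have e5 : (1 + t ^ 2)⁻¹ * (2 * (1 + s ^ 2)⁻¹ + 2 * y ^ 2 * (1 + u ^ 2)⁻¹) =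
          (1 + s ^ 2)⁻¹ * (1 + u ^ 2)⁻¹ *
            ((1 + t ^ 2)⁻¹ * (2 * (1 + u ^ 2) + 2 * y ^ 2 * (1 + s ^ 2))) := by
        field_simp
      rw [e5]
      refine le_mul_of_one_le_right (by positivity) ?_
      rw [← div_eq_inv_mul, one_le_div e3]
      exact e4
    calc Real.pi⁻¹ * (1 + s ^ 2)⁻¹ * ‖φ u‖
        ≤ Real.pi⁻¹ * (1 + s ^ 2)⁻¹ * (C * (1 + u ^ 2)⁻¹) := by gcongr; exact hC u
      _ = Real.pi⁻¹ * C * ((1 + s ^ 2)⁻¹ * (1 + u ^ 2)⁻¹) := by ring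
      _ ≤ Real.pi⁻¹ * C * ((1 + t ^ 2)⁻¹ * (2 * (1 + s ^ 2)⁻¹ + 2 * y ^ 2 * (1 + u ^ 2)⁻¹)) := by
          gcongr
      _ = _ := by ring
  have hint1 := integrable_cauchyDensity.const_mul 2
  have hint2 := (integrable_weight_comp hy t).const_mul (2 * y ^ 2 * Real.pi⁻¹)
  refine (integral_mono_of_nonneg (Eventually.of_forall fun s => norm_nonneg _)
    ((hint1.add hint2).const_mul _) (Eventually.of_forall h1)).trans ?_
  have : ∫ s : ℝ, C * (1 + t ^ 2)⁻¹ * (2 * (Real.pi⁻¹ * (1 + s ^ 2)⁻¹) +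
        2 * y ^ 2 * Real.pi⁻¹ * (1 + (t + y * s) ^ 2)⁻¹) = C * (2 + 2 * y) * (1 + t ^ 2)⁻¹ := by
    rw [integral_const_mul, integral_add hint1 hint2,
      integral_const_mul, integral_const_mul, integral_const_mul, integral_univ_inv_one_add_sq,
      integral_weight_comp hy]
    have := Real.pi_pos
    field_simp
  exact this.le

theorem poissonMean_eq_integral (φ : ℝ → ℂ) {y : ℝ} (hy : 0 < y) (t : ℝ) :
    poissonMean φ y t =
      ∫ x : ℝ, φ x * ((y / Real.pi / ((x - t) ^ 2 + y ^ 2) : ℝ) : ℂ) := by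
  have h := Measure.integral_comp_mul_left
    (fun x : ℝ => φ (t + x) * ((y / Real.pi / (((t + x) - t) ^ 2 + y ^ 2) : ℝ) : ℂ)) y
  rw [integral_add_left_eq_self
    (fun x : ℝ => φ x * ((y / Real.pi / ((x - t) ^ 2 + y ^ 2) : ℝ) : ℂ))] at h
  have h2 : ∫ x : ℝ, φ x * ((y / Real.pi / ((x - t) ^ 2 + y ^ 2) : ℝ) : ℂ) =
      y • ∫ s : ℝ, φ (t + y * s) *
        ((y / Real.pi / (((t + y * s) - t) ^ 2 + y ^ 2) : ℝ) : ℂ) := by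
    rw [h, abs_of_pos (inv_pos.2 hy), smul_smul, mul_inv_cancel₀ hy.ne', one_smul]
  rw [h2, poissonMean, ← integral_smul]
  congr 1
  ext s
  rw [Complex.real_smul, mul_left_comm, mul_comm _ (φ _)]
  congr 1
  rw [← Complex.ofReal_mul]
  congr 1
  have := Real.pi_pos
  have e : t + y * s - t = y * s := by ring
  rw [e]
  have : (y * s) ^ 2 + y ^ 2 = y ^ 2 * (1 + s ^ 2) := by ring
  rw [this]
  field_simp

theorem integrable_poisson_prod {ν : Measure ℝ} [SFinite ν]
    (hν : Integrable (fun t : ℝ => (1 + t ^ 2)⁻¹) ν) (hφ : Continuous φ)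
    (hC : ∀ x, ‖φ x‖ ≤ C * (1 + x ^ 2)⁻¹) {y : ℝ} (hy : 0 < y) :
    Integrable (fun p : ℝ × ℝ => φ p.1 * ((y / Real.pi / ((p.1 - p.2) ^ 2 + y ^ 2) : ℝ) : ℂ))
      (volume.prod ν) := by
  have hcont : Continuous fun p : ℝ × ℝ =>
      φ p.1 * ((y / Real.pi / ((p.1 - p.2) ^ 2 + y ^ 2) : ℝ) : ℂ) := by
    refine (hφ.comp continuous_fst).mul (continuous_ofReal.comp ?_)
    exact continuous_const.div (by fun_prop) fun p => by positivity
  rw [integrable_prod_iff' hcont.aestronglyMeasurable]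
  have hC0 := weight_const_nonneg hC
  have hφi : Integrable φ := (integrable_inv_one_add_sq.const_mul C).mono'
    hφ.aestronglyMeasurable (Eventually.of_forall hC)
  constructor
  · refine Eventually.of_forall fun t => ?_
    refine Integrable.mono' (hφi.norm.mul_const (y / Real.pi / y ^ 2))
      (hcont.comp (by fun_prop : Continuous fun x : ℝ => (x, t))).aestronglyMeasurable
      (Eventually.of_forall fun x => ?_)
    have hp := Real.pi_pos
    rw [norm_mul, Complex.norm_real, Real.norm_of_nonneg (by positivity)]
    gcongr
    nlinarith [sq_nonneg (x - t)]
  · refine (hν.const_mul (C * (2 + 2 * y))).mono'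
      (hcont.norm.stronglyMeasurable.integral_prod_left'
        (f := fun p : ℝ × ℝ =>
          ‖φ p.1 * ((y / Real.pi / ((p.1 - p.2) ^ 2 + y ^ 2) : ℝ) : ℂ)‖)).aestronglyMeasurable
      (Eventually.of_forall fun t => ?_)
    rw [Real.norm_of_nonneg (integral_nonneg fun x => norm_nonneg _)]
    have h1 : ∫ x : ℝ, ‖φ x * ((y / Real.pi / ((x - t) ^ 2 + y ^ 2) : ℝ) : ℂ)‖ =
        ∫ s : ℝ, ‖((Real.pi⁻¹ * (1 + s ^ 2)⁻¹ : ℝ) : ℂ) * φ (t + y * s)‖ := by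
      have h2 := poissonMean_eq_integral (fun x => ((‖φ x‖ : ℝ) : ℂ)) hy t
      have h3 : ∀ x : ℝ, ‖φ x * ((y / Real.pi / ((x - t) ^ 2 + y ^ 2) : ℝ) : ℂ)‖ =
          ‖φ x‖ * (y / Real.pi / ((x - t) ^ 2 + y ^ 2)) := fun x => by
        have hp := Real.pi_pos
        rw [norm_mul, Complex.norm_real, Real.norm_of_nonneg (by positivity)]
      have h4 : ∀ s : ℝ, ‖((Real.pi⁻¹ * (1 + s ^ 2)⁻¹ : ℝ) : ℂ) * φ (t + y * s)‖ =
          (Real.pi⁻¹ * (1 + s ^ 2)⁻¹) * ‖φ (t + y * s)‖ := fun s => by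
        rw [norm_mul, Complex.norm_real, Real.norm_of_nonneg (cauchyDensity_nonneg s)]
      simp_rw [h3, h4]
      rw [poissonMean] at h2
      simp_rw [← Complex.ofReal_mul] at h2
      rw [integral_complex_ofReal, integral_complex_ofReal, Complex.ofReal_inj] at h2
      exact h2.symm
    change ∫ x : ℝ, ‖φ x * ((y / Real.pi / ((x - t) ^ 2 + y ^ 2) : ℝ) : ℂ)‖ ≤ _
    rw [h1]
    exact integral_norm_poissonIntegrand_le hC hy t

theorem integral_poisson_swap {ν : Measure ℝ} [SFinite ν]
    (hν : Integrable (fun t : ℝ => (1 + t ^ 2)⁻¹) ν) (hφ : Continuous φ)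
    (hC : ∀ x, ‖φ x‖ ≤ C * (1 + x ^ 2)⁻¹) {y : ℝ} (hy : 0 < y) :
    ∫ x : ℝ, φ x * ∫ t : ℝ, ((y / Real.pi / ((x - t) ^ 2 + y ^ 2) : ℝ) : ℂ) ∂ν =
      ∫ t : ℝ, poissonMean φ y t ∂ν := by
  have h := integral_integral_swap (μ := volume) (ν := ν)
    (f := fun x t : ℝ => φ x * ((y / Real.pi / ((x - t) ^ 2 + y ^ 2) : ℝ) : ℂ))
    (integrable_poisson_prod hν hφ hC hy)
  simp_rw [integral_const_mul] at h
  rw [h]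
  congr 1
  ext t
  rw [poissonMean_eq_integral φ hy]

theorem integrable_poisson_left {ν : Measure ℝ} [SFinite ν]
    (hν : Integrable (fun t : ℝ => (1 + t ^ 2)⁻¹) ν) (hφ : Continuous φ)
    (hC : ∀ x, ‖φ x‖ ≤ C * (1 + x ^ 2)⁻¹) {y : ℝ} (hy : 0 < y) :
    Integrable fun x : ℝ => φ x * ∫ t : ℝ, ((y / Real.pi / ((x - t) ^ 2 + y ^ 2) : ℝ) : ℂ) ∂ν := by
  have h := (integrable_poisson_prod hν hφ hC hy).integral_prod_left
  simpa only [integral_const_mul] using h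

namespace RealMeasure

instance (μ : RealMeasure) : IsLocallyFiniteMeasure μ.pos := μ.pos_locallyFinite
instance (μ : RealMeasure) : IsLocallyFiniteMeasure μ.neg := μ.neg_locallyFinite

end RealMeasure

theorem add_conj_eq (w : ℂ) : w + conj w = ((2 * w.re : ℝ) : ℂ) := by
  apply Complex.ext <;> simp; ring

variable {f : ℂ → ℂ} {μ : RealMeasure}

/-- On the diagonal w = z the kernel identity is the Poisson formula. -/
theorem KernelIdentity.two_re_eq (hK : KernelIdentity f μ) {y : ℝ} (hy : 0 < y) (x : ℝ) :
    ((2 * (f (x + y * I)).re : ℝ) : ℂ) =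
      μ.integral fun t => ((y / Real.pi / ((x - t) ^ 2 + y ^ 2) : ℝ) : ℂ) := by
  have hz : (x + y * I : ℂ) ∈ upperHalf := by simpa [upperHalf] using hy
  have h := hK _ hz _ hz
  have hyc : (y : ℂ) ≠ 0 := by exact_mod_cast hy.ne'
  have hpc : (Real.pi : ℂ) ≠ 0 := by exact_mod_cast Real.pi_ne_zero
  have h1 : (x + y * I : ℂ) - conj (x + y * I : ℂ) = 2 * I * y := by
    simp; ring
  rw [add_conj_eq, h1, div_eq_iff (by simp [hyc])] at h
  rw [h]
  have h2 : (fun t : ℝ => ((y / Real.pi / ((x - t) ^ 2 + y ^ 2) : ℝ) : ℂ)) =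
      fun t : ℝ => ((y / Real.pi : ℝ) : ℂ) *
        (1 / (((x + y * I : ℂ) - t) * (conj (x + y * I : ℂ) - t))) := by
    ext t
    have h3 : ((x + y * I : ℂ) - t) * (conj (x + y * I : ℂ) - t) =
        (((x - t) ^ 2 + y ^ 2 : ℝ) : ℂ) := by
      push_cast
      simp only [map_add, map_mul, conj_I, conj_ofReal]
      ring_nf
      rw [I_sq]; ring
    rw [h3, mul_one_div, Complex.ofReal_div]
  rw [h2, RealMeasure.integral_const_mul']
  push_cast
  field_simp

/-- A tame measure is the boundary value of twice the real part of the function it represents. -/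
theorem KernelIdentity.tendsto_boundary (hμ : μ.Tame) (hK : KernelIdentity f μ)
    (hφ : Continuous φ) (hC : ∀ x, ‖φ x‖ ≤ C * (1 + x ^ 2)⁻¹) :
    Tendsto (fun y : ℝ => ∫ x : ℝ, φ x * ((2 * (f (x + y * I)).re : ℝ) : ℂ)) (𝓝[>] 0)
      (𝓝 (μ.integral φ)) := by
  have hC0 := weight_const_nonneg hC
  have hev : ∀ᶠ y : ℝ in 𝓝[>] 0, μ.integral (poissonMean φ y) =
      ∫ x : ℝ, φ x * ((2 * (f (x + y * I)).re : ℝ) : ℂ) := by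
    filter_upwards [self_mem_nhdsWithin] with y hy
    have hy : 0 < y := hy
    have hp := (show Integrable (fun t : ℝ => (1 + t ^ 2)⁻¹) μ.variation from hμ).mono_measure
      (Measure.le_add_right le_rfl : μ.pos ≤ μ.variation)
    have hn := (show Integrable (fun t : ℝ => (1 + t ^ 2)⁻¹) μ.variation from hμ).mono_measure
      (Measure.le_add_left le_rfl : μ.neg ≤ μ.variation)
    unfold RealMeasure.integral
    rw [← integral_poisson_swap hp hφ hC hy, ← integral_poisson_swap hn hφ hC hy,
      ← integral_sub (integrable_poisson_left hp hφ hC hy)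
        (integrable_poisson_left hn hφ hC hy)]
    congr 1
    ext x
    rw [hK.two_re_eq hy, RealMeasure.integral]
    ring
  refine Tendsto.congr' hev ?_
  -- The 4 bounds the factor 2 + 2y for y < 1.
  refine RealMeasure.tendsto_integral_of_dominated
    (b := fun t => C * 4 * (1 + t ^ 2)⁻¹) ?_ (Integrable.const_mul hμ _) ?_
    (tendsto_poissonMean hφ hC)
  · exact Eventually.of_forall fun y => (continuous_poissonMean hφ hC y).aestronglyMeasurable
  · have h1 : ∀ᶠ y : ℝ in 𝓝[>] 0, y < 1 := nhdsWithin_le_nhds (gt_mem_nhds one_pos)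
    filter_upwards [self_mem_nhdsWithin, h1] with y hy hy1 t
    refine (norm_integral_le_integral_norm _).trans
      ((integral_norm_poissonIntegrand_le hC hy t).trans ?_)
    gcongr
    linarith

namespace RealMeasure

/-- This is the minimality of the Jordan decomposition, written with sums because the measures may
be infinite. The measure p is carried by a set where n vanishes; there the identity reads p + n' =
p'. The other half is symmetric. -/
theorem le_of_add_eq_add {p n p' n' : Measure ℝ} (h : p + n' = p' + n)
    (hs : Measure.MutuallySingular p n) : p ≤ p' ∧ n ≤ n' := by
  obtain ⟨s, hsm, hp, hn⟩ := hs
  have hA : ∀ A, p A + n' A = p' A + n A := fun A => by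
    have := congrArg (fun ν : Measure ℝ => ν A) h
    simpa using this
  constructor
  · refine Measure.le_iff.2 fun A hAm => ?_
    have h1 : p A ≤ p (A ∩ sᶜ) := by
      calc p A ≤ p (A ∩ s ∪ A ∩ sᶜ) := by rw [Set.inter_union_compl]
        _ ≤ p (A ∩ s) + p (A ∩ sᶜ) := measure_union_le _ _
        _ = p (A ∩ sᶜ) := by rw [measure_mono_null Set.inter_subset_right hp, zero_add]
    have h2 := hA (A ∩ sᶜ)
    rw [measure_mono_null Set.inter_subset_right hn, add_zero] at h2
    calc p A ≤ p (A ∩ sᶜ) := h1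
      _ ≤ p (A ∩ sᶜ) + n' (A ∩ sᶜ) := le_self_add
      _ = p' (A ∩ sᶜ) := h2
      _ ≤ p' A := measure_mono Set.inter_subset_left
  · refine Measure.le_iff.2 fun A hAm => ?_
    have h1 : n A ≤ n (A ∩ s) := by
      calc n A ≤ n (A ∩ s ∪ A ∩ sᶜ) := by rw [Set.inter_union_compl]
        _ ≤ n (A ∩ s) + n (A ∩ sᶜ) := measure_union_le _ _
        _ = n (A ∩ s) := by rw [measure_mono_null Set.inter_subset_right hn, add_zero]
    have h2 := hA (A ∩ s)
    rw [measure_mono_null Set.inter_subset_right hp, zero_add] at h2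
    calc n A ≤ n (A ∩ s) := h1
      _ ≤ p' (A ∩ s) + n (A ∩ s) := le_add_self
      _ = n' (A ∩ s) := h2.symm
      _ ≤ n' A := measure_mono Set.inter_subset_left

theorem isLocallyFiniteMeasure_add (p n : Measure ℝ) [IsLocallyFiniteMeasure p]
    [IsLocallyFiniteMeasure n] : IsLocallyFiniteMeasure (p + n) := by
  refine ⟨fun x => ?_⟩
  obtain ⟨s, hs, hs'⟩ := p.finiteAt_nhds x
  obtain ⟨t, ht, ht'⟩ := n.finiteAt_nhds x
  refine ⟨s ∩ t, inter_mem hs ht, ?_⟩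
  rw [Measure.add_apply]
  exact ENNReal.add_lt_top.2 ⟨(measure_mono Set.inter_subset_left).trans_lt hs',
    (measure_mono Set.inter_subset_right).trans_lt ht'⟩

theorem eq_of_add_eq_add {μ ν : RealMeasure} (h : μ.pos + ν.neg = ν.pos + μ.neg) : μ = ν := by
  have h1 := le_of_add_eq_add h μ.mutuallySingular
  have h2 := le_of_add_eq_add h.symm ν.mutuallySingular
  exact RealMeasure.ext (le_antisymm h1.1 h2.1) (le_antisymm h1.2 h2.2)

end RealMeasure

/-- Both measures are the boundary value of 2 Re f on compactly supported continuous functions,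
which determine them. -/
theorem KernelIdentity.unique {μ ν : RealMeasure} (hμ : μ.Tame) (hν : ν.Tame)
    (hKμ : KernelIdentity f μ) (hKν : KernelIdentity f ν) : μ = ν := by
  refine RealMeasure.eq_of_add_eq_add ?_
  have := RealMeasure.isLocallyFiniteMeasure_add μ.pos ν.neg
  have := RealMeasure.isLocallyFiniteMeasure_add ν.pos μ.neg
  refine Measure.ext_of_integral_eq_on_compactlySupported fun g => ?_
  have hg : Continuous fun x => ((g x : ℝ) : ℂ) := continuous_ofReal.comp g.continuous
  obtain ⟨C, hC⟩ : ∃ C : ℝ, ∀ x, ‖((g x : ℝ) : ℂ)‖ ≤ C * (1 + x ^ 2)⁻¹ := by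
    have hk : HasCompactSupport fun x : ℝ => g x * (1 + x ^ 2) :=
      g.hasCompactSupport.mul_right
    obtain ⟨C, hC⟩ := hk.exists_bound_of_continuous (by fun_prop)
    refine ⟨C, fun x => ?_⟩
    have h0 : 0 < 1 + x ^ 2 := by positivity
    rw [← div_eq_mul_inv, le_div_iff₀ h0, Complex.norm_real]
    have := hC x
    rwa [norm_mul, Real.norm_of_nonneg h0.le] at this
  have h := tendsto_nhds_unique (hKμ.tendsto_boundary hμ hg hC) (hKν.tendsto_boundary hν hg hC)
  unfold RealMeasure.integral at h
  simp_rw [integral_complex_ofReal] at h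
  have h' : (∫ x, g x ∂μ.pos) - ∫ x, g x ∂μ.neg = (∫ x, g x ∂ν.pos) - ∫ x, g x ∂ν.neg := by
    exact_mod_cast h
  have hi : ∀ (m : Measure ℝ) [IsLocallyFiniteMeasure m], Integrable (fun x => g x) m :=
    fun m _ => g.continuous.integrable_of_hasCompactSupport g.hasCompactSupport
  rw [integral_add_measure (hi _) (hi _), integral_add_measure (hi _) (hi _)]
  linarith

/-! ### Harmonic functions in the disc with bounded circle averages -/

open Real (circleAverage)
open Metric (ball closedBall sphere)

/-- These are the terms by which the zeros of F enter Jensen's formula: multiplicities are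
nonnegative and zeros have modulus at most r. -/
theorem log_circle_term_nonneg {F : ℂ → ℂ} {r : ℝ} (hr : 0 < r)
    (hF : AnalyticOnNhd ℂ F (closedBall 0 |r|)) (u : ℂ) :
    0 ≤ (MeromorphicOn.divisor F (closedBall 0 |r|) u : ℝ) * Real.log (r * ‖0 - u‖⁻¹) := by
  by_cases hu : u ∈ closedBall (0 : ℂ) |r|
  · refine mul_nonneg (by exact_mod_cast MeromorphicOn.AnalyticOnNhd.divisor_nonneg hF u) ?_
    rcases eq_or_ne u 0 with rfl | hu0
    · simp
    · apply Real.log_nonneg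
      have h0 : 0 < ‖u‖ := norm_pos_iff.2 hu0
      rw [zero_sub, norm_neg, ← div_eq_mul_inv, one_le_div h0]
      simpa [abs_of_pos hr] using hu
  · rw [Function.locallyFinsuppWithin.apply_eq_zero_of_notMem _ hu]; simp

/-- By Jensen's formula the circle average of log|F| is at least log|F 0|, since the zeros
contribute nonnegatively. -/
theorem circleAverage_abs_le {u : ℂ → ℝ} {F : ℂ → ℂ} {r : ℝ} (hr : 0 < r)
    (hF : AnalyticOnNhd ℂ F (closedBall 0 r)) (hF0 : F 0 ≠ 0) (hu : ContinuousOn u (closedBall 0 r))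
    (hle : ∀ z ∈ closedBall (0 : ℂ) r, F z ≠ 0 → |u z| ≤ -Real.log ‖F z‖) :
    circleAverage (fun z => |u z|) 0 r ≤ -Real.log ‖F 0‖ := by
  have hr' : |r| = r := abs_of_pos hr
  have hsub : sphere (0 : ℂ) |r| ⊆ closedBall 0 r := hr'.symm ▸ Metric.sphere_subset_closedBall
  have hcod : F ⁻¹' {0}ᶜ ∈ codiscreteWithin (sphere (0 : ℂ) |r|) := by
    refine codiscreteWithin_mono hsub ?_
    exact hF.preimage_zero_mem_codiscreteWithin hF0 (by simp [hr.le])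
      (Metric.isConnected_closedBall hr.le)
  -- At a zero of F the default value log 0 = 0 spoils the pointwise bound. The zeros are isolated,
  -- so replacing |u| by 0 there does not change the average.
  set f₂ : ℂ → ℝ := fun z => if F z = 0 then 0 else |u z| with hf₂
  have heq : (fun z => |u z|) =ᶠ[codiscreteWithin (sphere (0 : ℂ) |r|)] f₂ := by
    filter_upwards [hcod] with z hz
    have : F z ≠ 0 := hz
    simp [hf₂, this]
  have hint : CircleIntegrable (fun z => |u z|) 0 r :=
    (hu.abs.mono Metric.sphere_subset_closedBall).circleIntegrable hr.le
  have hlog : CircleIntegrable (fun z => Real.log ‖F z‖) 0 r :=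
    MeromorphicOn.circleIntegrable_log_norm (hF.mono hsub).meromorphicOn
  rw [Real.circleAverage_congr_codiscreteWithin heq hr.ne']
  have h1 : circleAverage f₂ 0 r ≤ circleAverage (fun z => -Real.log ‖F z‖) 0 r := by
    refine Real.circleAverage_mono (hint.congr_codiscreteWithin heq) hlog.neg fun z hz => ?_
    by_cases h0 : F z = 0
    · simp [hf₂, h0]
    · simpa [hf₂, h0] using hle z (hsub hz) h0
  have h2 : circleAverage (fun z => -Real.log ‖F z‖) 0 r =
      -circleAverage (fun z => Real.log ‖F z‖) 0 r := by
    have := Real.circleAverage_fun_smul (a := (-1 : ℝ)) (f := fun z => Real.log ‖F z‖)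
      (c := 0) (R := r)
    simpa using this
  have hF' : AnalyticOnNhd ℂ F (closedBall 0 |r|) := hr'.symm ▸ hF
  have h3 := AnalyticOnNhd.circleAverage_log_norm hr.ne' hF' hF0
  have h4 := finsum_nonneg fun u => log_circle_term_nonneg hr hF' u
  rw [h2, h3] at h1
  linarith

/-- The Herglotz formula on the unit circle. -/
theorem herglotz_unit {g : ℂ → ℂ} {R : ℝ} (hR : 1 < R) (hg : DifferentiableOn ℂ g (ball 0 R)) {w : ℂ}
    (hw : w ∈ ball (0 : ℂ) 1) :
    g w = (g 0).im * I +
      circleAverage (fun ζ => herglotzRieszKernel 0 w ζ • (((g ζ).re : ℝ) : ℂ)) 0 1 := by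
  set H : ℂ → ℂ := fun w =>
    circleAverage (fun ζ => herglotzRieszKernel 0 w ζ • (((g ζ).re : ℝ) : ℂ)) 0 1 with hH
  have hsub : closedBall (0 : ℂ) 1 ⊆ ball 0 R := Metric.closedBall_subset_ball hR
  have hcont : ContinuousOn (fun ζ => (g ζ).re) (sphere (0 : ℂ) 1) :=
    Complex.continuous_re.comp_continuousOn
      (hg.continuousOn.mono (Metric.sphere_subset_closedBall.trans hsub))
  have hci : CircleIntegrable (fun ζ => (g ζ).re) 0 1 := hcont.circleIntegrable zero_le_one
  have hci' : CircleIntegrable (fun ζ => (((g ζ).re : ℝ) : ℂ)) 0 1 :=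
    (continuous_ofReal.comp_continuousOn hcont).circleIntegrable zero_le_one
  have hHd : DifferentiableOn ℂ H (ball 0 1) :=
    differentiableOn_circleAverage_herglotzRieszKernel_smul hci'
  have hgd : DifferentiableOn ℂ g (ball 0 1) := hg.mono (Metric.ball_subset_ball hR.le)
  -- Both functions have the Poisson integral of Re g as real part, so they differ by an imaginary
  -- constant, to be read off at 0, where the kernel is 1 and H is real.
  have hre : ∀ v ∈ ball (0 : ℂ) 1, (g v - H v).re = 0 := by
    intro v hv
    have h1 := re_circleAverage_herglotzRieszKernel_smul hci hv
    have h2 : DiffContOnCl ℂ g (ball 0 1) := by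
      refine DifferentiableOn.diffContOnCl ?_
      rw [closure_ball _ one_ne_zero]
      exact hg.mono hsub
    have h3 := h2.circleAverage_re_herglotzRieszKernel_smul hv
    have h4 := congrArg Complex.re h3
    have h5 : CircleIntegrable ((re ∘ herglotzRieszKernel 0 v) • g) 0 1 := by
      refine ContinuousOn.circleIntegrable zero_le_one (ContinuousOn.smul ?_ ?_)
      · have := continuousOn_herglotzRieszKernel_sphere hv
        rw [abs_one] at this
        exact Complex.continuous_re.comp_continuousOn this
      · exact hg.continuousOn.mono (Metric.sphere_subset_closedBall.trans hsub)
    have h6 := Complex.reCLM.circleAverage_comp_comm h5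
    have h7 : (⇑reCLM ∘ ((re ∘ herglotzRieszKernel 0 v) • g)) =
        ((re ∘ herglotzRieszKernel 0 v) • fun ζ => (g ζ).re) := by
      ext ζ; simp
    rw [h7] at h6
    have h8 : reCLM (circleAverage ((re ∘ herglotzRieszKernel 0 v) • g) 0 1) = (g v).re := h4
    rw [Complex.sub_re, hH, h1, h6, h8, sub_self]
  have hana : AnalyticOnNhd ℂ (fun v => g v - H v) (ball 0 1) :=
    (hgd.sub hHd).analyticOnNhd Metric.isOpen_ball
  obtain ⟨c, hc⟩ := hana.eq_const_of_re_eq_const hre Metric.isOpen_ball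
    ((convex_ball _ _).isConnected ⟨0, by simp⟩)
  have h0 : (0 : ℂ) ∈ ball (0 : ℂ) 1 := by simp
  have hH0 : H 0 = (((H 0).re : ℝ) : ℂ) := by
    have : H 0 = ((circleAverage (fun ζ => (g ζ).re) 0 1 : ℝ) : ℂ) := by
      have e := Complex.ofRealCLM.circleAverage_comp_comm hci
      simp only [Complex.ofRealCLM_apply] at e
      rw [← e, hH]
      refine Real.circleAverage_congr_sphere fun ζ hζ => ?_
      have hζ0 : ζ ≠ 0 := by
        rintro rfl; simp at hζ
      simp [herglotzRieszKernel_def, hζ0]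
    rw [this]; simp
  have e1 : g 0 - H 0 = (g 0).im * I := by
    apply Complex.ext
    · simpa using hre 0 h0
    · rw [hH0]; simp
  have e2 : g w - H w = g 0 - H 0 := by rw [hc w hw, hc 0 h0]
  change g w = _ + H w
  rw [← e1, ← e2]; ring

instance : MeasurableSpace Circle := borel Circle

instance : BorelSpace Circle := ⟨rfl⟩

theorem continuous_circle_coe : Continuous fun ζ : Circle => (ζ : ℂ) := continuous_subtype_val

/-- Normalised arc length on the circle. -/
def arcMeasure : Measure Circle :=
  ENNReal.ofReal (2 * Real.pi)⁻¹ • (volume.restrict (Set.Ioc 0 (2 * Real.pi))).map Circle.exp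

instance : IsFiniteMeasure arcMeasure := by
  unfold arcMeasure
  have := Measure.isFiniteMeasure_map (volume.restrict (Set.Ioc 0 (2 * Real.pi))) Circle.exp
  exact Measure.smul_finite _ ENNReal.ofReal_ne_top

theorem circleAverage_eq_arc {h : ℂ → ℂ} (hh : Continuous fun ζ : Circle => h ζ) :
    circleAverage h 0 1 = ∫ ζ : Circle, h ζ ∂arcMeasure := by
  have hp : 0 < (2 * Real.pi)⁻¹ := by positivity
  rw [arcMeasure, integral_smul_measure, integral_map Circle.exp.continuous.aemeasurable
    hh.aestronglyMeasurable, Real.circleAverage_def,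
    intervalIntegral.integral_of_le Real.two_pi_pos.le, ENNReal.toReal_ofReal hp.le]
  simp [circleMap]

theorem circleAverage_eq_arc_real {h : ℂ → ℝ} (hh : Continuous fun ζ : Circle => h ζ) :
    circleAverage h 0 1 = ∫ ζ : Circle, h ζ ∂arcMeasure := by
  have hp : 0 < (2 * Real.pi)⁻¹ := by positivity
  rw [arcMeasure, integral_smul_measure, integral_map Circle.exp.continuous.aemeasurable
    hh.aestronglyMeasurable, Real.circleAverage_def,
    intervalIntegral.integral_of_le Real.two_pi_pos.le, ENNReal.toReal_ofReal hp.le]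
  simp [circleMap]

/-- The sum of a Herglotz kernel and the conjugate of another one, on the unit circle. -/
def discKernel (w v ζ : ℂ) : ℂ := 2 * (1 - w * conj v) / ((ζ - w) * (conj ζ - conj v))

theorem circle_sub_ne_zero {w : ℂ} (hw : w ∈ ball (0 : ℂ) 1) (ζ : Circle) : (ζ : ℂ) - w ≠ 0 := by
  intro h
  rw [sub_eq_zero] at h
  rw [← h, mem_ball_zero_iff, Circle.norm_coe] at hw
  exact lt_irrefl _ hw

theorem circle_conj_sub_ne_zero {w : ℂ} (hw : w ∈ ball (0 : ℂ) 1) (ζ : Circle) :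
    conj (ζ : ℂ) - conj w ≠ 0 := by
  rw [← map_sub]
  exact (map_ne_zero _).2 (circle_sub_ne_zero hw ζ)

theorem continuous_discKernel {w v : ℂ} (hw : w ∈ ball (0 : ℂ) 1) (hv : v ∈ ball (0 : ℂ) 1) :
    Continuous fun ζ : Circle => discKernel w v ζ := by
  unfold discKernel
  refine continuous_const.div ?_ fun ζ =>
    mul_ne_zero (circle_sub_ne_zero hw ζ) (circle_conj_sub_ne_zero hv ζ)
  exact (continuous_circle_coe.sub continuous_const).mul
    ((continuous_conj.comp continuous_circle_coe).sub continuous_const)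

theorem herglotz_add_conj {w v : ℂ} (hw : w ∈ ball (0 : ℂ) 1) (hv : v ∈ ball (0 : ℂ) 1)
    (ζ : Circle) :
    herglotzRieszKernel 0 w ζ + conj (herglotzRieszKernel 0 v ζ) = discKernel w v ζ := by
  have h1 := circle_sub_ne_zero hw ζ
  have h2 := circle_conj_sub_ne_zero hv ζ
  have h3 : (ζ : ℂ) * conj (ζ : ℂ) = 1 := by
    rw [Complex.mul_conj, Complex.normSq_eq_norm_sq, Circle.norm_coe]; simp
  rw [herglotzRieszKernel_def, herglotzRieszKernel_def, discKernel]
  simp only [sub_zero, map_div₀, map_add, map_sub]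
  rw [div_add_div _ _ h1 h2, div_left_inj' (mul_ne_zero h1 h2)]
  linear_combination 2 * h3

/-- Adding the conjugate cancels the imaginary constant of the Herglotz formula and produces one
kernel in both points. -/
theorem herglotz_sum {g : ℂ → ℂ} {R : ℝ} (hR : 1 < R) (hg : DifferentiableOn ℂ g (ball 0 R))
    {w v : ℂ} (hw : w ∈ ball (0 : ℂ) 1) (hv : v ∈ ball (0 : ℂ) 1) :
    g w + conj (g v) = ∫ ζ : Circle, discKernel w v ζ * (((g ζ).re : ℝ) : ℂ) ∂arcMeasure := by
  have hgc : Continuous fun ζ : Circle => (((g ζ).re : ℝ) : ℂ) := by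
    refine continuous_ofReal.comp (Complex.continuous_re.comp ?_)
    refine hg.continuousOn.comp_continuous continuous_circle_coe fun ζ => ?_
    rw [mem_ball_zero_iff, Circle.norm_coe]
    exact hR
  have hk : ∀ {w : ℂ}, w ∈ ball (0 : ℂ) 1 →
      Continuous fun ζ : Circle => herglotzRieszKernel 0 w ζ • (((g ζ).re : ℝ) : ℂ) := by
    intro w hw
    refine Continuous.fun_smul ?_ hgc
    have := continuousOn_herglotzRieszKernel_sphere hw
    rw [abs_one] at this
    exact this.comp_continuous continuous_circle_coe fun ζ =>
      mem_sphere_zero_iff_norm.2 (Circle.norm_coe ζ)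
  have hi : ∀ {F : Circle → ℂ}, Continuous F → Integrable F arcMeasure := fun hF =>
    hF.integrable_of_hasCompactSupport (HasCompactSupport.of_compactSpace _)
  rw [herglotz_unit hR hg hw, herglotz_unit hR hg hv, circleAverage_eq_arc (hk hw),
    circleAverage_eq_arc (hk hv), map_add, ← _root_.integral_conj]
  have e : ∀ a b : ℂ, ((g 0).im : ℂ) * I + a + (conj (((g 0).im : ℂ) * I) + b) = a + b := by
    intro a b
    simp only [map_mul, conj_ofReal, conj_I]
    ring
  have hkc : Continuous fun ζ : Circle =>
      conj (herglotzRieszKernel 0 v ζ • (((g ζ).re : ℝ) : ℂ)) :=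
    Complex.continuous_conj.comp (hk hv)
  rw [e]
  refine (integral_add (hi (hk hw)) (hi hkc)).symm.trans ?_
  congr 1
  ext ζ
  rw [← herglotz_add_conj hw hv]
  simp only [smul_eq_mul, map_mul, conj_ofReal]
  ring

/-- The part of a continuous density on the circle selected by `ENNReal.ofReal`. -/
def arcDensity (ρ : Circle → ℝ) : Measure Circle :=
  arcMeasure.withDensity fun ζ => ENNReal.ofReal (ρ ζ)

theorem integrable_arc {E : Type*} [NormedAddCommGroup E] {F : Circle → E} (hF : Continuous F) :
    Integrable F arcMeasure :=
  hF.integrable_of_hasCompactSupport (HasCompactSupport.of_compactSpace _)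

theorem arcDensity_univ_le {ρ : Circle → ℝ} (hρ : Continuous ρ) {L : ℝ}
    (hL : ∫ ζ, |ρ ζ| ∂arcMeasure ≤ L) : arcDensity ρ Set.univ ≤ ENNReal.ofReal L := by
  rw [arcDensity, withDensity_apply _ MeasurableSet.univ, Measure.restrict_univ]
  calc ∫⁻ ζ, ENNReal.ofReal (ρ ζ) ∂arcMeasure
      ≤ ∫⁻ ζ, ENNReal.ofReal |ρ ζ| ∂arcMeasure :=
        lintegral_mono fun ζ => ENNReal.ofReal_le_ofReal (le_abs_self _)
    _ = ENNReal.ofReal (∫ ζ, |ρ ζ| ∂arcMeasure) :=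
        (ofReal_integral_eq_lintegral_ofReal (integrable_arc hρ.abs)
          (Eventually.of_forall fun ζ => abs_nonneg _)).symm
    _ ≤ _ := ENNReal.ofReal_le_ofReal hL

theorem integral_arcDensity {ρ : Circle → ℝ} (hρ : Continuous ρ) (k : Circle → ℂ) :
    ∫ ζ, k ζ ∂arcDensity ρ = ∫ ζ, ((max (ρ ζ) 0 : ℝ) : ℂ) * k ζ ∂arcMeasure := by
  have h := integral_withDensity_eq_integral_smul (μ := arcMeasure)
    (f := fun ζ => (ρ ζ).toNNReal) hρ.measurable.real_toNNReal k
  refine Eq.trans h (integral_congr_ae (Eventually.of_forall fun ζ => ?_))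
  change (((ρ ζ).toNNReal : ℝ)) • k ζ = _
  rw [Real.coe_toNNReal', Complex.real_smul]

theorem integral_arcDensity_sub {ρ : Circle → ℝ} (hρ : Continuous ρ) {k : Circle → ℂ}
    (hk : Continuous k) :
    (∫ ζ, k ζ ∂arcDensity ρ) - ∫ ζ, k ζ ∂arcDensity (fun ζ => -ρ ζ) =
      ∫ ζ, k ζ * ((ρ ζ : ℝ) : ℂ) ∂arcMeasure := by
  rw [integral_arcDensity hρ, integral_arcDensity (ρ := fun ζ => -ρ ζ) hρ.neg, ← integral_sub]
  · congr 1
    ext ζ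
    rw [← sub_mul, mul_comm, ← Complex.ofReal_sub]
    congr 2
    rcases le_total (ρ ζ) 0 with h | h
    · rw [max_eq_right h, max_eq_left (by linarith)]; ring
    · rw [max_eq_left h, max_eq_right (by linarith)]; ring
  · exact integrable_arc ((continuous_ofReal.comp (hρ.max continuous_const)).mul hk)
  · exact integrable_arc ((continuous_ofReal.comp (hρ.neg.max continuous_const)).mul hk)

/-- A holomorphic function in the disc whose real part has bounded circle averages is the
Herglotz integral of a difference of two finite measures. -/
theorem exists_disc_measures {g : ℂ → ℂ} (hg : DifferentiableOn ℂ g (ball 0 1)) {L : ℝ}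
    (hL : ∀ r ∈ Set.Ioo (0 : ℝ) 1, circleAverage (fun z => |(g z).re|) 0 r ≤ L) :
    ∃ p n : Measure Circle, IsFiniteMeasure p ∧ IsFiniteMeasure n ∧
      ∀ w ∈ ball (0 : ℂ) 1, ∀ v ∈ ball (0 : ℂ) 1, g w + conj (g v) =
        (∫ ζ : Circle, discKernel w v ζ ∂p) - ∫ ζ : Circle, discKernel w v ζ ∂n := by
  obtain ⟨r, hr, hlim⟩ : ∃ r : ℕ → ℝ, (∀ k, r k ∈ Set.Ioo (0 : ℝ) 1) ∧
      Tendsto r atTop (𝓝 1) := by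
    -- The shift by 2 keeps the radius positive at k = 0.
    refine ⟨fun k => 1 - 1 / ((k : ℝ) + 2), fun k => ⟨?_, ?_⟩, ?_⟩
    · have h2 : (0 : ℝ) < (k : ℝ) + 2 := by positivity
      rw [sub_pos, div_lt_one h2]
      have : (0 : ℝ) ≤ k := k.cast_nonneg
      linarith
    · have : (0 : ℝ) < 1 / ((k : ℝ) + 2) := by positivity
      linarith
    · have h1 := (tendsto_one_div_add_atTop_nhds_zero_nat (𝕜 := ℝ)).comp (tendsto_add_atTop_nat 1)
      have h2 : Tendsto (fun k : ℕ => 1 - 1 / ((k : ℝ) + 2)) atTop (𝓝 (1 - 0)) := by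
        refine tendsto_const_nhds.sub (h1.congr fun k => ?_)
        simp only [Function.comp_apply]
        push_cast
        congr 1; ring
      simpa using h2
  set ρ : ℕ → Circle → ℝ := fun k ζ => (g (r k * ζ)).re with hρd
  have hmem : ∀ k (ζ : Circle), (r k * ζ : ℂ) ∈ ball (0 : ℂ) 1 := by
    intro k ζ
    rw [mem_ball_zero_iff, norm_mul, Circle.norm_coe, mul_one, Complex.norm_real,
      Real.norm_of_nonneg (hr k).1.le]
    exact (hr k).2
  have hρ : ∀ k, Continuous (ρ k) := fun k => by
    refine Complex.continuous_re.comp ?_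
    exact hg.continuousOn.comp_continuous (continuous_const.mul continuous_circle_coe) (hmem k)
  have hint : ∀ k, ∫ ζ, |ρ k ζ| ∂arcMeasure ≤ L := by
    intro k
    have h1 := hL (r k) (hr k)
    rw [Real.circleAverage_eq_circleAverage_zero_one] at h1
    simp only [add_zero] at h1
    rwa [circleAverage_eq_arc_real (h := fun z => |(g (r k * z)).re|) (hρ k).abs] at h1
  have hint' : ∀ k, ∫ ζ, |-ρ k ζ| ∂arcMeasure ≤ L := fun k => by simpa using hint k
  have hfin : ∀ {σ : Circle → ℝ}, Continuous σ → ∫ ζ, |σ ζ| ∂arcMeasure ≤ L →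
      IsFiniteMeasure (arcDensity σ) := fun hσ h =>
    ⟨(arcDensity_univ_le hσ h).trans_lt ENNReal.ofReal_lt_top⟩
  -- The positive part of the density Re g(r_k ζ), followed by the negative part; the bound on the
  -- circle averages bounds both masses by L.
  let P : ℕ → FiniteMeasure Circle := fun k => ⟨arcDensity (ρ k), hfin (hρ k) (hint k)⟩
  let N : ℕ → FiniteMeasure Circle := fun k =>
    ⟨arcDensity fun ζ => -ρ k ζ, hfin (hρ k).neg (hint' k)⟩
  have hcomp := isCompact_setOfPred_finiteMeasure_le_of_compactSpace Circle L.toNNReal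
  have hPm : ∀ k, (P k).mass ≤ L.toNNReal := fun k => by
    have := arcDensity_univ_le (hρ k) (hint k)
    rw [← ENNReal.coe_le_coe, FiniteMeasure.ennreal_mass]
    exact this
  have hNm : ∀ k, (N k).mass ≤ L.toNNReal := fun k => by
    have := arcDensity_univ_le (hρ k).neg (hint' k)
    rw [← ENNReal.coe_le_coe, FiniteMeasure.ennreal_mass]
    exact this
  have hUle : ((hyperfilter ℕ : Ultrafilter ℕ) : Filter ℕ) ≤ atTop := Nat.hyperfilter_le_atTop
  -- Both sequences converge along the same ultrafilter, so that the limits may be subtracted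
  -- without extracting subsequences.
  obtain ⟨p, -, hp⟩ := hcomp.ultrafilter_le_nhds ((hyperfilter ℕ).map P)
    (le_principal_iff.2 (Filter.mem_map.2 (Filter.univ_mem' hPm)))
  obtain ⟨n, -, hn⟩ := hcomp.ultrafilter_le_nhds ((hyperfilter ℕ).map N)
    (le_principal_iff.2 (Filter.mem_map.2 (Filter.univ_mem' hNm)))
  refine ⟨p, n, inferInstance, inferInstance, fun w hw v hv => ?_⟩
  have hk := continuous_discKernel hw hv
  let K : BoundedContinuousFunction Circle ℂ :=
    BoundedContinuousFunction.mkOfCompact ⟨_, hk⟩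
  have hp' := (FiniteMeasure.tendsto_iff_forall_integral_rclike_tendsto ℂ).1
    (show Tendsto P (hyperfilter ℕ) (𝓝 p) from hp) K
  have hn' := (FiniteMeasure.tendsto_iff_forall_integral_rclike_tendsto ℂ).1
    (show Tendsto N (hyperfilter ℕ) (𝓝 n) from hn) K
  have hlim1 := hp'.sub hn'
  have hscale : ∀ {u : ℂ}, u ∈ ball (0 : ℂ) 1 →
      Tendsto (fun k => g (r k * u)) (hyperfilter ℕ) (𝓝 (g u)) := by
    intro u hu
    have h1 : Tendsto (fun k => (r k : ℂ) * u) (hyperfilter ℕ) (𝓝 u) := by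
      have : Tendsto (fun k => (r k : ℂ) * u) atTop (𝓝 (((1 : ℝ) : ℂ) * u)) :=
        ((continuous_ofReal.tendsto 1).comp hlim).mul_const u
      simp only [ofReal_one, one_mul] at this
      exact this.mono_left hUle
    exact ((hg.differentiableAt (Metric.isOpen_ball.mem_nhds hu)).continuousAt.tendsto).comp h1
  have hlim2 := (hscale hw).add ((Complex.continuous_conj.tendsto _).comp (hscale hv))
  refine tendsto_nhds_unique hlim2 (hlim1.congr fun k => ?_)
  change (∫ ζ : Circle, discKernel w v ζ ∂arcDensity (ρ k)) -
    (∫ ζ : Circle, discKernel w v ζ ∂arcDensity fun ζ => -ρ k ζ) = _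
  rw [integral_arcDensity_sub (hρ k) hk]
  -- The dilated function is holomorphic beyond the closed unit disc, as `herglotz_sum` requires.
  have hd : DifferentiableOn ℂ (fun z => g (r k * z)) (ball 0 (r k)⁻¹) := by
    refine hg.comp (by fun_prop) fun z hz => ?_
    rw [mem_ball_zero_iff] at hz ⊢
    rw [norm_mul, Complex.norm_real, Real.norm_of_nonneg (hr k).1.le]
    calc r k * ‖z‖ < r k * (r k)⁻¹ := mul_lt_mul_of_pos_left hz (hr k).1
      _ = 1 := mul_inv_cancel₀ (hr k).1.ne'
  exact (herglotz_sum (one_lt_inv_iff₀.2 (hr k)) hd hw hv).symm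

/-! ### From finite measures to real-valued measures -/

/-- Subtraction of measures is truncated, and both sides equal the supremum of p and n. Hence p - n
and n - p form a Jordan decomposition with the same difference as p and n. -/
theorem add_sub_eq_add_sub (p n : Measure ℝ) [IsFiniteMeasure p] [IsFiniteMeasure n] :
    p + (n - p) = n + (p - n) := by
  have h := Measure.sub_toSignedMeasure_eq_toSignedMeasure_sub (μ := p) (ν := n)
  refine Measure.ext fun s hs => ?_
  have h1 := congrArg (fun v : SignedMeasure ℝ => v s) h
  simp only [sub_apply, Measure.toSignedMeasure_apply_measurable hs] at h1
  simp only [Measure.add_apply]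
  rw [← ENNReal.toReal_eq_toReal_iff' (by finiteness) (by finiteness),
    ENNReal.toReal_add (by finiteness) (by finiteness),
    ENNReal.toReal_add (by finiteness) (by finiteness)]
  simp only [Measure.real] at h1
  linarith

namespace RealMeasure

/-- The real-valued measure `ρ · (p - n)`. -/
def ofFinite (p n : Measure ℝ) [IsFiniteMeasure p] [IsFiniteMeasure n] (ρ : ℝ → ℝ)
    (hρ : Continuous ρ) : RealMeasure where
  pos := (p - n).withDensity fun t => ENNReal.ofReal (ρ t)
  neg := (n - p).withDensity fun t => ENNReal.ofReal (ρ t)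
  pos_locallyFinite := IsLocallyFiniteMeasure.withDensity_ofReal hρ
  neg_locallyFinite := IsLocallyFiniteMeasure.withDensity_ofReal hρ
  mutuallySingular := Measure.mutually_singular_measure_sub.mono_ac
    (withDensity_absolutelyContinuous _ _) (withDensity_absolutelyContinuous _ _)

theorem integrable_withDensity {q : Measure ℝ} {ρ : ℝ → ℝ} (hρ : Continuous ρ)
    (hρ0 : ∀ t, 0 ≤ ρ t) {E : Type*} [NormedAddCommGroup E] [NormedSpace ℝ E] {h : ℝ → E}
    (hh : Integrable (fun t => ρ t • h t) q) :
    Integrable h (q.withDensity fun t => ENNReal.ofReal (ρ t)) := by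
  have := integrable_withDensity_iff_integrable_smul (μ := q) (f := fun t => (ρ t).toNNReal)
    hρ.measurable.real_toNNReal (g := h)
  refine this.2 (hh.congr (Eventually.of_forall fun t => ?_))
  change _ = (((ρ t).toNNReal : ℝ)) • h t
  rw [Real.coe_toNNReal _ (hρ0 t)]

theorem integral_withDensity {q : Measure ℝ} {ρ : ℝ → ℝ} (hρ : Continuous ρ)
    (hρ0 : ∀ t, 0 ≤ ρ t) (h : ℝ → ℂ) :
    ∫ t, h t ∂(q.withDensity fun t => ENNReal.ofReal (ρ t)) = ∫ t, (ρ t : ℂ) * h t ∂q := by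
  have := integral_withDensity_eq_integral_smul (μ := q) (f := fun t => (ρ t).toNNReal)
    hρ.measurable.real_toNNReal h
  refine Eq.trans this (integral_congr_ae (Eventually.of_forall fun t => ?_))
  change (((ρ t).toNNReal : ℝ)) • h t = _
  rw [Real.coe_toNNReal _ (hρ0 t), Complex.real_smul]

variable {p n : Measure ℝ} [IsFiniteMeasure p] [IsFiniteMeasure n] {ρ : ℝ → ℝ}

theorem integral_ofFinite (hρ : Continuous ρ) (hρ0 : ∀ t, 0 ≤ ρ t) {h : ℝ → ℂ}
    (hh : Continuous h) {C : ℝ} (hC : ∀ t, ‖(ρ t : ℂ) * h t‖ ≤ C) :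
    (ofFinite p n ρ hρ).integral h = (∫ t, (ρ t : ℂ) * h t ∂p) - ∫ t, (ρ t : ℂ) * h t ∂n := by
  have hi : ∀ (q : Measure ℝ) [IsFiniteMeasure q], Integrable (fun t => (ρ t : ℂ) * h t) q :=
    fun q _ => Integrable.of_bound
      ((continuous_ofReal.comp hρ).mul hh).aestronglyMeasurable C (Eventually.of_forall hC)
  have h1 := congrArg (fun q : Measure ℝ => ∫ t, (ρ t : ℂ) * h t ∂q) (add_sub_eq_add_sub p n)
  rw [integral_add_measure (hi _) (hi _), integral_add_measure (hi _) (hi _)] at h1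
  change (∫ t, h t ∂((p - n).withDensity fun t => ENNReal.ofReal (ρ t))) -
    ∫ t, h t ∂((n - p).withDensity fun t => ENNReal.ofReal (ρ t)) = _
  rw [integral_withDensity hρ hρ0, integral_withDensity hρ hρ0]
  linear_combination -h1

theorem tame_ofFinite (hρ : Continuous ρ) (hρ0 : ∀ t, 0 ≤ ρ t) {C : ℝ}
    (hC : ∀ t, ρ t * (1 + t ^ 2)⁻¹ ≤ C) : (ofFinite p n ρ hρ).Tame := by
  have hi : ∀ (q : Measure ℝ) [IsFiniteMeasure q],
      Integrable (fun t : ℝ => (1 + t ^ 2)⁻¹) (q.withDensity fun t => ENNReal.ofReal (ρ t)) := by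
    intro q _
    refine integrable_withDensity hρ hρ0 (Integrable.of_bound
      (hρ.smul continuous_weight).aestronglyMeasurable C (Eventually.of_forall fun t => ?_))
    rw [smul_eq_mul, Real.norm_of_nonneg (mul_nonneg (hρ0 t) (by positivity))]
    exact hC t
  exact (hi _).add_measure (hi _)

end RealMeasure

/-! ### The Cayley transform based at `z₀` -/

/-- The map from the disc to the upper half-plane sending `0` to `z₀`. -/
def fromDisc (z₀ w : ℂ) : ℂ := (z₀ - conj z₀ * w) / (1 - w)

/-- The inverse map. -/
def toDisc (z₀ z : ℂ) : ℂ := (z - z₀) / (z - conj z₀)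

variable {z₀ : ℂ}

theorem one_sub_ne_zero {w : ℂ} (hw : w ∈ ball (0 : ℂ) 1) : 1 - w ≠ 0 := by
  intro h
  have : w = 1 := (sub_eq_zero.1 h).symm
  simp [this] at hw

theorem fromDisc_im (z₀ w : ℂ) :
    (fromDisc z₀ w).im = z₀.im * (1 - ‖w‖ ^ 2) / ‖1 - w‖ ^ 2 := by
  rw [fromDisc, Complex.div_im, ← Complex.normSq_eq_norm_sq, ← Complex.normSq_eq_norm_sq]
  rw [← sub_div]
  congr 1
  simp only [sub_im, sub_re, mul_im, mul_re, conj_re, conj_im, one_re, one_im,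
    Complex.normSq_apply]
  ring

theorem fromDisc_mem (hz₀ : 0 < z₀.im) {w : ℂ} (hw : w ∈ ball (0 : ℂ) 1) :
    fromDisc z₀ w ∈ upperHalf := by
  have h1 : 0 < ‖1 - w‖ := norm_pos_iff.2 (one_sub_ne_zero hw)
  have h2 : ‖w‖ < 1 := mem_ball_zero_iff.1 hw
  have h3 : 0 < 1 - ‖w‖ ^ 2 := by nlinarith [norm_nonneg w]
  change 0 < (fromDisc z₀ w).im
  rw [fromDisc_im]
  positivity

theorem differentiableOn_fromDisc : DifferentiableOn ℂ (fromDisc z₀) (ball 0 1) := by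
  unfold fromDisc
  exact DifferentiableOn.div (by fun_prop) (by fun_prop) fun w hw => one_sub_ne_zero hw

theorem sub_conj_ne_zero {z w : ℂ} (hz : 0 < z.im) (hw : 0 < w.im) : z - conj w ≠ 0 := by
  intro h
  have := congrArg Complex.im h
  simp at this; linarith

theorem toDisc_mem (hz₀ : 0 < z₀.im) {z : ℂ} (hz : 0 < z.im) : toDisc z₀ z ∈ ball (0 : ℂ) 1 := by
  rw [mem_ball_zero_iff, toDisc, norm_div,
    div_lt_one (norm_pos_iff.2 (sub_conj_ne_zero hz hz₀))]
  refine lt_of_pow_lt_pow_left₀ 2 (norm_nonneg _) ?_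
  rw [← Complex.normSq_eq_norm_sq, ← Complex.normSq_eq_norm_sq, Complex.normSq_apply,
    Complex.normSq_apply]
  simp only [sub_re, sub_im, conj_re, conj_im]
  nlinarith [mul_pos hz hz₀]

theorem self_sub_conj_ne_zero (hz₀ : 0 < z₀.im) : z₀ - conj z₀ ≠ 0 := sub_conj_ne_zero hz₀ hz₀

theorem fromDisc_toDisc (hz₀ : 0 < z₀.im) {z : ℂ} (hz : 0 < z.im) :
    fromDisc z₀ (toDisc z₀ z) = z := by
  have h1 := sub_conj_ne_zero hz hz₀
  have h2 := self_sub_conj_ne_zero hz₀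
  have h3 : 1 - toDisc z₀ z = (z₀ - conj z₀) / (z - conj z₀) := by
    rw [toDisc]; field_simp; ring
  have h4 : z₀ - conj z₀ * toDisc z₀ z = z * (z₀ - conj z₀) / (z - conj z₀) := by
    rw [toDisc]; field_simp; ring
  rw [fromDisc, h3, h4]
  field_simp

/-- The boundary point on the line corresponding to a point of the circle. -/
def circleToReal (z₀ : ℂ) (ζ : Circle) : ℝ := (fromDisc z₀ ζ).re

/-- This includes ζ = 1, where division by zero makes both sides 0. -/
theorem coe_circleToReal (z₀ : ℂ) (ζ : Circle) :
    ((circleToReal z₀ ζ : ℝ) : ℂ) = fromDisc z₀ ζ := by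
  apply Complex.ext
  · simp [circleToReal]
  · rw [fromDisc_im, Circle.norm_coe]; simp

theorem measurable_circleToReal (z₀ : ℂ) : Measurable (circleToReal z₀) := by
  have h := continuous_circle_coe.measurable
  unfold circleToReal fromDisc
  exact Complex.measurable_re.comp ((measurable_const.sub (measurable_const.mul h)).div
    (measurable_const.sub h))

theorem coe_eq_of_ne_one (hz₀ : 0 < z₀.im) {ζ : Circle} (hζ : (ζ : ℂ) ≠ 1) :
    (ζ : ℂ) = toDisc z₀ (circleToReal z₀ ζ) := by
  have h1 : 1 - (ζ : ℂ) ≠ 0 := sub_ne_zero.2 hζ.symm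
  have h2 := coe_circleToReal z₀ ζ
  have h3 : ((circleToReal z₀ ζ : ℝ) : ℂ) - conj z₀ ≠ 0 := by
    intro h
    have := congrArg Complex.im h
    simp at this; linarith
  rw [fromDisc, eq_div_iff h1] at h2
  rw [toDisc, eq_div_iff h3]
  linear_combination -h2

/-- The density `2π |t - z₀|² / Im z₀`. -/
def cayleyDensity (z₀ : ℂ) (t : ℝ) : ℝ := 2 * Real.pi / z₀.im * ‖(t : ℂ) - z₀‖ ^ 2

theorem continuous_cayleyDensity (z₀ : ℂ) : Continuous (cayleyDensity z₀) := by
  unfold cayleyDensity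
  fun_prop

theorem cayleyDensity_nonneg (hz₀ : 0 < z₀.im) (t : ℝ) : 0 ≤ cayleyDensity z₀ t := by
  have := Real.pi_pos
  unfold cayleyDensity; positivity

theorem cayleyDensity_le (hz₀ : 0 < z₀.im) :
    ∃ C : ℝ, 0 ≤ C ∧ ∀ t, cayleyDensity z₀ t * (1 + t ^ 2)⁻¹ ≤ C := by
  have hp := Real.pi_pos
  refine ⟨2 * Real.pi / z₀.im * (2 + 2 * ‖z₀‖ ^ 2), by positivity, fun t => ?_⟩
  rw [← div_eq_mul_inv, div_le_iff₀ (by positivity), cayleyDensity, mul_assoc]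
  refine mul_le_mul_of_nonneg_left ?_ (by positivity)
  have h1 : ‖(t : ℂ) - z₀‖ ≤ |t| + ‖z₀‖ := by
    simpa using norm_sub_le (t : ℂ) z₀
  have h2 : ‖(t : ℂ) - z₀‖ ^ 2 ≤ (|t| + ‖z₀‖) ^ 2 := by gcongr
  have h3 : |t| ^ 2 = t ^ 2 := sq_abs t
  nlinarith [sq_nonneg (|t| - ‖z₀‖), sq_nonneg (t * ‖z₀‖)]

theorem im_eq (z₀ : ℂ) : ((z₀.im : ℝ) : ℂ) = (z₀ - conj z₀) / (2 * I) := by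
  rw [eq_div_iff (by simp)]
  apply Complex.ext <;> simp
  ring

theorem one_sub_toDisc_mul (hz₀ : 0 < z₀.im) {z w : ℂ} (hz : 0 < z.im) (hw : 0 < w.im) :
    1 - toDisc z₀ z * conj (toDisc z₀ w) =
      -((z - conj w) * (z₀ - conj z₀)) / ((z - conj z₀) * (conj w - z₀)) := by
  have h1 := sub_conj_ne_zero hz hz₀
  have h2 : conj w - z₀ ≠ 0 := by
    have := (map_ne_zero conj).2 (sub_conj_ne_zero hw hz₀)
    simpa using this
  simp only [toDisc, map_div₀, map_sub, conj_conj]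
  field_simp
  ring

/-- The density collects the factors of the transformed kernel that depend on the boundary point
alone; what is left is the kernel of the half-plane. -/
theorem discKernel_toDisc (hz₀ : 0 < z₀.im) {z w : ℂ} (hz : 0 < z.im) (hw : 0 < w.im)
    {ζ : Circle} (hζ : (ζ : ℂ) ≠ 1) :
    discKernel (toDisc z₀ z) (toDisc z₀ w) ζ = (z - conj w) / (2 * Real.pi * I) *
      ((cayleyDensity z₀ (circleToReal z₀ ζ) : ℂ) *
        (1 / ((z - circleToReal z₀ ζ) * (conj w - circleToReal z₀ ζ)))) := by
  set t := circleToReal z₀ ζ with ht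
  have h0 := self_sub_conj_ne_zero hz₀
  have h1 := sub_conj_ne_zero hz hz₀
  have h2 : conj w - z₀ ≠ 0 := by
    have := (map_ne_zero conj).2 (sub_conj_ne_zero hw hz₀)
    simpa using this
  have h3 := sub_ofReal_ne_zero hz.ne' t
  have h4 := conj_sub_ofReal_ne_zero hw.ne' t
  have h5 : (t : ℂ) - z₀ ≠ 0 := by
    have := sub_ofReal_ne_zero hz₀.ne' t
    rwa [← neg_sub, neg_ne_zero] at this
  have h6 : (t : ℂ) - conj z₀ ≠ 0 := by
    have := conj_sub_ofReal_ne_zero hz₀.ne' t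
    rwa [← neg_sub, neg_ne_zero] at this
  have hp : (Real.pi : ℂ) ≠ 0 := by exact_mod_cast Real.pi_ne_zero
  have e1 : (ζ : ℂ) - toDisc z₀ z =
      (z₀ - conj z₀) * (t - z) / ((t - conj z₀) * (z - conj z₀)) := by
    rw [coe_eq_of_ne_one hz₀ hζ, ← ht, toDisc, toDisc]
    field_simp; ring
  have e2 : conj (ζ : ℂ) - conj (toDisc z₀ w) =
      (conj z₀ - z₀) * (t - conj w) / ((t - z₀) * (conj w - z₀)) := by
    rw [coe_eq_of_ne_one hz₀ hζ, ← ht, toDisc, toDisc]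
    simp only [map_div₀, map_sub, conj_conj, conj_ofReal]
    field_simp; ring
  have e3 : ((cayleyDensity z₀ t : ℝ) : ℂ) =
      2 * Real.pi * (2 * I) / (z₀ - conj z₀) * ((t - z₀) * (t - conj z₀)) := by
    rw [cayleyDensity, ← Complex.normSq_eq_norm_sq]
    push_cast
    rw [im_eq, Complex.normSq_eq_conj_mul_self]
    simp only [map_sub, conj_ofReal]
    field_simp
  rw [discKernel, one_sub_toDisc_mul hz₀ hz hw, e1, e2, e3]
  have h7 : conj z₀ - z₀ ≠ 0 := by rwa [← neg_sub, neg_ne_zero]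
  have h8 : (t : ℂ) - z ≠ 0 := by rwa [← neg_sub, neg_ne_zero]
  have h9 : (t : ℂ) - conj w ≠ 0 := by rwa [← neg_sub, neg_ne_zero]
  field_simp
  ring

/-- The point 1 of the circle corresponds to infinity: after division by z - conj w its contribution
is constant, which is the linear term of f. -/
theorem discKernel_one (hz₀ : 0 < z₀.im) {z w : ℂ} (hz : 0 < z.im) (hw : 0 < w.im) :
    discKernel (toDisc z₀ z) (toDisc z₀ w) 1 =
      (z - conj w) / (2 * Real.pi * I) * ((2 * Real.pi / z₀.im : ℝ) : ℂ) := by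
  have h0 := self_sub_conj_ne_zero hz₀
  have h1 := sub_conj_ne_zero hz hz₀
  have h2 : conj w - z₀ ≠ 0 := by
    have := (map_ne_zero conj).2 (sub_conj_ne_zero hw hz₀)
    simpa using this
  have hp : (Real.pi : ℂ) ≠ 0 := by exact_mod_cast Real.pi_ne_zero
  have e1 : 1 - toDisc z₀ z = (z₀ - conj z₀) / (z - conj z₀) := by
    rw [toDisc]; field_simp; ring
  have e2 : conj (1 : ℂ) - conj (toDisc z₀ w) = (conj z₀ - z₀) / (conj w - z₀) := by
    rw [toDisc]
    simp only [map_div₀, map_sub, conj_conj, map_one]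
    field_simp; ring
  have h7 : conj z₀ - z₀ ≠ 0 := by rwa [← neg_sub, neg_ne_zero]
  rw [discKernel, one_sub_toDisc_mul hz₀ hz hw, e1, e2]
  push_cast
  rw [im_eq]
  field_simp
  ring

/-- The part on the real line of a measure on the circle. -/
def lineMeasure (z₀ : ℂ) (p : Measure Circle) : Measure ℝ :=
  (p.restrict {1}ᶜ).map (circleToReal z₀)

instance (z₀ : ℂ) (p : Measure Circle) [IsFiniteMeasure p] : IsFiniteMeasure (lineMeasure z₀ p) := by
  unfold lineMeasure
  infer_instance

/-- The atom at 1 is split off before the transport to the line, because `circleToReal` sends 1 to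
the meaningless value 0. -/
theorem integral_discKernel {z₀ : ℂ} (hz₀ : 0 < z₀.im) {z w : ℂ} (hz : 0 < z.im) (hw : 0 < w.im)
    (p : Measure Circle) [IsFiniteMeasure p] :
    ∫ ζ : Circle, discKernel (toDisc z₀ z) (toDisc z₀ w) ζ ∂p =
      (z - conj w) / (2 * Real.pi * I) * (((2 * Real.pi / z₀.im * p.real {1} : ℝ) : ℂ) +
        ∫ t, (cayleyDensity z₀ t : ℂ) * (1 / ((z - t) * (conj w - t))) ∂lineMeasure z₀ p) := by
  have hk := continuous_discKernel (toDisc_mem hz₀ hz) (toDisc_mem hz₀ hw)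
  have hi : Integrable (fun ζ : Circle => discKernel (toDisc z₀ z) (toDisc z₀ w) ζ) p :=
    hk.integrable_of_hasCompactSupport (HasCompactSupport.of_compactSpace _)
  have h1 := integral_add_compl (measurableSet_singleton (1 : Circle)) hi
  have hc : Continuous fun t : ℝ =>
      (cayleyDensity z₀ t : ℂ) * (1 / ((z - t) * (conj w - t))) :=
    (continuous_ofReal.comp (continuous_cayleyDensity z₀)).mul (continuous_kernel hz hw)
  rw [← h1, integral_singleton, mul_add, lineMeasure,
    integral_map (measurable_circleToReal z₀).aemeasurable hc.aestronglyMeasurable,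
    ← integral_const_mul]
  congr 1
  · rw [Complex.real_smul, Circle.coe_one, discKernel_one hz₀ hz hw]
    push_cast
    ring
  · refine setIntegral_congr_fun (measurableSet_singleton (1 : Circle)).compl fun ζ hζ => ?_
    refine discKernel_toDisc hz₀ hz hw fun h => hζ ?_
    exact Circle.ext h

/-! ### Representation of `f` when `exp f` is of bounded type -/

theorem exists_norm_le_one {P Q : ℂ → ℂ} (hP : BoundedHolomorphic P) (hQ : BoundedHolomorphic Q) :
    ∃ c : ℝ, 0 < c ∧ ∀ z ∈ upperHalf, ‖(c : ℂ) * P z‖ ≤ 1 ∧ ‖(c : ℂ) * Q z‖ ≤ 1 := by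
  obtain ⟨-, A, hA⟩ := hP
  obtain ⟨-, B, hB⟩ := hQ
  have hC : 0 < |A| + |B| + 1 := by positivity
  refine ⟨(|A| + |B| + 1)⁻¹, by positivity, fun z hz => ?_⟩
  have h1 := (hA z hz).trans (le_abs_self A)
  have h2 := (hB z hz).trans (le_abs_self B)
  have h3 := abs_nonneg A
  have h4 := abs_nonneg B
  simp only [norm_mul, Complex.norm_real, Real.norm_of_nonneg (inv_nonneg.2 hC.le)]
  constructor <;> rw [inv_mul_le_iff₀ hC] <;> linarith

/-- Re a is the difference of log|p| and log|q|, both nonpositive, so its modulus is at most minus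
their sum. -/
theorem abs_re_le_neg_log {a p q : ℂ} (h : exp a * q = p) (hp : ‖p‖ ≤ 1) (hq : ‖q‖ ≤ 1)
    (hpq : p * q ≠ 0) : |a.re| ≤ -Real.log ‖p * q‖ := by
  have hp0 : 0 < ‖p‖ := norm_pos_iff.2 (left_ne_zero_of_mul hpq)
  have hq0 : 0 < ‖q‖ := norm_pos_iff.2 (right_ne_zero_of_mul hpq)
  have h1 := congrArg (fun z => Real.log ‖z‖) h
  simp only [norm_mul, Complex.norm_exp] at h1
  rw [Real.log_mul (Real.exp_pos _).ne' hq0.ne', Real.log_exp] at h1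
  have h2 := Real.log_nonpos hp0.le hp
  have h3 := Real.log_nonpos hq0.le hq
  rw [norm_mul, Real.log_mul hp0.ne' hq0.ne', abs_le]
  constructor <;> linarith

/-- If `exp f` is of bounded type, then `f` is represented by a tame real-valued measure, up to a
linear term. -/
theorem exists_measure_of_boundedType {f : ℂ → ℂ} (hf : DifferentiableOn ℂ f upperHalf)
    (hb : BoundedType fun z => exp (f z)) :
    ∃ (M : ℝ) (μ : RealMeasure), μ.Tame ∧ ∀ z ∈ upperHalf, ∀ w ∈ upperHalf,
      (f z + conj (f w)) / (z - conj w) = 1 / (2 * Real.pi * I) *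
        (M + μ.integral fun t : ℝ => 1 / ((z - t) * (conj w - t))) := by
  obtain ⟨P, Q, hP, hQ, ⟨z₀, hz₀, hQ0⟩, hPQ⟩ := hb
  obtain ⟨c, hc, hle⟩ := exists_norm_le_one hP hQ
  have hz₀' : 0 < z₀.im := hz₀
  have hcc : (c : ℂ) ≠ 0 := by exact_mod_cast hc.ne'
  -- The centre z₀ of the Cayley transform is a point where Q does not vanish, which makes F 0 ≠ 0
  -- and Jensen's bound meaningful.
  set φ := fromDisc z₀ with hφ
  have hφm : Set.MapsTo φ (ball 0 1) upperHalf := fun w hw => fromDisc_mem hz₀' hw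
  have hφ0 : φ 0 = z₀ := by simp [hφ, fromDisc]
  have hgd : DifferentiableOn ℂ (fun w => f (φ w)) (ball 0 1) :=
    hf.comp differentiableOn_fromDisc hφm
  set F : ℂ → ℂ := fun w => ((c : ℂ) * P (φ w)) * ((c : ℂ) * Q (φ w)) with hF
  have hFd : DifferentiableOn ℂ F (ball 0 1) :=
    ((hP.1.comp differentiableOn_fromDisc hφm).const_mul _).mul
      ((hQ.1.comp differentiableOn_fromDisc hφm).const_mul _)
  have hF0 : F 0 ≠ 0 := by
    rw [hF]
    simp only [hφ0, ← hPQ z₀ hz₀]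
    exact mul_ne_zero (mul_ne_zero hcc (mul_ne_zero (exp_ne_zero _) hQ0)) (mul_ne_zero hcc hQ0)
  have hbound : ∀ r ∈ Set.Ioo (0 : ℝ) 1,
      circleAverage (fun w => |(f (φ w)).re|) 0 r ≤ -Real.log ‖F 0‖ := by
    intro r hr
    have hsub : closedBall (0 : ℂ) r ⊆ ball 0 1 := Metric.closedBall_subset_ball hr.2
    refine circleAverage_abs_le (u := fun w => (f (φ w)).re) hr.1
      ((hFd.analyticOnNhd Metric.isOpen_ball).mono hsub) hF0
      (Complex.continuous_re.comp_continuousOn (hgd.continuousOn.mono hsub)) fun w hw hne => ?_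
    have hm := hφm (hsub hw)
    refine abs_re_le_neg_log ?_ (hle _ hm).1 (hle _ hm).2 hne
    rw [← hPQ _ hm]; ring
  obtain ⟨p, n, hpf, hnf, hrep⟩ := exists_disc_measures hgd hbound
  obtain ⟨D, hD0, hD⟩ := cayleyDensity_le hz₀'
  have hρ := continuous_cayleyDensity z₀
  have hρ0 := cayleyDensity_nonneg hz₀'
  refine ⟨2 * Real.pi / z₀.im * p.real {1} - 2 * Real.pi / z₀.im * n.real {1},
    RealMeasure.ofFinite (lineMeasure z₀ p) (lineMeasure z₀ n) (cayleyDensity z₀) hρ,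
    RealMeasure.tame_ofFinite hρ hρ0 hD, fun z hz w hw => ?_⟩
  have hz' : 0 < z.im := hz
  have hw' : 0 < w.im := hw
  have h1 := hrep _ (toDisc_mem hz₀' hz') _ (toDisc_mem hz₀' hw')
  simp only [hφ, fromDisc_toDisc hz₀' hz', fromDisc_toDisc hz₀' hw'] at h1
  rw [integral_discKernel hz₀' hz' hw', integral_discKernel hz₀' hz' hw'] at h1
  have hker : ∀ t : ℝ, ‖(cayleyDensity z₀ t : ℂ) * (1 / ((z - t) * (conj w - t)))‖ ≤
      (kernelConst z + kernelConst w) * D := by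
    intro t
    rw [norm_mul, Complex.norm_real, Real.norm_of_nonneg (hρ0 t)]
    have hkc : 0 ≤ kernelConst z + kernelConst w :=
      (add_pos (kernelConst_pos z) (kernelConst_pos w)).le
    calc _ ≤ cayleyDensity z₀ t * ((kernelConst z + kernelConst w) * (1 + t ^ 2)⁻¹) :=
          mul_le_mul_of_nonneg_left (norm_kernel_le hz' hw' t) (hρ0 t)
      _ = (kernelConst z + kernelConst w) * (cayleyDensity z₀ t * (1 + t ^ 2)⁻¹) := by ring
      _ ≤ _ := mul_le_mul_of_nonneg_left (hD t) hkc
  rw [RealMeasure.integral_ofFinite hρ hρ0 (continuous_kernel hz' hw') hker, h1]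
  have hne := sub_conj_ne_zero hz' hw'
  rw [div_eq_iff hne]
  push_cast
  ring

/-- At z = w = iy the kernel is (y² + t²)⁻¹, dominated by (1 + t²)⁻¹ once y ≥ 1. The measure thus
contributes only o(y) to Re f(iy). -/
theorem integral_kernel_tendsto_zero {μ : RealMeasure} (hμ : μ.Tame) :
    Tendsto (fun y : ℝ => μ.integral fun t : ℝ => 1 / ((y * I - t) * (conj (y * I : ℂ) - t)))
      atTop (𝓝 0) := by
  have key : ∀ y t : ℝ, 1 / ((y * I - t) * (conj (y * I : ℂ) - t)) =
      (((y ^ 2 + t ^ 2)⁻¹ : ℝ) : ℂ) := by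
    intro y t
    have : ((y : ℂ) * I - t) * (conj (y * I : ℂ) - t) = ((y ^ 2 + t ^ 2 : ℝ) : ℂ) := by
      simp only [map_mul, conj_I, conj_ofReal]
      push_cast
      ring_nf
      rw [I_sq]; ring
    rw [this, one_div, ← Complex.ofReal_inv]
  simp_rw [key]
  have h0 : (0 : ℂ) = μ.integral fun _ => (0 : ℂ) := by simp [RealMeasure.integral]
  rw [h0]
  refine RealMeasure.tendsto_integral_of_dominated (b := fun t => (1 + t ^ 2)⁻¹) ?_ hμ ?_ ?_
  · exact Eventually.of_forall fun y => Measurable.aestronglyMeasurable (by fun_prop)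
  · filter_upwards [eventually_ge_atTop 1] with y hy t
    rw [Complex.norm_real, Real.norm_of_nonneg (by positivity)]
    gcongr
    nlinarith
  · intro t
    have h1 : Tendsto (fun y : ℝ => (y ^ 2 + t ^ 2)⁻¹) atTop (𝓝 0) :=
      (tendsto_atTop_add_const_right _ _ (tendsto_pow_atTop two_ne_zero)).inv_tendsto_atTop
    have := (continuous_ofReal.tendsto 0).comp h1
    rw [ofReal_zero] at this
    exact this

/-- Along the imaginary axis Re f(iy)/y converges to M/(2π), so the limsup condition forces M = 0.
-/
theorem exists_tame_kernelIdentity {f : ℂ → ℂ} (hf : DifferentiableOn ℂ f upperHalf)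
    (hIV : ExpBoundedTypeZero f) : ∃ μ : RealMeasure, μ.Tame ∧ KernelIdentity f μ := by
  obtain ⟨M, μ, hμ, hK⟩ := exists_measure_of_boundedType hf hIV.1
  refine ⟨μ, hμ, fun z hz w hw => ?_⟩
  suffices hM : M = 0 by simpa [hM] using hK z hz w hw
  have hlim : Tendsto (fun y : ℝ => (((f (y * I)).re / y : ℝ) : ℂ)) atTop
      (𝓝 (((M / (2 * Real.pi) : ℝ)) : ℂ)) := by
    have h1 := ((integral_kernel_tendsto_zero hμ).const_add (M : ℂ)).const_mul
      ((1 / (2 * Real.pi) : ℝ) : ℂ)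
    have e : ((1 / (2 * Real.pi) : ℝ) : ℂ) * ((M : ℂ) + 0) = (((M / (2 * Real.pi) : ℝ)) : ℂ) := by
      push_cast; ring
    rw [e] at h1
    refine h1.congr' ?_
    filter_upwards [eventually_gt_atTop 0] with y hy
    have hy' : (y * I : ℂ) ∈ upperHalf := by simpa [upperHalf] using hy
    have h2 := hK _ hy' _ hy'
    have hyc : (y : ℂ) ≠ 0 := by exact_mod_cast hy.ne'
    have hpc : (Real.pi : ℂ) ≠ 0 := by exact_mod_cast Real.pi_ne_zero
    have h3 : (y * I : ℂ) - conj (y * I : ℂ) = 2 * I * y := by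
      simp; ring
    rw [add_conj_eq, h3, div_eq_iff (by simp [hyc])] at h2
    have h4 : (((f (y * I)).re : ℝ) : ℂ) = y / (2 * Real.pi) *
        (M + μ.integral fun t : ℝ => 1 / ((y * I - t) * (conj (y * I : ℂ) - t))) := by
      have h5 : (2 : ℂ) * (((f (y * I)).re : ℝ) : ℂ) = 2 * (y / (2 * Real.pi) *
        (M + μ.integral fun t : ℝ => 1 / ((y * I - t) * (conj (y * I : ℂ) - t)))) := by
        rw [← Complex.ofReal_ofNat, ← Complex.ofReal_mul, h2]
        push_cast
        field_simp
      exact mul_left_cancel₀ two_ne_zero h5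
    rw [Complex.ofReal_div (f (y * I)).re y, h4]
    push_cast
    field_simp
  have hlim2 : Tendsto (fun y : ℝ => (f (y * I)).re / y) atTop (𝓝 (M / (2 * Real.pi))) := by
    have := (Complex.continuous_re.tendsto _).comp hlim
    simpa only [Function.comp_def, Complex.ofReal_re] using this
  have hlim3 : Tendsto (fun y : ℝ => (((f (y * I)).re / y : ℝ) : EReal)) atTop
      (𝓝 ((M / (2 * Real.pi) : ℝ) : EReal)) :=
    (continuous_coe_real_ereal.tendsto _).comp hlim2
  have h6 := hlim3.limsup_eq
  rw [hIV.2] at h6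
  have h7 : M / (2 * Real.pi) = 0 := by exact_mod_cast h6.symm
  have hp := Real.pi_pos
  rcases div_eq_zero_iff.1 h7 with h | h
  · exact h
  · exact absurd h (by positivity)

/-! ### Almost periodic functions on the real line -/

/-- Almost periodicity in the sense of Bochner: `g` is continuous and its set of translates is
totally bounded for the uniform distance. -/
structure BochnerAP {E : Type*} [PseudoMetricSpace E] (g : ℝ → E) : Prop where
  continuous : Continuous g
  exists_net : ∀ ε : ℝ, 0 < ε →
    ∃ s : Finset ℝ, ∀ t, ∃ t' ∈ s, ∀ x, dist (g (x + t)) (g (x + t')) ≤ ε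

namespace BochnerAP

section Metric

variable {E F : Type*} [PseudoMetricSpace E] [PseudoMetricSpace F] {g : ℝ → E} {h : ℝ → F}

theorem totallyBounded_range (hg : BochnerAP g) : TotallyBounded (Set.range g) := by
  rw [Metric.totallyBounded_iff]
  intro ε hε
  obtain ⟨s, hs⟩ := hg.exists_net (ε / 2) (by linarith)
  refine ⟨(fun t => g (0 + t)) '' s, s.finite_toSet.image _, ?_⟩
  rintro _ ⟨t, rfl⟩
  obtain ⟨t', ht', h⟩ := hs t
  simp only [Set.mem_iUnion]
  refine ⟨_, ⟨t', ht', rfl⟩, ?_⟩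
  have := h 0
  rw [zero_add] at this
  exact Metric.mem_ball.2 (lt_of_le_of_lt this (by linarith))

/-- Each t is classified by its pair of net points, one for g and one for h. One representative is
kept for each pair that occurs; translates in the same class are close by the triangle inequality.
With `comp_continuous` this gives sums and products. -/
theorem prodMk (hg : BochnerAP g) (hh : BochnerAP h) : BochnerAP fun x => (g x, h x) := by
  classical
  refine ⟨hg.continuous.prodMk hh.continuous, fun ε hε => ?_⟩
  obtain ⟨s, hs⟩ := hg.exists_net (ε / 2) (by linarith)
  obtain ⟨s', hs'⟩ := hh.exists_net (ε / 2) (by linarith)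
  choose u hu hu' using hs
  choose v hv hv' using hs'
  have key : ∀ p : ℝ × ℝ, ∃ r : ℝ, (∃ t, u t = p.1 ∧ v t = p.2) → u r = p.1 ∧ v r = p.2 := by
    intro p
    by_cases H : ∃ t, u t = p.1 ∧ v t = p.2
    · exact ⟨H.choose, fun _ => H.choose_spec⟩
    · exact ⟨0, fun h => absurd h H⟩
  choose r hr using key
  refine ⟨(s ×ˢ s').image r, fun t => ⟨r (u t, v t), Finset.mem_image_of_mem _
    (Finset.mk_mem_product (hu t) (hv t)), fun x => ?_⟩⟩
  obtain ⟨h1, h2⟩ := hr (u t, v t) ⟨t, rfl, rfl⟩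
  have a1 := hu' t x
  have a2 := hv' t x
  have b1 := hu' (r (u t, v t)) x
  have b2 := hv' (r (u t, v t)) x
  rw [h1] at b1
  rw [h2] at b2
  rw [Prod.dist_eq, max_le_iff]
  constructor
  · exact (dist_triangle_right _ _ _).trans (by dsimp only; linarith)
  · exact (dist_triangle_right _ _ _).trans (by dsimp only; linarith)

/-- The range is relatively compact, and φ is uniformly continuous on its closure. -/
theorem comp_continuous [ProperSpace E] (hg : BochnerAP g) {φ : E → F} (hφ : Continuous φ) :
    BochnerAP fun x => φ (g x) := by
  refine ⟨hφ.comp hg.continuous, fun ε hε => ?_⟩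
  have hc : IsCompact (closure (Set.range g)) :=
    hg.totallyBounded_range.isBounded.isCompact_closure
  obtain ⟨δ, hδ, H⟩ := Metric.uniformContinuousOn_iff.1
    (hc.uniformContinuousOn_of_continuous hφ.continuousOn) ε hε
  obtain ⟨s, hs⟩ := hg.exists_net (δ / 2) (by linarith)
  refine ⟨s, fun t => ?_⟩
  obtain ⟨t', ht', h⟩ := hs t
  refine ⟨t', ht', fun x => (H _ (subset_closure ⟨_, rfl⟩) _ (subset_closure ⟨_, rfl⟩) ?_).le⟩
  exact lt_of_le_of_lt (h x) (by linarith)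

theorem of_uniform_approx
    (H : ∀ ε : ℝ, 0 < ε → ∃ h : ℝ → E, BochnerAP h ∧ ∀ x, dist (g x) (h x) ≤ ε) :
    BochnerAP g := by
  constructor
  · refine continuous_of_uniform_approx_of_continuous fun u hu => ?_
    obtain ⟨ε, hε, hu⟩ := Metric.mem_uniformity_dist.1 hu
    obtain ⟨h, hh, hd⟩ := H (ε / 2) (by linarith)
    exact ⟨h, hh.continuous, fun x => hu (lt_of_le_of_lt (hd x) (by linarith))⟩
  · intro ε hε
    obtain ⟨h, hh, hd⟩ := H (ε / 3) (by linarith)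
    obtain ⟨s, hs⟩ := hh.exists_net (ε / 3) (by linarith)
    refine ⟨s, fun t => ?_⟩
    obtain ⟨t', ht', h'⟩ := hs t
    refine ⟨t', ht', fun x => ?_⟩
    have h1 := hd (x + t)
    have h2 := hd (x + t')
    have h3 := h' x
    rw [dist_comm] at h2
    have := dist_triangle4 (g (x + t)) (h (x + t)) (h (x + t')) (g (x + t'))
    linarith

end Metric

section Complex

variable {g h : ℝ → ℂ}

theorem exists_bound (hg : BochnerAP g) : ∃ B : ℝ, 0 < B ∧ ∀ x, ‖g x‖ ≤ B := by
  obtain ⟨B, hB, h⟩ := hg.totallyBounded_range.isBounded.exists_pos_norm_le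
  exact ⟨B, hB, fun x => h _ ⟨x, rfl⟩⟩

theorem add (hg : BochnerAP g) (hh : BochnerAP h) : BochnerAP fun x => g x + h x :=
  (hg.prodMk hh).comp_continuous continuous_add

theorem sub (hg : BochnerAP g) (hh : BochnerAP h) : BochnerAP fun x => g x - h x :=
  (hg.prodMk hh).comp_continuous continuous_sub

theorem mul (hg : BochnerAP g) (hh : BochnerAP h) : BochnerAP fun x => g x * h x :=
  (hg.prodMk hh).comp_continuous continuous_mul

theorem const (c : ℂ) : BochnerAP fun _ : ℝ => c :=
  ⟨continuous_const, fun ε hε => ⟨{0}, fun _ => ⟨0, by simp, fun _ => by simpa using hε.le⟩⟩⟩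

theorem sum {ι : Type*} (s : Finset ι) {g : ι → ℝ → ℂ} (hg : ∀ i ∈ s, BochnerAP (g i)) :
    BochnerAP fun x => ∑ i ∈ s, g i x := by
  classical
  induction s using Finset.induction_on with
  | empty => simpa using const 0
  | insert a s ha ih =>
    simp only [Finset.sum_insert ha]
    exact (hg a (Finset.mem_insert_self _ _)).add
      (ih fun i hi => hg i (Finset.mem_insert_of_mem hi))

end Complex

end BochnerAP

/-- The character `x ↦ exp (2π i l x)` of the real line. -/
def character (l x : ℝ) : ℂ := exp (2 * Real.pi * I * l * x)

theorem character_eq (l x : ℝ) : character l x = exp (((2 * Real.pi * l * x : ℝ) : ℂ) * I) := by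
  unfold character
  congr 1
  push_cast
  ring

@[simp] theorem norm_character (l x : ℝ) : ‖character l x‖ = 1 := by
  rw [character_eq, Complex.norm_exp_ofReal_mul_I]

theorem character_add_right (l x y : ℝ) : character l (x + y) = character l x * character l y := by
  unfold character
  rw [← Complex.exp_add]
  push_cast
  ring_nf

theorem character_add_left (l k x : ℝ) : character (l + k) x = character l x * character k x := by
  unfold character
  rw [← Complex.exp_add]
  push_cast
  ring_nf

theorem conj_character (l x : ℝ) : conj (character l x) = character (-l) x := by
  unfold character
  rw [← Complex.exp_conj]
  simp [Complex.conj_ofNat]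

@[simp] theorem character_zero_left (x : ℝ) : character 0 x = 1 := by simp [character]

@[fun_prop] theorem continuous_character (l : ℝ) : Continuous (character l) := by
  unfold character
  fun_prop

/-- Translating a character multiplies it by a unimodular constant, so a finite net of its range
gives a net of translates. -/
theorem bochnerAP_character (l : ℝ) : BochnerAP (character l) := by
  refine ⟨continuous_character l, fun ε hε => ?_⟩
  have htb : TotallyBounded (Set.range (character l)) := by
    refine (isCompact_closedBall (0 : ℂ) 1).totallyBounded.subset ?_
    rintro _ ⟨x, rfl⟩
    simp
  obtain ⟨T, hT, hfin, hcov⟩ := totallyBounded_iff_subset.1 htb _ (Metric.dist_mem_uniformity hε)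
  classical
  refine ⟨hfin.toFinset.image (Function.invFun (character l)), fun t => ?_⟩
  have ht := hcov ⟨t, rfl⟩
  simp only [Set.mem_iUnion] at ht
  obtain ⟨y, hy, hty⟩ := ht
  refine ⟨_, Finset.mem_image_of_mem _ (hfin.mem_toFinset.2 hy), fun x => ?_⟩
  rw [character_add_right, character_add_right, Function.invFun_eq (hT hy), dist_eq_norm,
    ← mul_sub, norm_mul, norm_character, one_mul, ← dist_eq_norm]
  exact le_of_lt hty

theorem norm_integral_translate_sub_le {E : Type*} [NormedAddCommGroup E] [NormedSpace ℝ E]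
    {g : ℝ → E} {B : ℝ} (hg : Continuous g)
    (hB : ∀ x, ‖g x‖ ≤ B) (c a b : ℝ) :
    ‖(∫ x in a..b, g (x + c)) - ∫ x in a..b, g x‖ ≤ 2 * B * |c| := by
  rw [intervalIntegral.integral_comp_add_right,
    intervalIntegral.integral_interval_sub_interval_comm (hg.intervalIntegrable _ _)
      (hg.intervalIntegrable _ _) (hg.intervalIntegrable _ _)]
  have h1 : ‖∫ x in (a + c)..a, g x‖ ≤ B * |a - (a + c)| :=
    intervalIntegral.norm_integral_le_of_norm_le_const fun x _ => hB x
  have h2 : ‖∫ x in (b + c)..b, g x‖ ≤ B * |b - (b + c)| :=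
    intervalIntegral.norm_integral_le_of_norm_le_const fun x _ => hB x
  rw [sub_add_cancel_left, abs_neg] at h1
  rw [sub_add_cancel_left, abs_neg] at h2
  exact (norm_sub_le _ _).trans (by linarith)

namespace BochnerAP

variable {g : ℝ → ℂ}

/-- Translation by a is replaced by translation by a net point at cost εT; the latter moves only the
ends of the interval, by a bounded amount. -/
theorem exists_norm_integral_sub_le (hg : BochnerAP g) {ε : ℝ} (hε : 0 < ε) :
    ∃ K : ℝ, 0 < K ∧ ∀ T : ℝ, 0 ≤ T → ∀ a,
      ‖(∫ x in (0 : ℝ)..T, g (x + a)) - ∫ x in (0 : ℝ)..T, g x‖ ≤ ε * T + K := by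
  obtain ⟨B, hB, hgB⟩ := hg.exists_bound
  obtain ⟨s, hs⟩ := hg.exists_net ε hε
  refine ⟨1 + ∑ t ∈ s, 2 * B * |t|, by positivity, fun T hT a => ?_⟩
  obtain ⟨t, ht, h⟩ := hs a
  have hc := hg.continuous
  have h1 : ‖(∫ x in (0 : ℝ)..T, g (x + a)) - ∫ x in (0 : ℝ)..T, g (x + t)‖ ≤ ε * T := by
    rw [← intervalIntegral.integral_sub (Continuous.intervalIntegrable (by fun_prop) _ _)
      (Continuous.intervalIntegrable (by fun_prop) _ _)]
    refine (intervalIntegral.norm_integral_le_of_norm_le_const (C := ε) fun x _ => ?_).trans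
      (by rw [sub_zero, abs_of_nonneg hT])
    rw [← dist_eq_norm]
    exact h x
  have h2 := norm_integral_translate_sub_le hc hgB t 0 T
  have h3 : 2 * B * |t| ≤ ∑ t ∈ s, 2 * B * |t| :=
    Finset.single_le_sum (f := fun t : ℝ => 2 * B * |t|) (fun i _ => by positivity) ht
  have := norm_sub_le_norm_sub_add_norm_sub (∫ x in (0 : ℝ)..T, g (x + a))
    (∫ x in (0 : ℝ)..T, g (x + t)) (∫ x in (0 : ℝ)..T, g x)
  linarith

/-- Both products are compared with the integral of g(x + a) over x in [0, T] and a in [0, S], which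
is symmetric in the two variables. Divided by ST, the estimate is the Cauchy property of the means.
-/
theorem exists_norm_mul_integral_sub_le (hg : BochnerAP g) {ε : ℝ} (hε : 0 < ε) :
    ∃ K : ℝ, 0 < K ∧ ∀ S T : ℝ, 0 ≤ S → 0 ≤ T →
      ‖(S : ℂ) * (∫ x in (0 : ℝ)..T, g x) - T * ∫ x in (0 : ℝ)..S, g x‖ ≤
        2 * ε * S * T + K * (S + T) := by
  obtain ⟨K, hK, h⟩ := hg.exists_norm_integral_sub_le hε
  have hc := hg.continuous
  have key : ∀ S T : ℝ, 0 ≤ S → 0 ≤ T →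
      ‖(S : ℂ) * (∫ x in (0 : ℝ)..T, g x) - ∫ a in (0 : ℝ)..S, ∫ x in (0 : ℝ)..T, g (x + a)‖ ≤
        (ε * T + K) * S := by
    intro S T hS hT
    have e : (S : ℂ) * (∫ x in (0 : ℝ)..T, g x) =
        ∫ _ in (0 : ℝ)..S, ∫ x in (0 : ℝ)..T, g x := by
      simp
    have hcont : Continuous fun a => ∫ x in (0 : ℝ)..T, g (x + a) :=
      intervalIntegral.continuous_parametric_intervalIntegral_of_continuous' (by fun_prop) _ _
    rw [e, ← intervalIntegral.integral_sub (by simp) (hcont.intervalIntegrable _ _)]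
    refine (intervalIntegral.norm_integral_le_of_norm_le_const (C := ε * T + K)
      fun a _ => ?_).trans (by rw [sub_zero, abs_of_nonneg hS])
    rw [norm_sub_rev]
    exact h T hT a
  refine ⟨K, hK, fun S T hS hT => ?_⟩
  have h1 := key S T hS hT
  have h2 := key T S hT hS
  have e : (∫ a in (0 : ℝ)..S, ∫ x in (0 : ℝ)..T, g (x + a)) =
      ∫ a in (0 : ℝ)..T, ∫ x in (0 : ℝ)..S, g (x + a) := by
    rw [intervalIntegral_intervalIntegral_swap]
    · simp_rw [add_comm]
    · refine (ContinuousOn.integrableOn_compact (K := Set.uIcc 0 S ×ˢ Set.uIcc 0 T)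
        (isCompact_uIcc.prod isCompact_uIcc) (Continuous.continuousOn ?_)).mono_set
        (Set.prod_mono Set.uIoc_subset_uIcc Set.uIoc_subset_uIcc)
      simp only [Function.uncurry_def]
      fun_prop
  rw [e] at h1
  rw [norm_sub_rev] at h2
  have := norm_sub_le_norm_sub_add_norm_sub ((S : ℂ) * ∫ x in (0 : ℝ)..T, g x)
    (∫ a in (0 : ℝ)..T, ∫ x in (0 : ℝ)..S, g (x + a)) (T * ∫ x in (0 : ℝ)..S, g x)
  linarith

end BochnerAP

/-! ### Mean values and their uniformity in translation and frequency -/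

/-- The mean value of a function on the line. -/
def bohrMean (g : ℝ → ℂ) : ℂ :=
  limUnder atTop fun T : ℝ => (T : ℂ)⁻¹ * ∫ x in (0 : ℝ)..T, g x

namespace BochnerAP

variable {g : ℝ → ℂ}

theorem tendsto_bohrMean (hg : BochnerAP g) :
    Tendsto (fun T : ℝ => (T : ℂ)⁻¹ * ∫ x in (0 : ℝ)..T, g x) atTop (𝓝 (bohrMean g)) := by
  refine tendsto_nhds_limUnder (cauchySeq_tendsto_of_complete ?_)
  rw [Metric.cauchySeq_iff]
  intro ε hε
  obtain ⟨K, hK, h⟩ := hg.exists_norm_mul_integral_sub_le (ε := ε / 8) (by linarith)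
  refine ⟨max 1 (8 * K / ε), fun T hT S hS => ?_⟩
  simp only [ge_iff_le, max_le_iff] at hT hS
  have hT0 : 0 < T := by linarith
  have hS0 : 0 < S := by linarith
  have hTc : (T : ℂ) ≠ 0 := by exact_mod_cast hT0.ne'
  have hSc : (S : ℂ) ≠ 0 := by exact_mod_cast hS0.ne'
  have e : (T : ℂ)⁻¹ * (∫ x in (0 : ℝ)..T, g x) - (S : ℂ)⁻¹ * (∫ x in (0 : ℝ)..S, g x) =
      ((S * T : ℝ) : ℂ)⁻¹ * (S * (∫ x in (0 : ℝ)..T, g x) - T * ∫ x in (0 : ℝ)..S, g x) := by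
    push_cast
    field_simp
  have hST : 0 < S * T := by positivity
  rw [dist_eq_norm, e, norm_mul, norm_inv, Complex.norm_real, Real.norm_of_nonneg hST.le,
    inv_mul_lt_iff₀ hST]
  refine (h S T hS0.le hT0.le).trans_lt ?_
  have h1 : 8 * K ≤ T * ε := (div_le_iff₀ hε).1 hT.2
  have h2 : 8 * K ≤ S * ε := (div_le_iff₀ hε).1 hS.2
  have h3 := mul_le_mul_of_nonneg_right h1 hS0.le
  have h4 := mul_le_mul_of_nonneg_right h2 hT0.le
  have h5 : 0 < S * T * ε := by positivity
  nlinarith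

theorem exists_norm_integral_sub_mean_le (hg : BochnerAP g) {ε : ℝ} (hε : 0 < ε) :
    ∃ T₀ : ℝ, 0 < T₀ ∧ ∀ T : ℝ, T₀ ≤ T → ∀ a,
      ‖(∫ x in a..(a + T), g x) - T * bohrMean g‖ ≤ ε * T := by
  obtain ⟨K, hK, h⟩ := hg.exists_norm_integral_sub_le (ε := ε / 3) (by linarith)
  obtain ⟨T₁, h₁⟩ := Metric.tendsto_atTop.1 hg.tendsto_bohrMean (ε / 3) (by linarith)
  refine ⟨max T₁ (max 1 (3 * K / ε)), by positivity, fun T hT a => ?_⟩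
  simp only [max_le_iff] at hT
  obtain ⟨hT1, hT2, hT3⟩ := hT
  have hT0 : 0 < T := by linarith
  rw [div_le_iff₀ hε] at hT3
  have h2 := h T hT0.le a
  rw [intervalIntegral.integral_comp_add_right, zero_add, add_comm T a] at h2
  have h3 := h₁ T hT1
  rw [dist_eq_norm] at h3
  have hTc : (T : ℂ) ≠ 0 := by exact_mod_cast hT0.ne'
  have h4 : ‖(∫ x in (0 : ℝ)..T, g x) - T * bohrMean g‖ ≤ ε / 3 * T := by
    have e : (∫ x in (0 : ℝ)..T, g x) - T * bohrMean g =
        T * ((T : ℂ)⁻¹ * (∫ x in (0 : ℝ)..T, g x) - bohrMean g) := by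
      field_simp
    rw [e, norm_mul, Complex.norm_real, Real.norm_of_nonneg hT0.le, mul_comm]
    gcongr
  have := norm_sub_le_norm_sub_add_norm_sub (∫ x in a..(a + T), g x)
    (∫ x in (0 : ℝ)..T, g x) (T * bohrMean g)
  linarith

theorem tendsto_symm_mean (hg : BochnerAP g) :
    Tendsto (fun T : ℝ => (1 / (2 * T) : ℂ) * ∫ x in (-T)..T, g x) atTop (𝓝 (bohrMean g)) := by
  rw [Metric.tendsto_atTop]
  intro ε hε
  obtain ⟨T₀, hT₀, h⟩ := hg.exists_norm_integral_sub_mean_le (ε := ε / 2) (by linarith)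
  refine ⟨T₀, fun T hT => ?_⟩
  have hT0 : 0 < T := by linarith
  have hTc : (T : ℂ) ≠ 0 := by exact_mod_cast hT0.ne'
  have h1 := h (2 * T) (by linarith) (-T)
  rw [show -T + 2 * T = T by ring] at h1
  have e : (1 / (2 * T) : ℂ) * (∫ x in (-T)..T, g x) - bohrMean g =
      ((2 * T : ℝ) : ℂ)⁻¹ * ((∫ x in (-T)..T, g x) - (2 * T : ℝ) * bohrMean g) := by
    push_cast
    field_simp
  rw [dist_eq_norm, e, norm_mul, norm_inv, Complex.norm_real, Real.norm_of_nonneg (by linarith),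
    inv_mul_lt_iff₀ (by linarith)]
  nlinarith

end BochnerAP

theorem norm_integral_le_of_blocks {F : ℝ → ℂ} {B L η : ℝ} (hF : Continuous F)
    (hB : ∀ x, ‖F x‖ ≤ B) (hL : 0 < L) (hη : 0 ≤ η)
    (h : ∀ a, ‖∫ x in a..(a + L), F x‖ ≤ η * L) {T : ℝ} (hT : 0 ≤ T) (a : ℝ) :
    ‖∫ x in a..(a + T), F x‖ ≤ η * T + B * L := by
  have hB0 : 0 ≤ B := (norm_nonneg _).trans (hB 0)
  have key : ∀ n : ℕ, ∀ T a : ℝ, 0 ≤ T → T ≤ n * L →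
      ‖∫ x in a..(a + T), F x‖ ≤ η * T + B * L := by
    intro n
    induction n with
    | zero =>
      intro T a hT hT'
      have : T = 0 := le_antisymm (by simpa using hT') hT
      subst this
      simp only [add_zero, intervalIntegral.integral_same, norm_zero]
      positivity
    | succ n ih =>
      intro T a hT hT'
      push_cast at hT'
      rcases le_total T L with hTL | hTL
      · have h1 : ‖∫ x in a..(a + T), F x‖ ≤ B * |a + T - a| :=
          intervalIntegral.norm_integral_le_of_norm_le_const fun x _ => hB x
        rw [add_sub_cancel_left, abs_of_nonneg hT] at h1
        have : B * T ≤ B * L := by gcongr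
        have : 0 ≤ η * T := by positivity
        linarith
      · have h1 := ih (T - L) (a + L) (by linarith) (by linarith)
        rw [show a + L + (T - L) = a + T by ring] at h1
        rw [← intervalIntegral.integral_add_adjacent_intervals
          (hF.intervalIntegrable a (a + L)) (hF.intervalIntegrable (a + L) (a + T))]
        refine (norm_add_le _ _).trans ?_
        have := h a
        linarith
  obtain ⟨n, hn⟩ := exists_nat_ge (T / L)
  exact key n T a hT ((div_le_iff₀ hL).1 hn)

theorem norm_character_sub_one_le (l x : ℝ) : ‖character l x - 1‖ ≤ 2 * Real.pi * |l| * |x| := by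
  rw [character_eq, mul_comm _ I]
  refine Real.norm_exp_I_mul_ofReal_sub_one_le.trans ?_
  rw [Real.norm_eq_abs, abs_mul, abs_mul, abs_of_pos Real.two_pi_pos]

namespace BochnerAP

variable {g : ℝ → ℂ}

/-- Every translate of g is uniformly close to one of finitely many, and these are simultaneously
continuous at 0. -/
theorem exists_uniform_modulus (hg : BochnerAP g) {ε : ℝ} (hε : 0 < ε) :
    ∃ δ : ℝ, 0 < δ ∧ ∀ u, |u| ≤ δ → ∀ x, ‖g (x + u) - g x‖ ≤ ε := by
  obtain ⟨s, hs⟩ := hg.exists_net (ε / 3) (by linarith)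
  have hev : ∀ᶠ u in 𝓝 (0 : ℝ), ∀ t ∈ s, dist (g (u + t)) (g (0 + t)) < ε / 3 := by
    rw [Filter.eventually_all_finset]
    intro t _
    have hc : Continuous fun u => g (u + t) := hg.continuous.comp (by fun_prop)
    exact Metric.tendsto_nhds.1 (hc.tendsto 0) _ (by linarith)
  obtain ⟨δ, hδ, h⟩ := Metric.eventually_nhds_iff.1 hev
  refine ⟨δ / 2, by linarith, fun u hu x => ?_⟩
  have h1 := @h u (by rw [dist_zero_right, Real.norm_eq_abs]; linarith)
  obtain ⟨t, ht, h2⟩ := hs x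
  have h3 := h2 u
  have h4 := h2 0
  have h5 := h1 t ht
  rw [← dist_eq_norm, add_comm x u]
  rw [zero_add x, dist_comm] at h4
  have := dist_triangle4 (g (u + x)) (g (u + t)) (g (0 + t)) (g x)
  linarith

/-- Compactness in the frequency. For fixed k some block length L makes all block integrals small; a
frequency close to k differs from it on a block by a nearly constant phase, and
`norm_integral_le_of_blocks` assembles the blocks. -/
theorem exists_uniform_norm_integral_le_of_bounded (hg : BochnerAP g)
    (h0 : ∀ l, bohrMean (fun x => g x * character l x) = 0) (R : ℝ) {ε : ℝ} (hε : 0 < ε) :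
    ∃ T₀ : ℝ, 0 < T₀ ∧ ∀ l ∈ Set.Icc (-R) R, ∀ T : ℝ, T₀ ≤ T → ∀ a,
      ‖∫ x in a..(a + T), g x * character l x‖ ≤ ε * T := by
  obtain ⟨B, hB, hgB⟩ := hg.exists_bound
  have hc := hg.continuous
  refine isCompact_Icc.induction_on (p := fun S : Set ℝ => ∃ T₀ : ℝ, 0 < T₀ ∧ ∀ l ∈ S, ∀ T : ℝ,
    T₀ ≤ T → ∀ a, ‖∫ x in a..(a + T), g x * character l x‖ ≤ ε * T) ?_ ?_ ?_ ?_
  · exact ⟨1, one_pos, by simp⟩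
  · rintro S S' hS ⟨T₀, h, h'⟩
    exact ⟨T₀, h, fun l hl => h' l (hS hl)⟩
  · rintro S S' ⟨T₁, h₁, h₁'⟩ ⟨T₂, h₂, h₂'⟩
    refine ⟨max T₁ T₂, by positivity, ?_⟩
    rintro l (hl | hl) T hT
    · exact h₁' l hl T ((le_max_left _ _).trans hT)
    · exact h₂' l hl T ((le_max_right _ _).trans hT)
  · intro k _
    obtain ⟨L, hL, h⟩ := (hg.mul (bochnerAP_character k)).exists_norm_integral_sub_mean_le
      (ε := ε / 4) (by linarith)
    simp_rw [h0 k, mul_zero, sub_zero] at h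
    have hp := Real.pi_pos
    -- Chosen so that the phase error on one block, B · 2πδL · L, is exactly εL/4.
    set δ : ℝ := ε / (8 * Real.pi * B * L) with hδ
    have hδ0 : 0 < δ := by positivity
    refine ⟨Metric.closedBall k δ, mem_nhdsWithin_of_mem_nhds (Metric.closedBall_mem_nhds k hδ0),
      max (2 * B * L / ε) 1, by positivity, fun l hl T hT a => ?_⟩
    rw [Metric.mem_closedBall, Real.dist_eq] at hl
    rw [max_le_iff, div_le_iff₀ hε] at hT
    have hblock : ∀ a, ‖∫ x in a..(a + L), g x * character l x‖ ≤ ε / 2 * L := by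
      intro a
      have e : (∫ x in a..(a + L), g x * character l x) =
          character (l - k) a * ((∫ x in a..(a + L), g x * character k x) +
            ∫ x in a..(a + L), g x * character k x * (character (l - k) (x - a) - 1)) := by
        rw [← intervalIntegral.integral_add (Continuous.intervalIntegrable (by fun_prop) _ _)
          (Continuous.intervalIntegrable (by fun_prop) _ _),
          ← intervalIntegral.integral_const_mul]
        congr 1
        ext x
        have h1 := character_add_right (l - k) a (x - a)
        have h2 := character_add_left (l - k) k x
        rw [add_sub_cancel] at h1
        rw [sub_add_cancel] at h2
        rw [h2, h1]
        ring
      have h3 : ‖∫ x in a..(a + L), g x * character k x * (character (l - k) (x - a) - 1)‖ ≤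
          B * (2 * Real.pi * δ * L) * |a + L - a| := by
        refine intervalIntegral.norm_integral_le_of_norm_le_const fun x hx => ?_
        rw [Set.uIoc_of_le (by linarith)] at hx
        rw [norm_mul, norm_mul, norm_character, mul_one]
        have h4 : |x - a| ≤ L := by rw [abs_of_pos (by linarith [hx.1])]; linarith [hx.2]
        gcongr
        · exact hgB x
        · exact (norm_character_sub_one_le _ _).trans (by gcongr)
      rw [add_sub_cancel_left, abs_of_pos hL] at h3
      have h5 : B * (2 * Real.pi * δ * L) * L = ε / 4 * L := by
        rw [hδ]; field_simp; norm_num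
      rw [e, norm_mul, norm_character, one_mul]
      refine (norm_add_le _ _).trans ?_
      have := h L le_rfl a
      linarith
    have := norm_integral_le_of_blocks (F := fun x => g x * character l x) (B := B) (by fun_prop)
      (fun x => by rw [norm_mul, norm_character, mul_one]; exact hgB x) hL
      (by linarith) hblock (T := T) (by linarith) a
    nlinarith

/-- Large frequencies are treated as in the Riemann–Lebesgue lemma: translation by the half period
1/(2l) changes the sign of the character but moves g by at most ε. The other frequencies form a
compact interval. -/
theorem exists_uniform_norm_integral_le (hg : BochnerAP g)
    (h0 : ∀ l, bohrMean (fun x => g x * character l x) = 0) {ε : ℝ} (hε : 0 < ε) :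
    ∃ T₀ : ℝ, 0 < T₀ ∧ ∀ l T : ℝ, T₀ ≤ T → ∀ a,
      ‖∫ x in a..(a + T), g x * character l x‖ ≤ ε * T := by
  obtain ⟨B, hB, hgB⟩ := hg.exists_bound
  have hc := hg.continuous
  obtain ⟨δ, hδ, hmod⟩ := hg.exists_uniform_modulus hε
  obtain ⟨T₀, hT₀, h⟩ := hg.exists_uniform_norm_integral_le_of_bounded h0 (1 / (2 * δ)) hε
  refine ⟨max T₀ (2 * B * δ / ε), by positivity, fun l T hT a => ?_⟩
  rw [max_le_iff, div_le_iff₀ hε] at hT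
  by_cases hl : l ∈ Set.Icc (-(1 / (2 * δ))) (1 / (2 * δ))
  · exact h l hl T hT.1 a
  have hl' : 1 / (2 * δ) < |l| := by
    rw [Set.mem_Icc, ← abs_le] at hl
    exact not_le.1 hl
  have hl0 : 0 < |l| := lt_trans (by positivity) hl'
  have hlne : l ≠ 0 := abs_pos.1 hl0
  set s := 1 / (2 * l) with hs
  have hsδ : |s| ≤ δ := by
    rw [hs, abs_div, abs_one, abs_mul, abs_two]
    rw [div_lt_iff₀ (by positivity)] at hl'
    rw [div_le_iff₀ (by positivity)]
    linarith
  have hchar : character l s = -1 := by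
    rw [character_eq, hs, show 2 * Real.pi * l * (1 / (2 * l)) = Real.pi by field_simp,
      Complex.exp_pi_mul_I]
  set F : ℝ → ℂ := fun x => g x * character l x with hF
  have hFc : Continuous F := by fun_prop
  have h1 := norm_integral_translate_sub_le hFc (B := B)
    (fun x => by simp only [hF, norm_mul, norm_character, mul_one]; exact hgB x) s a (a + T)
  have h2 : ‖(∫ x in a..(a + T), F (x + s)) + ∫ x in a..(a + T), F x‖ ≤ ε * |a + T - a| := by
    rw [← intervalIntegral.integral_add (Continuous.intervalIntegrable (by fun_prop) _ _)
      (hFc.intervalIntegrable _ _)]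
    refine intervalIntegral.norm_integral_le_of_norm_le_const fun x _ => ?_
    have e : F (x + s) + F x = -((g (x + s) - g x) * character l x) := by
      simp only [hF, character_add_right, hchar]
      ring
    rw [e, norm_neg, norm_mul, norm_character, mul_one]
    exact hmod s hsδ x
  rw [add_sub_cancel_left, abs_of_pos (by linarith)] at h2
  have e : (∫ x in a..(a + T), F x) = (1 / 2 : ℂ) *
      (((∫ x in a..(a + T), F (x + s)) + ∫ x in a..(a + T), F x) -
        ((∫ x in a..(a + T), F (x + s)) - ∫ x in a..(a + T), F x)) := by ring
  have h3 : 2 * B * |s| ≤ 2 * B * δ := by gcongr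
  rw [e, norm_mul]
  have h4 := norm_sub_le ((∫ x in a..(a + T), F (x + s)) + ∫ x in a..(a + T), F x)
    ((∫ x in a..(a + T), F (x + s)) - ∫ x in a..(a + T), F x)
  rw [show ‖(1 / 2 : ℂ)‖ = 1 / 2 by norm_num]
  linarith

end BochnerAP

/-! ### Uniqueness theorem for Fourier–Bohr coefficients -/

theorem fourier_eq_integral_character (G : ℝ → ℂ) (l : ℝ) :
    𝓕 G l = ∫ x, character (-l) x * G x := by
  rw [Real.fourier_real_eq_integral_exp_smul]
  congr 1
  ext x
  rw [smul_eq_mul, character_eq]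
  congr 3
  push_cast
  ring

/-- The autocorrelation of a smooth compactly supported function is square integrable with norm
controlled by the sup norm of the Fourier transform. -/
theorem exists_autocorrelation {G : ℝ → ℂ} (hG : ContDiff ℝ ∞ G) (hGc : HasCompactSupport G)
    {A : ℝ} (hA : ∀ l, ‖𝓕 G l‖ ≤ A) :
    ∃ H : SchwartzMap ℝ ℂ, (∀ u, H u = ∫ t, G t * conj (G (t - u))) ∧
      ∫ u, ‖H u‖ ^ 2 ≤ A ^ 2 * ∫ t, ‖G t‖ ^ 2 := by
  set R : ℝ → ℂ := fun x => conj (G (-x)) with hR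
  have hRs : ContDiff ℝ ∞ R :=
    Complex.conjCLE.contDiff.comp (hG.comp contDiff_neg)
  have hRc : HasCompactSupport R :=
    HasCompactSupport.comp_left (g := conj) (hGc.comp_homeomorph (Homeomorph.neg ℝ)) (map_zero _)
  set Gs := hGc.toSchwartzMap hG
  set Rs := hRc.toSchwartzMap hRs
  have hGs : ∀ x, Gs x = G x := fun _ => rfl
  have hRs' : ∀ x, Rs x = conj (G (-x)) := fun _ => rfl
  have hFR : ∀ l, ‖𝓕 Rs l‖ = ‖𝓕 G l‖ := by
    intro l
    rw [SchwartzMap.fourier_coe]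
    have : 𝓕 (⇑Rs) l = conj (𝓕 G l) := by
      rw [fourier_eq_integral_character, fourier_eq_integral_character, ← integral_conj,
        ← integral_neg_eq_self]
      congr 1
      ext x
      rw [hRs', map_mul, conj_character, neg_neg, neg_neg]
      congr 1
      simp [character]
    rw [this, RCLike.norm_conj]
  have hFG : ∀ l, ‖𝓕 Gs l‖ = ‖𝓕 G l‖ := fun l => by rw [SchwartzMap.fourier_coe]; rfl
  refine ⟨SchwartzMap.convolution (ContinuousLinearMap.mul ℂ ℂ) Gs Rs, fun u => ?_, ?_⟩
  · rw [SchwartzMap.convolution_apply]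
    simp [MeasureTheory.convolution_def, hGs, hRs']
  -- By Plancherel the integral of |H|² is that of |𝓕 G|⁴; two of the four factors are bounded by A
  -- and the other two are returned to G.
  · rw [← SchwartzMap.integral_norm_sq_fourier, SchwartzMap.fourier_convolution]
    have e : ∀ l, ‖SchwartzMap.pairing (ContinuousLinearMap.mul ℂ ℂ) (𝓕 Gs) (𝓕 Rs) l‖ ^ 2 =
        ‖𝓕 G l‖ ^ 2 * ‖𝓕 Gs l‖ ^ 2 := by
      intro l
      simp only [SchwartzMap.pairing_apply_apply, ContinuousLinearMap.mul_apply', norm_mul, hFR,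
        hFG]
      ring
    have hint : Integrable fun l => ‖𝓕 Gs l‖ ^ 2 :=
      (SchwartzMap.memLp (𝓕 Gs) 2).integrable_norm_pow two_ne_zero
    calc _ = ∫ l, ‖𝓕 G l‖ ^ 2 * ‖𝓕 Gs l‖ ^ 2 := integral_congr_ae (Eventually.of_forall e)
      _ ≤ ∫ l, A ^ 2 * ‖𝓕 Gs l‖ ^ 2 := by
        refine integral_mono_of_nonneg (Eventually.of_forall fun l => by positivity)
          (hint.const_mul _) (Eventually.of_forall fun l => ?_)
        dsimp only
        gcongr
        exact hA l
      _ = _ := by rw [integral_const_mul, SchwartzMap.integral_norm_sq_fourier]; rfl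

/-- A smooth cutoff of `[-T, T]`. -/
def cutoff (T : ℝ) (hT : 0 < T) : ContDiffBump (0 : ℝ) := ⟨T, T + 1, hT, by linarith⟩

section Cutoff

variable {T : ℝ} (hT : 0 < T)

theorem cutoff_eq_one {x : ℝ} (hx : |x| ≤ T) : cutoff T hT x = 1 :=
  (cutoff T hT).one_of_mem_closedBall (by simpa [cutoff] using hx)

theorem support_cutoff_mul_subset (g : ℝ → ℂ) :
    Function.support (fun x => (cutoff T hT x : ℂ) * g x) ⊆ Set.Ioc (-(T + 1)) (T + 1) := by
  intro x hx
  have h1 : x ∈ Function.support (cutoff T hT) := by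
    intro h
    simp [h] at hx
  rw [ContDiffBump.support_eq] at h1
  simp only [cutoff, Metric.mem_ball, dist_zero_right, Real.norm_eq_abs, abs_lt] at h1
  exact ⟨h1.1, h1.2.le⟩

theorem norm_cutoff_mul_le (x : ℝ) (z : ℂ) : ‖(cutoff T hT x : ℂ) * z‖ ≤ ‖z‖ := by
  rw [norm_mul, Complex.norm_real, Real.norm_of_nonneg (cutoff T hT).nonneg]
  exact mul_le_of_le_one_left (norm_nonneg _) (cutoff T hT).le_one

/-- The cutoff falls from 1 to 0 over two intervals of length 1, which account for the term 2B. -/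
theorem norm_integral_cutoff_mul_le {g : ℝ → ℂ} {B : ℝ} (hg : Continuous g) (hB : ∀ x, ‖g x‖ ≤ B) :
    ‖∫ x, (cutoff T hT x : ℂ) * g x‖ ≤ ‖∫ x in (-T)..T, g x‖ + 2 * B := by
  have hc : Continuous fun x => (cutoff T hT x : ℂ) * g x :=
    (continuous_ofReal.comp (cutoff T hT).continuous).mul hg
  have hi : ∀ a b, IntervalIntegrable (fun x => (cutoff T hT x : ℂ) * g x) volume a b :=
    fun a b => hc.intervalIntegrable a b
  rw [← intervalIntegral.integral_eq_integral_of_support_subset (support_cutoff_mul_subset hT g),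
    ← intervalIntegral.integral_add_adjacent_intervals (hi _ (-T)) (hi _ _),
    ← intervalIntegral.integral_add_adjacent_intervals (hi (-T) T) (hi _ _)]
  have hle : ∀ x, ‖(cutoff T hT x : ℂ) * g x‖ ≤ B := fun x =>
    (norm_cutoff_mul_le hT x _).trans (hB x)
  have h1 : ‖∫ x in (-(T + 1))..(-T), (cutoff T hT x : ℂ) * g x‖ ≤ B * |-T - -(T + 1)| :=
    intervalIntegral.norm_integral_le_of_norm_le_const fun x _ => hle x
  have h2 : ‖∫ x in T..(T + 1), (cutoff T hT x : ℂ) * g x‖ ≤ B * |T + 1 - T| :=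
    intervalIntegral.norm_integral_le_of_norm_le_const fun x _ => hle x
  have h3 : (∫ x in (-T)..T, (cutoff T hT x : ℂ) * g x) = ∫ x in (-T)..T, g x := by
    refine intervalIntegral.integral_congr fun x hx => ?_
    rw [Set.uIcc_of_le (by linarith), Set.mem_Icc, ← abs_le] at hx
    simp [cutoff_eq_one hT hx]
  rw [show -T - -(T + 1) = 1 by ring, abs_one, mul_one] at h1
  rw [show T + 1 - T = 1 by ring, abs_one, mul_one] at h2
  rw [h3]
  refine (norm_add_le _ _).trans ?_
  have := norm_add_le (∫ x in (-T)..T, g x) (∫ x in T..(T + 1), (cutoff T hT x : ℂ) * g x)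
  linarith

end Cutoff

namespace BochnerAP

variable {g : ℝ → ℂ}

/-- Relative density in finite form: subtracting a suitable one of finitely many numbers turns any x
into an almost period. -/
theorem exists_almost_period_net (hg : BochnerAP g) {ε : ℝ} (hε : 0 < ε) :
    ∃ s : Finset ℝ, ∀ x, ∃ t ∈ s, ∀ y, ‖g (y + (x - t)) - g y‖ ≤ ε := by
  obtain ⟨s, hs⟩ := hg.exists_net ε hε
  refine ⟨s, fun x => ?_⟩
  obtain ⟨t, ht, h⟩ := hs x
  refine ⟨t, ht, fun y => ?_⟩
  have := h (y - t)
  rwa [dist_eq_norm, show y - t + x = y + (x - t) by ring, sub_add_cancel] at this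

/-- Since x - t is an almost period for some net point t, g has modulus at least |g x₀|/2 at x + (x₀
- t). Hence a finite sum of translates of |g|² is bounded below everywhere, and each translate has
nearly the same integral. -/
theorem exists_le_integral_norm_sq (hg : BochnerAP g) {x₀ : ℝ} (hx₀ : g x₀ ≠ 0) :
    ∃ c : ℝ, 0 < c ∧ ∃ T₀ : ℝ, ∀ T : ℝ, T₀ ≤ T → ∀ a,
      c * T ≤ ∫ x in a..(a + T), ‖g x‖ ^ 2 := by
  obtain ⟨B, hB, hgB⟩ := hg.exists_bound
  have hc := hg.continuous
  have hpos : 0 < ‖g x₀‖ := norm_pos_iff.2 hx₀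
  obtain ⟨s, hs⟩ := hg.exists_almost_period_net (ε := ‖g x₀‖ / 2) (by linarith)
  have hs1 : 0 < (s.card : ℝ) := by
    obtain ⟨t, ht, -⟩ := hs 0
    exact_mod_cast Finset.card_pos.2 ⟨t, ht⟩
  set d := (‖g x₀‖ / 2) ^ 2 with hd
  have hd0 : 0 < d := by positivity
  set K := ∑ t ∈ s, 2 * B ^ 2 * |x₀ - t| with hK
  have hK0 : 0 ≤ K := by positivity
  refine ⟨d / (2 * s.card), by positivity, max 0 (2 * K / d), fun T hT a => ?_⟩
  rw [max_le_iff, div_le_iff₀ hd0] at hT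
  have h1 : ∀ x, d ≤ ∑ t ∈ s, ‖g (x + (x₀ - t))‖ ^ 2 := by
    intro x
    obtain ⟨t, ht, h⟩ := hs x
    have h2 := h x₀
    rw [show x₀ + (x - t) = x + (x₀ - t) by ring] at h2
    have h3 : ‖g x₀‖ / 2 ≤ ‖g (x + (x₀ - t))‖ := by
      have := norm_sub_norm_le (g x₀) (g (x + (x₀ - t)))
      rw [norm_sub_rev] at this
      linarith
    refine le_trans ?_ (Finset.single_le_sum (f := fun t => ‖g (x + (x₀ - t))‖ ^ 2)
      (fun i _ => by positivity) ht)
    rw [hd]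
    gcongr
  have h2 : d * T ≤ ∑ t ∈ s, ∫ x in a..(a + T), ‖g (x + (x₀ - t))‖ ^ 2 := by
    rw [← intervalIntegral.integral_finsetSum
      (fun t _ => Continuous.intervalIntegrable (by fun_prop) _ _)]
    have := intervalIntegral.integral_mono_on (a := a) (b := a + T) (μ := volume)
      (f := fun _ => d) (g := fun x => ∑ t ∈ s, ‖g (x + (x₀ - t))‖ ^ 2) (by linarith) (by simp)
      (Continuous.intervalIntegrable (by fun_prop) _ _) (fun x _ => h1 x)
    simpa [mul_comm] using this
  have h3 : ∀ t ∈ s, (∫ x in a..(a + T), ‖g (x + (x₀ - t))‖ ^ 2) ≤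
      (∫ x in a..(a + T), ‖g x‖ ^ 2) + 2 * B ^ 2 * |x₀ - t| := by
    intro t _
    have := norm_integral_translate_sub_le (g := fun x => ‖g x‖ ^ 2) (B := B ^ 2) (by fun_prop)
      (fun x => by
        rw [Real.norm_of_nonneg (by positivity)]
        gcongr
        exact hgB x) (x₀ - t) a (a + T)
    have := (Real.le_norm_self _).trans this
    linarith
  have h4 := Finset.sum_le_sum h3
  rw [Finset.sum_add_distrib, Finset.sum_const, nsmul_eq_mul, ← hK] at h4
  rw [div_mul_eq_mul_div, div_le_iff₀ (by positivity)]
  linarith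

end BochnerAP

namespace BochnerAP

variable {g : ℝ → ℂ}

/-- Lower bound for the autocorrelation of a truncated almost periodic function at an almost
period. -/
theorem re_autocorrelation_ge {B ε K T u : ℝ} (hg : Continuous g) (hB : ∀ x, ‖g x‖ ≤ B)
    (hT : 0 < T) (hK : 0 ≤ K) (hKT : 2 * K ≤ T) (hu : -K ≤ u) (hu' : u ≤ T + K)
    (hper : ∀ y, ‖g (y + u) - g y‖ ≤ ε) :
    (∫ x in K..(K + (T - 2 * K)), ‖g x‖ ^ 2) - ε * B * (2 * T + 2) ≤
      (∫ t, ((cutoff T hT t : ℂ) * g t) * conj ((cutoff T hT (t - u) : ℂ) * g (t - u))).re := by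
  have hB0 : 0 ≤ B := (norm_nonneg _).trans (hB 0)
  set w := cutoff T hT with hw
  have hwc : Continuous w := w.continuous
  set G : ℝ → ℂ := fun t => (w t : ℂ) * g t with hG
  have hGc : Continuous G := (continuous_ofReal.comp hwc).mul hg
  set Φ : ℝ → ℂ := fun t => g t * conj (G (t - u)) with hΦ
  have e1 : ∀ t, G t * conj (G (t - u)) = (w t : ℂ) * Φ t := fun t => by
    simp only [hG, hΦ]; ring
  have hcont : Continuous fun t => (w t : ℂ) * Φ t :=
    (continuous_ofReal.comp hwc).mul
      (hg.mul (Complex.continuous_conj.comp (hGc.comp (by fun_prop))))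
  have hsupp := support_cutoff_mul_subset hT Φ
  simp_rw [← hw] at hsupp
  have e2 : (∫ t, G t * conj (G (t - u))) = ∫ t in (-(T + 1))..(T + 1), (w t : ℂ) * Φ t := by
    simp_rw [e1]
    exact (intervalIntegral.integral_eq_integral_of_support_subset hsupp).symm
  have e3 : (∫ t in (-(T + 1))..(T + 1), (w t : ℂ) * Φ t).re =
      ∫ t in (-(T + 1))..(T + 1), ((w t : ℂ) * Φ t).re := by
    have := Complex.reCLM.intervalIntegral_comp_comm (hcont.intervalIntegrable (μ := volume) (-(T + 1)) (T + 1))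
    simpa using this.symm
  change _ ≤ (∫ t, G t * conj (G (t - u))).re
  rw [e2, e3]
  -- Replacing g(t - u) by g(t) costs at most εB, as the product of the cutoffs lies in [0, 1].
  have hlow : ∀ t, w t * w (t - u) * ‖g t‖ ^ 2 - ε * B ≤ ((w t : ℂ) * Φ t).re := by
    intro t
    have e4 : (w t : ℂ) * Φ t = ((w t * w (t - u) * ‖g t‖ ^ 2 : ℝ) : ℂ) +
        ((w t * w (t - u) : ℝ) : ℂ) * (g t * conj (g (t - u) - g t)) := by
      simp only [hΦ, hG, map_mul, conj_ofReal, map_sub, mul_sub, Complex.mul_conj,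
        Complex.normSq_eq_norm_sq]
      push_cast
      ring
    rw [e4, Complex.add_re, Complex.ofReal_re]
    have h5 : ‖((w t * w (t - u) : ℝ) : ℂ) * (g t * conj (g (t - u) - g t))‖ ≤ 1 * (B * ε) := by
      rw [norm_mul, norm_mul, RCLike.norm_conj, Complex.norm_real,
        Real.norm_of_nonneg (mul_nonneg w.nonneg w.nonneg)]
      have h6 := hper (t - u)
      rw [sub_add_cancel, norm_sub_rev] at h6
      gcongr
      · exact mul_le_one₀ w.le_one w.nonneg w.le_one
      · exact hB t
    have h7 := (abs_le.1 (Complex.abs_re_le_norm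
      (((w t * w (t - u) : ℝ) : ℂ) * (g t * conj (g (t - u) - g t))))).1
    linarith
  have hm := intervalIntegral.integral_mono_on (a := -(T + 1)) (b := T + 1) (μ := volume)
    (by linarith) (f := fun t => w t * w (t - u) * ‖g t‖ ^ 2 - ε * B)
    (g := fun t => ((w t : ℂ) * Φ t).re)
    (Continuous.intervalIntegrable (by fun_prop) _ _)
    ((Complex.continuous_re.comp hcont).intervalIntegrable _ _) (fun t _ => hlow t)
  refine le_trans ?_ hm
  rw [intervalIntegral.integral_sub (Continuous.intervalIntegrable (by fun_prop) _ _) (by simp),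
    intervalIntegral.integral_const, smul_eq_mul]
  -- For K ≤ t ≤ T - K and -K ≤ u ≤ T + K, both t and t - u lie in [-T, T], where the cutoff is 1.
  have h8 : (∫ x in K..(K + (T - 2 * K)), ‖g x‖ ^ 2) ≤
      ∫ t in (-(T + 1))..(T + 1), w t * w (t - u) * ‖g t‖ ^ 2 := by
    have h9 : (∫ x in K..(K + (T - 2 * K)), ‖g x‖ ^ 2) =
        ∫ t in K..(K + (T - 2 * K)), w t * w (t - u) * ‖g t‖ ^ 2 := by
      refine intervalIntegral.integral_congr fun t ht => ?_
      rw [Set.uIcc_of_le (by linarith), Set.mem_Icc] at ht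
      have w1 : w t = 1 := cutoff_eq_one hT (abs_le.2 ⟨by linarith, by linarith⟩)
      have w2 : w (t - u) = 1 := cutoff_eq_one hT (abs_le.2 ⟨by linarith, by linarith⟩)
      simp [w1, w2]
    rw [h9]
    refine intervalIntegral.integral_mono_interval (by linarith) (by linarith) (by linarith)
      (Eventually.of_forall fun t => ?_) (Continuous.intervalIntegrable (by fun_prop) _ _)
    exact mul_nonneg (mul_nonneg w.nonneg w.nonneg) (by positivity)
  nlinarith

/-- A smooth almost periodic function all of whose Fourier-Bohr coefficients vanish is zero. -/
theorem eq_zero_of_coeff_eq_zero (hg : BochnerAP g) (hs : ContDiff ℝ ∞ g)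
    (h0 : ∀ l, bohrMean (fun x => g x * character l x) = 0) : g = 0 := by
  -- The integral of |H|² is estimated twice, H being the autocorrelation of a truncation of g to
  -- about [-T, T]. At almost periods |H| ≥ cT/2, and every x in [0, T] is one up to N shifts, so N
  -- times the integral is at least c²T³/4. But vanishing coefficients make the Fourier transform of
  -- the truncation at most 4ηT, uniformly in the frequency, and Plancherel gives a smaller multiple
  -- of T³.
  by_contra hne
  obtain ⟨x₀, hx₀⟩ := Function.ne_iff.1 hne
  obtain ⟨B, hB, hgB⟩ := hg.exists_bound
  have hc := hg.continuous
  obtain ⟨c, hc0, T₁, hT₁⟩ := hg.exists_le_integral_norm_sq hx₀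
  obtain ⟨s, hs'⟩ := hg.exists_almost_period_net (ε := c / (8 * B)) (by positivity)
  set K := ∑ t ∈ s, |t| with hK
  have hK0 : 0 ≤ K := by positivity
  have hKt : ∀ t ∈ s, |t| ≤ K := fun t ht =>
    Finset.single_le_sum (f := fun t : ℝ => |t|) (fun i _ => abs_nonneg i) ht
  obtain ⟨N, hN⟩ : ∃ N : ℝ, N = s.card := ⟨_, rfl⟩
  have hN0 : 0 ≤ N := hN ▸ Nat.cast_nonneg _
  -- With this η the upper bound becomes c²T³ · N / (16(N + 1)²), which is below c²T³/4.
  set η := c / (32 * B * (N + 1)) with hη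
  have hη0 : 0 < η := by positivity
  obtain ⟨T₂, hT₂, hsup⟩ := hg.exists_uniform_norm_integral_le h0 hη0
  obtain ⟨T, hTmax⟩ : ∃ T : ℝ, max (max 1 (T₁ + 2 * K)) (max (8 * K + 1) (max T₂ (B / η))) ≤ T := ⟨_, le_rfl⟩
  simp only [max_le_iff] at hTmax
  obtain ⟨⟨hT1, hTT₁⟩, hTK, hTT₂, hTB⟩ := hTmax
  rw [div_le_iff₀ hη0] at hTB
  have hT : 0 < T := by linarith
  set w := cutoff T hT with hw
  set G : ℝ → ℂ := fun t => (w t : ℂ) * g t with hG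
  have hGs : ContDiff ℝ ∞ G := (Complex.ofRealCLM.contDiff.comp w.contDiff).mul hs
  have hGc : HasCompactSupport G := by
    refine HasCompactSupport.of_support_subset_isCompact (isCompact_Icc (a := -(T + 1))
      (b := T + 1)) ?_
    exact (support_cutoff_mul_subset hT g).trans Set.Ioc_subset_Icc_self
  have hA : ∀ l, ‖𝓕 G l‖ ≤ 4 * η * T := by
    intro l
    rw [fourier_eq_integral_character]
    have e : (∫ x, character (-l) x * G x) = ∫ x, (w x : ℂ) * (g x * character (-l) x) := by
      congr 1
      ext x
      simp only [hG]
      ring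
    rw [e]
    refine (norm_integral_cutoff_mul_le hT (B := B) (by fun_prop)
      (fun x => by rw [norm_mul, norm_character, mul_one]; exact hgB x)).trans ?_
    have := hsup (-l) (2 * T) (by linarith) (-T)
    rw [show -T + 2 * T = T by ring] at this
    linarith
  obtain ⟨H, hH, hH2⟩ := exists_autocorrelation hGs hGc hA
  have hG2 : ∫ t, ‖G t‖ ^ 2 ≤ B ^ 2 * (2 * T + 2) := by
    have hsub : Function.support (fun t => ‖G t‖ ^ 2) ⊆ Set.Ioc (-(T + 1)) (T + 1) := by
      refine subset_trans ?_ (support_cutoff_mul_subset hT g)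
      intro x hx hx'
      apply hx
      simp only [hG, ← hw] at hx' ⊢
      simp [hx']
    rw [← intervalIntegral.integral_eq_integral_of_support_subset hsub]
    have : ‖∫ t in (-(T + 1))..(T + 1), ‖G t‖ ^ 2‖ ≤ B ^ 2 * |T + 1 - -(T + 1)| := by
      refine intervalIntegral.norm_integral_le_of_norm_le_const fun x _ => ?_
      rw [Real.norm_of_nonneg (by positivity)]
      gcongr
      exact (norm_cutoff_mul_le hT x _).trans (hgB x)
    rw [abs_of_pos (by linarith)] at this
    exact ((Real.le_norm_self _).trans this).trans (by ring_nf; rfl)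
  have hHint : Integrable fun u => ‖H u‖ ^ 2 :=
    (SchwartzMap.memLp H 2).integrable_norm_pow two_ne_zero
  have hHc : Continuous H := H.continuous
  have hlow : ∀ x ∈ Set.Icc 0 T, (c * T / 2) ^ 2 ≤ ∑ t ∈ s, ‖H (x - t)‖ ^ 2 := by
    intro x hx
    obtain ⟨t, ht, hper⟩ := hs' x
    have ht' := abs_le.1 (hKt t ht)
    have h1 := re_autocorrelation_ge (K := K) (u := x - t) hc hgB hT hK0
      (by linarith) (by linarith [hx.1]) (by linarith [hx.2]) hper
    have h2 := hT₁ (T - 2 * K) (by linarith) K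
    have h3 : c / (8 * B) * B * (2 * T + 2) = c * (T + 1) / 4 := by
      field_simp
      ring
    rw [h3] at h1
    have h4 := hH (x - t)
    have h5 : (H (x - t)).re ≤ ‖H (x - t)‖ := Complex.re_le_norm _
    rw [h4] at h5
    have h6 : c * T / 2 ≤ ‖H (x - t)‖ := by
      rw [h4]
      have : 0 ≤ c * (T - (8 * K + 1)) := mul_nonneg hc0.le (by linarith)
      refine le_trans ?_ h5
      refine le_trans ?_ h1
      linarith
    refine le_trans ?_ (Finset.single_le_sum (f := fun t => ‖H (x - t)‖ ^ 2)
      (fun i _ => by positivity) ht)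
    gcongr
  have h1 : (c * T / 2) ^ 2 * T ≤ N * ∫ u, ‖H u‖ ^ 2 := by
    have h2 := intervalIntegral.integral_mono_on (a := 0) (b := T) (μ := volume)
      (f := fun _ => (c * T / 2) ^ 2) (g := fun x => ∑ t ∈ s, ‖H (x - t)‖ ^ 2) hT.le (by simp)
      (Continuous.intervalIntegrable (by fun_prop) _ _) hlow
    rw [intervalIntegral.integral_const, smul_eq_mul, sub_zero,
      intervalIntegral.integral_finsetSum
      (fun t _ => Continuous.intervalIntegrable (by fun_prop) _ _)] at h2
    have h3 : ∀ t ∈ s, (∫ x in (0 : ℝ)..T, ‖H (x - t)‖ ^ 2) ≤ ∫ u, ‖H u‖ ^ 2 := by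
      intro t _
      rw [intervalIntegral.integral_comp_sub_right (fun u => ‖H u‖ ^ 2),
        intervalIntegral.integral_of_le (by linarith)]
      exact setIntegral_le_integral hHint (Eventually.of_forall fun u => by positivity)
    have h4 := Finset.sum_le_sum h3
    rw [Finset.sum_const, nsmul_eq_mul, ← hN] at h4
    linarith
  have h5 : ∫ u, ‖H u‖ ^ 2 ≤ (4 * η * T) ^ 2 * (B ^ 2 * (4 * T)) := by
    refine hH2.trans ?_
    gcongr
    refine hG2.trans ?_
    gcongr
    linarith
  have h6 : (c * T / 2) ^ 2 * T ≤ N * ((4 * η * T) ^ 2 * (B ^ 2 * (4 * T))) :=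
    h1.trans (by gcongr)
  have h7 : N * ((4 * η * T) ^ 2 * (B ^ 2 * (4 * T))) =
      c ^ 2 * T ^ 3 * (N / (16 * (N + 1) ^ 2)) := by
    rw [hη]
    field_simp
    ring
  have h8 : N / (16 * (N + 1) ^ 2) < 1 / 4 := by
    rw [div_lt_div_iff₀ (by positivity) (by norm_num)]
    nlinarith
  have h9 : c ^ 2 * T ^ 3 * (N / (16 * (N + 1) ^ 2)) < c ^ 2 * T ^ 3 * (1 / 4) := by
    gcongr
  nlinarith

end BochnerAP

/-! ### Bounds for almost periodic functions in the half-plane -/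

theorem isOpen_upperHalf : IsOpen upperHalf := isOpen_lt continuous_const Complex.continuous_im

/-- Phragmén–Lindelöf principle for a half-plane and functions of at most quadratic growth. -/
theorem norm_le_of_norm_le_on_line {F : ℂ → ℂ} {h A C : ℝ} (hF : DifferentiableOn ℂ F upperHalf)
    (hh : 0 < h) (hA : ∀ z : ℂ, h ≤ z.im → ‖F z‖ ≤ A * (1 + ‖z‖) ^ 2)
    (hC : ∀ x : ℝ, ‖F (x + h * I)‖ ≤ C) {z : ℂ} (hz : h ≤ z.im) : ‖F z‖ ≤ C := by
  have hA0 : 0 ≤ A := by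
    have := (norm_nonneg _).trans (hA (h * I) (by simp))
    exact nonneg_of_mul_nonneg_left this (by positivity)
  have hC0 : 0 ≤ C := (norm_nonneg _).trans (hC 0)
  have himw : ∀ w : ℂ, (I * w + h * I).im = w.re + h := fun w => by simp
  set w₀ : ℂ := -I * (z - h * I) with hw₀
  have hzw : I * w₀ + h * I = z := by
    rw [hw₀, ← mul_assoc, mul_neg, I_mul_I]; ring
  have hw₀re : 0 ≤ w₀.re := by
    have := himw w₀
    rw [hzw] at this
    linarith
  have key : ∀ ε : ℝ, 0 < ε → ‖F z‖ ≤ C * ‖1 + ε * w₀‖ ^ 3 := by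
    intro ε hε
    have hre : ∀ w : ℂ, 0 ≤ w.re → 1 ≤ (1 + ε * w).re := fun w hw => by
      simp; positivity
    have hne : ∀ w : ℂ, 0 ≤ w.re → 1 ≤ ‖1 + ε * w‖ := fun w hw =>
      (hre w hw).trans (Complex.re_le_norm _)
    have hne' : ∀ w : ℂ, 0 ≤ w.re → (1 + ε * w) ≠ 0 := fun w hw h0 => by
      have := hne w hw
      rw [h0, norm_zero] at this
      linarith
    -- The map w ↦ iw + ih carries the right half-plane onto Im z > h. The cubic denominator beats
    -- the quadratic growth, so G is bounded and tends to 0 along the positive axis; ε tends to 0 at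
    -- the end.
    set G : ℂ → ℂ := fun w => F (I * w + h * I) / (1 + ε * w) ^ 3 with hG
    set K : ℝ := A * (1 + h + 1 / ε) ^ 2 with hK
    have hbound : ∀ w : ℂ, 0 ≤ w.re → ‖G w‖ ≤ K / ‖1 + ε * w‖ := by
      intro w hw
      have h1 := hA (I * w + h * I) (by rw [himw]; linarith)
      have h2 : 1 + ‖I * w + h * I‖ ≤ (1 + h + 1 / ε) * ‖1 + ε * w‖ := by
        have h3 : ‖I * w + h * I‖ ≤ ‖w‖ + h := by
          refine (norm_add_le _ _).trans ?_
          simp [abs_of_pos hh]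
        have h4 : ε * ‖w‖ ≤ ‖1 + ε * w‖ := by
          have : ‖(ε : ℂ) * w‖ = ε * ‖w‖ := by
            rw [norm_mul, Complex.norm_real, Real.norm_of_nonneg hε.le]
          rw [← this, ← sq_le_sq₀ (norm_nonneg _) (norm_nonneg _), Complex.sq_norm, Complex.sq_norm,
            Complex.normSq_apply, Complex.normSq_apply]
          simp
          have : 0 ≤ ε * w.re := by positivity
          nlinarith
        have h5 := hne w hw
        have h6 : ‖w‖ ≤ 1 / ε * ‖1 + ε * w‖ := by
          rw [one_div, ← div_eq_inv_mul, le_div_iff₀ hε]; linarith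
        nlinarith
      rw [hG, norm_div, norm_pow, div_le_div_iff₀ (by have := hne w hw; positivity)
        (by have := hne w hw; positivity)]
      have h7 : A * (1 + ‖I * w + h * I‖) ^ 2 ≤ A * ((1 + h + 1 / ε) * ‖1 + ε * w‖) ^ 2 := by
        gcongr
      calc ‖F (I * w + h * I)‖ * ‖1 + ε * w‖ ≤
          A * ((1 + h + 1 / ε) * ‖1 + ε * w‖) ^ 2 * ‖1 + ε * w‖ := by
            gcongr
            exact h1.trans h7
        _ = K * ‖1 + ε * w‖ ^ 3 := by rw [hK]; ring
    have hK0 : 0 ≤ K := by positivity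
    have hd : DiffContOnCl ℂ G {w | 0 < w.re} := by
      refine DifferentiableOn.diffContOnCl fun w hw => ?_
      rw [Complex.closure_setOfPred_lt_re] at hw
      have hw' : (0 : ℝ) ≤ w.re := hw
      have hFd : DifferentiableAt ℂ F (I * w + h * I) := by
        refine hF.differentiableAt (isOpen_upperHalf.mem_nhds ?_)
        change 0 < (I * w + h * I).im
        rw [himw]; linarith
      have hcomp : DifferentiableAt ℂ (fun w => F (I * w + h * I)) w :=
        DifferentiableAt.comp w hFd (by fun_prop)
      have hden : DifferentiableAt ℂ (fun w : ℂ => (1 + (ε : ℂ) * w) ^ 3) w := by fun_prop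
      exact (hcomp.div hden (pow_ne_zero 3 (hne' w hw'))).differentiableWithinAt
    have hbd : ∀ w : ℂ, 0 ≤ w.re → ‖G w‖ ≤ K := fun w hw =>
      (hbound w hw).trans (div_le_self hK0 (hne w hw))
    have hmain := PhragmenLindelof.right_half_plane_of_tendsto_zero_on_real (C := C) hd
      ⟨0, by norm_num, 0, ?_⟩ ?_ ?_ hw₀re
    · have h1 := hne w₀ hw₀re
      rw [hG] at hmain
      dsimp only at hmain
      rw [hzw, norm_div, norm_pow, div_le_iff₀ (by positivity)] at hmain
      exact hmain
    · refine Asymptotics.IsBigO.of_bound K ?_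
      refine Filter.Eventually.filter_mono inf_le_right ?_
      refine Filter.eventually_principal.2 fun w hw => ?_
      simpa using hbd w (le_of_lt hw)
    · refine squeeze_zero_norm' (a := fun x : ℝ => K / (ε * x)) ?_
        (tendsto_const_nhds.div_atTop (tendsto_id.const_mul_atTop hε))
      filter_upwards [eventually_gt_atTop 0] with x hx
      refine (hbound x (by simpa using hx.le)).trans ?_
      gcongr
      refine le_trans ?_ (Complex.re_le_norm _)
      simp
    · intro x
      have h1 := hne (x * I) (by simp)
      rw [hG]
      dsimp only
      rw [norm_div, norm_pow]
      refine (div_le_self (norm_nonneg _) (one_le_pow₀ h1)).trans ?_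
      have e : I * (x * I) + h * I = ((-x : ℝ) : ℂ) + h * I := by
        rw [mul_left_comm, I_mul_I]; push_cast; ring
      rw [e]
      exact hC _
  have hlim : Tendsto (fun ε : ℝ => C * ‖1 + ε * w₀‖ ^ 3) (𝓝[>] 0) (𝓝 C) := by
    have : Continuous fun ε : ℝ => C * ‖1 + (ε : ℂ) * w₀‖ ^ 3 := by fun_prop
    have h1 := this.tendsto 0
    simp only [ofReal_zero, zero_mul, add_zero, norm_one, one_pow, mul_one] at h1
    exact h1.mono_left nhdsWithin_le_nhds
  exact ge_of_tendsto hlim (by filter_upwards [self_mem_nhdsWithin] with ε hε using key ε hε)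

/-- A holomorphic function in the upper half-plane which is almost periodic above the height `c`
and has at most quadratic growth away from the real line. -/
structure TemperedAP (f : ℂ → ℂ) (c : ℝ) : Prop where
  pos : 0 < c
  differentiableOn : DifferentiableOn ℂ f upperHalf
  almostPeriodic : AlmostPeriodicUpper fun z => f (z + c * I)
  growth : ∀ η : ℝ, 0 < η → ∃ C : ℝ, 0 < C ∧ ∀ z : ℂ, η ≤ z.im → ‖f z‖ ≤ C * (1 + ‖z‖) ^ 2

namespace TemperedAP

variable {f : ℂ → ℂ} {c : ℝ}

theorem differentiableAt (hf : TemperedAP f c) {z : ℂ} (hz : 0 < z.im) : DifferentiableAt ℂ f z :=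
  hf.differentiableOn.differentiableAt (isOpen_upperHalf.mem_nhds hz)

theorem continuous_line (hf : TemperedAP f c) {y : ℝ} (hy : 0 < y) :
    Continuous fun x : ℝ => f (x + y * I) := by
  rw [continuous_iff_continuousAt]
  intro x
  have h : ContinuousAt f (x + y * I) := (hf.differentiableAt (by simpa using hy)).continuousAt
  exact h.comp (f := fun x : ℝ => (x : ℂ) + y * I) (Continuous.continuousAt (by fun_prop))

theorem exists_translation (hf : TemperedAP f c) {a b ε : ℝ} (ha : c < a) (hab : a ≤ b)
    (hε : 0 < ε) :
    ∃ l : ℝ, 0 < l ∧ ∀ x : ℝ, ∃ t : ℝ, x + t ∈ Set.Ioo 0 l ∧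
      ∀ z : ℂ, a ≤ z.im → z.im ≤ b → ‖f z - f (z + t)‖ ≤ ε := by
  -- The closed strip a ≤ Im z ≤ b, lowered by c, lies in the open strip with these bounds.
  obtain ⟨τ, ⟨l, hl, hτ⟩, h⟩ := hf.almostPeriodic.2 ((a - c) / 2) (b - c + 1) ε (by linarith)
    (by linarith) hε
  refine ⟨l, hl, fun x => ?_⟩
  obtain ⟨t, ht, htτ⟩ := hτ (-x)
  refine ⟨t, ⟨by linarith [ht.1], by linarith [ht.2]⟩, fun z hz hz' => ?_⟩
  have := h t htτ (z - c * I) (by simp; linarith) (by simp; linarith)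
  dsimp only at this
  rwa [sub_add_cancel, sub_add_eq_add_sub, sub_add_cancel] at this

theorem exists_bound_line (hf : TemperedAP f c) {h : ℝ} (hh : c < h) :
    ∃ C : ℝ, ∀ x : ℝ, ‖f (x + h * I)‖ ≤ C := by
  obtain ⟨l, hl, ht⟩ := hf.exists_translation hh le_rfl one_pos
  obtain ⟨C, hC⟩ := (isCompact_Icc (a := (0 : ℝ)) (b := l)).exists_bound_of_continuousOn
    (hf.continuous_line (hf.pos.trans hh)).continuousOn
  refine ⟨C + 1, fun x => ?_⟩
  obtain ⟨t, hxt, h1⟩ := ht x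
  have h2 := h1 (x + h * I) (by simp) (by simp)
  have h3 := hC _ (Set.Ioo_subset_Icc_self hxt)
  rw [show (x : ℂ) + h * I + t = ((x + t : ℝ) : ℂ) + h * I by push_cast; ring] at h2
  have := norm_sub_norm_le (f (x + h * I)) (f (((x + t : ℝ) : ℂ) + h * I))
  linarith

/-- A bound on one line propagates to everything above it by Phragmén–Lindelöf, thanks to the
quadratic growth. -/
theorem exists_bound (hf : TemperedAP f c) {h : ℝ} (hh : c < h) :
    ∃ C : ℝ, 0 < C ∧ ∀ z : ℂ, h ≤ z.im → ‖f z‖ ≤ C := by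
  obtain ⟨C, hC⟩ := hf.exists_bound_line hh
  have hh0 := hf.pos.trans hh
  obtain ⟨A, -, hA⟩ := hf.growth h hh0
  have hC0 : 0 ≤ C := (norm_nonneg _).trans (hC 0)
  exact ⟨C + 1, by linarith, fun z hz =>
    (norm_le_of_norm_le_on_line hf.differentiableOn hh0 hA hC hz).trans (by linarith)⟩

/-- Cauchy's estimate on the disc tangent to the line of height h. The decay as Im z grows is needed
in `tendsto_vertical`. -/
theorem exists_deriv_bound (hf : TemperedAP f c) {h : ℝ} (hh : c < h) :
    ∃ K : ℝ, 0 < K ∧ ∀ z : ℂ, h < z.im → ‖deriv f z‖ ≤ K / (z.im - h) := by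
  obtain ⟨C, hC0, hC⟩ := hf.exists_bound hh
  refine ⟨C, hC0, fun z hz => ?_⟩
  have him : ∀ w ∈ Metric.closedBall z (z.im - h), h ≤ w.im := by
    intro w hw
    rw [Metric.mem_closedBall, dist_eq_norm] at hw
    have h1 := (abs_le.1 (Complex.abs_im_le_norm (w - z))).1
    rw [Complex.sub_im] at h1
    linarith
  refine Complex.norm_deriv_le_of_forall_mem_sphere_norm_le (by linarith) ?_
    fun w hw => hC w (him w (Metric.sphere_subset_closedBall hw))
  refine DifferentiableOn.diffContOnCl fun w hw => ?_
  have := him w (Metric.closure_ball_subset_closedBall hw)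
  exact (hf.differentiableAt (by linarith [hf.pos])).differentiableWithinAt

theorem exists_lipschitz (hf : TemperedAP f c) {h : ℝ} (hh : c < h) :
    ∃ K : ℝ, 0 < K ∧ ∀ z w : ℂ, h ≤ z.im → h ≤ w.im → ‖f z - f w‖ ≤ K * ‖z - w‖ := by
  obtain ⟨K, hK, hd⟩ := hf.exists_deriv_bound (h := (c + h) / 2) (by linarith)
  refine ⟨K / ((h - c) / 2), div_pos hK (by linarith), fun z w hz hw => ?_⟩
  refine Convex.norm_image_sub_le_of_norm_deriv_le (𝕜 := ℂ) (s := {z : ℂ | h ≤ z.im})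
    (fun z hz => hf.differentiableAt ?_) (fun z hz => ?_) (convex_halfSpace_im_ge h) hw hz
  · have hz' : h ≤ z.im := hz
    linarith [hf.pos]
  · have hz' : h ≤ z.im := hz
    refine (hd z (by linarith)).trans ?_
    gcongr
    linarith

/-- Bohr's condition implies Bochner's: an almost period brings any translation into a fixed bounded
interval, and the Lipschitz bound reduces that interval to a finite net. -/
theorem bochnerAP_line (hf : TemperedAP f c) {y : ℝ} (hy : c < y) :
    BochnerAP fun x : ℝ => f (x + y * I) := by
  refine ⟨hf.continuous_line (hf.pos.trans hy), fun ε hε => ?_⟩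
  classical
  obtain ⟨l, hl, ht⟩ := hf.exists_translation hy le_rfl (ε := ε / 2) (by linarith)
  obtain ⟨K, hK, hL⟩ := hf.exists_lipschitz hy
  obtain ⟨S, hS, hfin, hcov⟩ := totallyBounded_iff_subset.1
    (isCompact_Icc (a := (0 : ℝ)) (b := l)).totallyBounded _
    (Metric.dist_mem_uniformity (ε := ε / (2 * K)) (by positivity))
  refine ⟨hfin.toFinset, fun u => ?_⟩
  obtain ⟨t, hut, h1⟩ := ht u
  have h2 := hcov (Set.Ioo_subset_Icc_self hut)
  simp only [Set.mem_iUnion] at h2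
  obtain ⟨t', ht', hd⟩ := h2
  refine ⟨t', hfin.mem_toFinset.2 ht', fun x => ?_⟩
  have h3 := h1 (((x + u : ℝ) : ℂ) + y * I) (by simp) (by simp)
  have h4 := hL (((x + u : ℝ) : ℂ) + y * I + t) (((x + t' : ℝ) : ℂ) + y * I) (by simp) (by simp)
  have h5 : ‖((x + u : ℝ) : ℂ) + y * I + t - (((x + t' : ℝ) : ℂ) + y * I)‖ ≤ ε / (2 * K) := by
    have e : ((x + u : ℝ) : ℂ) + y * I + t - (((x + t' : ℝ) : ℂ) + y * I) =
        ((u + t - t' : ℝ) : ℂ) := by push_cast; ring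
    rw [e, Complex.norm_real, Real.norm_eq_abs, ← Real.dist_eq]
    exact le_of_lt hd
  have h6 : K * (ε / (2 * K)) = ε / 2 := by field_simp
  have h7 : K * ‖((x + u : ℝ) : ℂ) + y * I + t - (((x + t' : ℝ) : ℂ) + y * I)‖ ≤
      K * (ε / (2 * K)) := by gcongr
  rw [dist_eq_norm]
  have := norm_sub_le_norm_sub_add_norm_sub (f (((x + u : ℝ) : ℂ) + y * I))
    (f (((x + u : ℝ) : ℂ) + y * I + t)) (f (((x + t' : ℝ) : ℂ) + y * I))
  linarith

end TemperedAP

theorem sq_mul_exp_neg_sq_le (d : ℝ) : d ^ 2 * Real.exp (-d ^ 2) ≤ 1 := by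
  rw [Real.exp_neg, ← div_eq_mul_inv, div_le_one (Real.exp_pos _)]
  linarith [Real.add_one_le_exp (d ^ 2)]

namespace TemperedAP

variable {f : ℂ → ℂ} {c : ℝ}

/-- By the three lines theorem, `f` grows sublinearly also on the line of height `c`. -/
theorem exists_sqrt_growth (hf : TemperedAP f c) :
    ∃ K : ℝ, 0 < K ∧ ∀ z : ℂ, c ≤ z.im → ‖f z‖ ≤ K * √(1 + |z.re|) := by
  -- The heights c/2 and 7c/6 place c three quarters of the way up. Interpolating quadratic growth
  -- below with boundedness above leaves the exponent 2 · 1/4 = 1/2.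
  have hc := hf.pos
  set a := c / 2 with ha
  set b := 7 * c / 6 with hb
  obtain ⟨C₁, hC₁, h₁⟩ := hf.growth a (by linarith)
  obtain ⟨C₂, hC₂, h₂⟩ := hf.exists_bound (h := b) (by linarith)
  have hone : ∀ x : ℝ, 1 ≤ √(1 + |x|) := fun x => by
    rw [Real.one_le_sqrt]; linarith [abs_nonneg x]
  set K₁ := C₁ * (2 * (1 + b) ^ 2 + 2) * Real.exp (b ^ 2) with hK₁
  set K := max K₁ (C₂ * Real.exp (b ^ 2)) with hK
  have hK0 : 0 < K := lt_max_of_lt_right (by positivity)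
  have hb0 : 0 < b := by linarith
  have hab : a < b := by linarith
  suffices H : ∀ z : ℂ, c ≤ z.im → z.im ≤ b → ‖f z‖ ≤ K * √(1 + |z.re|) by
    refine ⟨max K C₂, by positivity, fun z hz => ?_⟩
    rcases le_total z.im b with h | h
    · exact (H z hz h).trans (by gcongr; exact le_max_left _ _)
    · refine (h₂ z h).trans ?_
      have := hone z.re
      have h3 := le_max_right K C₂
      nlinarith
  intro z hz hzb
  set x₀ := z.re with hx₀
  -- Multiplication by I turns vertical strips into horizontal ones. The Gaussian centred at x₀
  -- localises the quadratic growth, so that on the strip G is bounded by a multiple of (1 + |x₀|)².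
  set G : ℂ → ℂ := fun w => f (I * w) * exp (-(I * w - x₀) ^ 2) with hG
  have him : ∀ w : ℂ, (I * w).im = w.re := fun w => by simp
  have hexp : ∀ w : ℂ, ‖exp (-(I * w - x₀) ^ 2)‖ =
      Real.exp (w.re ^ 2) * Real.exp (-(w.im + x₀) ^ 2) := by
    intro w
    rw [Complex.norm_exp, ← Real.exp_add]
    congr 1
    simp [pow_two]
    ring
  have hsq : ∀ w : ℂ, a ≤ w.re → w.re ≤ b → Real.exp (w.re ^ 2) ≤ Real.exp (b ^ 2) := by
    intro w hw hw'
    rw [Real.exp_le_exp]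
    have : 0 ≤ w.re := by linarith
    gcongr
  have hbd : ∀ w : ℂ, a ≤ w.re → w.re ≤ b → ‖G w‖ ≤ K * (1 + |x₀|) ^ 2 := by
    intro w hw hw'
    have g1 := h₁ (I * w) (by rw [him]; exact hw)
    set d := |w.im + x₀| with hd
    have hd0 : 0 ≤ d := abs_nonneg _
    have g2 : 1 + ‖I * w‖ ≤ (1 + |x₀|) * (1 + b + d) := by
      have g3 : ‖I * w‖ ≤ |w.re| + |w.im| := by
        rw [norm_mul, Complex.norm_I, one_mul]
        exact Complex.norm_le_abs_re_add_abs_im w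
      rw [abs_of_nonneg (by linarith)] at g3
      have g4 : |w.im| ≤ d + |x₀| := by
        have := abs_sub (w.im + x₀) x₀
        rwa [add_sub_cancel_right] at this
      have g5 := abs_nonneg x₀
      nlinarith [mul_nonneg g5 hd0, mul_nonneg g5 hb0.le]
    have g6 : (1 + b + d) ^ 2 * Real.exp (-(w.im + x₀) ^ 2) ≤ 2 * (1 + b) ^ 2 + 2 := by
      have e1 : (w.im + x₀) ^ 2 = d ^ 2 := by rw [hd, sq_abs]
      rw [e1]
      have e2 := sq_mul_exp_neg_sq_le d
      have e3 : Real.exp (-d ^ 2) ≤ 1 := Real.exp_le_one_iff.2 (by nlinarith)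
      have e4 := Real.exp_pos (-d ^ 2)
      have e5 : (1 + b + d) ^ 2 ≤ 2 * (1 + b) ^ 2 + 2 * d ^ 2 := by nlinarith [sq_nonneg (1 + b - d)]
      calc _ ≤ (2 * (1 + b) ^ 2 + 2 * d ^ 2) * Real.exp (-d ^ 2) := by gcongr
        _ ≤ _ := by nlinarith [sq_nonneg (1 + b)]
    calc ‖G w‖ = ‖f (I * w)‖ * (Real.exp (w.re ^ 2) * Real.exp (-(w.im + x₀) ^ 2)) := by
          rw [hG]; dsimp only; rw [norm_mul, hexp]
      _ ≤ (C₁ * ((1 + |x₀|) * (1 + b + d)) ^ 2) *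
          (Real.exp (b ^ 2) * Real.exp (-(w.im + x₀) ^ 2)) := by
          have h7 := hsq w hw hw'
          have h8 := g1.trans (show _ ≤ C₁ * ((1 + |x₀|) * (1 + b + d)) ^ 2 by gcongr)
          exact mul_le_mul h8 (mul_le_mul_of_nonneg_right h7 (Real.exp_pos _).le)
            (by positivity) (by positivity)
      _ = C₁ * Real.exp (b ^ 2) * (1 + |x₀|) ^ 2 *
          ((1 + b + d) ^ 2 * Real.exp (-(w.im + x₀) ^ 2)) := by ring
      _ ≤ C₁ * Real.exp (b ^ 2) * (1 + |x₀|) ^ 2 * (2 * (1 + b) ^ 2 + 2) := by gcongr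
      _ = K₁ * (1 + |x₀|) ^ 2 := by rw [hK₁]; ring
      _ ≤ _ := by gcongr; exact le_max_left _ _
  set w₀ : ℂ := -I * z with hw₀
  have hzw : I * w₀ = z := by rw [hw₀, ← mul_assoc, mul_neg, I_mul_I]; ring
  have hw₀re : w₀.re = z.im := by rw [← him, hzw]
  have hd : DiffContOnCl ℂ G (Complex.HadamardThreeLines.verticalStrip a b) := by
    refine DifferentiableOn.diffContOnCl fun w hw => ?_
    have hw' : a ≤ w.re := by
      have : closure (Complex.HadamardThreeLines.verticalStrip a b) ⊆ {w | a ≤ w.re} :=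
        closure_minimal (fun w hw => le_of_lt hw.1) (isClosed_le continuous_const continuous_re)
      exact this hw
    have h4 : DifferentiableAt ℂ f (I * w) := hf.differentiableAt (by rw [him]; linarith)
    have h5 : DifferentiableAt ℂ (fun w => f (I * w)) w := DifferentiableAt.comp w h4 (by fun_prop)
    exact (h5.mul (by fun_prop)).differentiableWithinAt
  have hmain := Complex.HadamardThreeLines.norm_le_interp_of_mem_verticalClosedStrip' (f := G)
    (z := w₀) (a := K * (1 + |x₀|) ^ 2) (b := K) hab
    ⟨by linarith, by linarith⟩ hd
    ⟨K * (1 + |x₀|) ^ 2, by rintro _ ⟨w, hw, rfl⟩; exact hbd w hw.1 hw.2⟩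
    (fun w hw => by
      have : w.re = a := hw
      exact hbd w this.ge (by linarith))
    (fun w hw => by
      have hwb : w.re = b := hw
      rw [hG]; dsimp only; rw [norm_mul, hexp]
      rw [hwb]
      calc _ ≤ C₂ * (Real.exp (b ^ 2) * 1) := by
            gcongr
            · exact h₂ _ (by rw [him, hwb])
            · exact Real.exp_le_one_iff.2 (neg_nonpos.2 (sq_nonneg _))
        _ ≤ K := by rw [mul_one]; exact le_max_right _ _)
  rw [hw₀re] at hmain
  set θ := (z.im - a) / (b - a) with hθ
  have hθ34 : 3 / 4 ≤ θ := by
    rw [hθ, le_div_iff₀ (by linarith)]; linarith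
  have hleft : ‖f z‖ ≤ ‖G w₀‖ := by
    rw [hG]; dsimp only; rw [norm_mul, hexp, hzw, hw₀re]
    have e : w₀.im + x₀ = 0 := by rw [hw₀, hx₀]; simp
    rw [e]
    have : 1 ≤ Real.exp (z.im ^ 2) := Real.one_le_exp (sq_nonneg _)
    simp only [ne_eq, OfNat.ofNat_ne_zero, not_false_eq_true, zero_pow, neg_zero, Real.exp_zero,
      mul_one]
    exact le_mul_of_one_le_right (norm_nonneg _) this
  refine hleft.trans (hmain.trans ?_)
  have hq : 1 ≤ (1 + |x₀|) ^ 2 := one_le_pow₀ (by linarith [abs_nonneg x₀])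
  rw [Real.mul_rpow hK0.le (by positivity), mul_right_comm, ← Real.rpow_add hK0, sub_add_cancel,
    Real.rpow_one]
  gcongr
  calc ((1 + |x₀|) ^ 2) ^ (1 - θ) ≤ ((1 + |x₀|) ^ 2) ^ (1 / 4 : ℝ) :=
        Real.rpow_le_rpow_of_exponent_le hq (by linarith)
    _ = √(1 + |x₀|) := by
        rw [← Real.rpow_natCast, ← Real.rpow_mul (by positivity), Real.sqrt_eq_rpow]
        norm_num

end TemperedAP

/-! ### Fourier–Bohr coefficients and the local mean bound -/

theorem tendsto_sqrt_div_atTop (K : ℝ) :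
    Tendsto (fun T : ℝ => K * √(1 + |T|) / T) atTop (𝓝 0) := by
  have h1 : Tendsto (fun T : ℝ => √((1 + T) / T ^ 2)) atTop (𝓝 0) := by
    rw [← Real.sqrt_zero]
    refine (Real.continuous_sqrt.tendsto 0).comp ?_
    have h2 : Tendsto (fun T : ℝ => T⁻¹ * T⁻¹ + T⁻¹) atTop (𝓝 (0 * 0 + 0)) :=
      (tendsto_inv_atTop_zero.mul tendsto_inv_atTop_zero).add tendsto_inv_atTop_zero
    rw [zero_mul, add_zero] at h2
    refine h2.congr' ?_
    filter_upwards [eventually_gt_atTop 0] with T hT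
    field_simp
  have h3 := h1.const_mul K
  rw [mul_zero] at h3
  refine h3.congr' ?_
  filter_upwards [eventually_gt_atTop 0] with T hT
  rw [abs_of_pos hT, Real.sqrt_div (by positivity), Real.sqrt_sq hT.le, mul_div_assoc]

/-- Means along two horizontal lines agree for functions of sublinear growth. -/
theorem tendsto_mean_sub_mean {F : ℂ → ℂ} (hF : DifferentiableOn ℂ F upperHalf) {y₁ y₂ K : ℝ}
    (hy₁ : 0 < y₁) (hy : y₁ ≤ y₂)
    (hK : ∀ z : ℂ, y₁ ≤ z.im → z.im ≤ y₂ → ‖F z‖ ≤ K * √(1 + |z.re|)) :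
    Tendsto (fun T : ℝ => (1 / (2 * T) : ℂ) * ((∫ x in (-T)..T, F (x + y₁ * I)) -
      ∫ x in (-T)..T, F (x + y₂ * I))) atTop (𝓝 0) := by
  refine squeeze_zero_norm' (a := fun T => (K * |y₂ - y₁|) * √(1 + |T|) / T) ?_
    (tendsto_sqrt_div_atTop _)
  filter_upwards [eventually_gt_atTop 0] with T hT
  have hrect := Complex.integral_boundary_rect_eq_zero_of_differentiableOn F (((-T : ℝ) : ℂ) + y₁ * I)
    ((T : ℂ) + y₂ * I) (by
      refine hF.mono fun z hz => ?_
      have := hz.2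
      simp only [add_im, ofReal_im, mul_im, ofReal_re, I_im, mul_one, I_re, mul_zero, add_zero,
        zero_add, Set.mem_preimage, Set.uIcc_of_le hy] at this
      exact hy₁.trans_le this.1)
  simp only [add_im, add_re, mul_re, ofReal_im, mul_im, ofReal_re, I_im, mul_one, I_re, mul_zero,
    add_zero, zero_add, sub_self, smul_eq_mul] at hrect
  -- By Cauchy's theorem the difference of the horizontal integrals is carried by the vertical
  -- sides, which are O(√T).
  have hv : ∀ s : ℝ, |s| = T → ‖∫ y in y₁..y₂, F (s + y * I)‖ ≤ K * √(1 + |T|) * |y₂ - y₁| := by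
    intro s hs
    refine intervalIntegral.norm_integral_le_of_norm_le_const fun y hy' => ?_
    rw [Set.uIoc_of_le hy] at hy'
    have := hK (s + y * I) (by simpa using hy'.1.le) (by simpa using hy'.2)
    simpa [hs, abs_of_pos hT] using this
  have e : (∫ x in (-T)..T, F (x + y₁ * I)) - (∫ x in (-T)..T, F (x + y₂ * I)) =
      I * (∫ y in y₁..y₂, F (((-T : ℝ) : ℂ) + y * I)) - I * ∫ y in y₁..y₂, F (T + y * I) := by
    linear_combination hrect
  have h1 := hv (-T) (by rw [abs_neg, abs_of_pos hT])
  have h2 := hv T (abs_of_pos hT)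
  have h3 : ‖(1 / (2 * T) : ℂ)‖ = 1 / (2 * T) := by
    rw [show (1 / (2 * T) : ℂ) = ((1 / (2 * T) : ℝ) : ℂ) by push_cast; rfl, Complex.norm_real,
      Real.norm_of_nonneg (by positivity)]
  rw [e, norm_mul, h3, ← mul_sub, norm_mul, Complex.norm_I, one_mul]
  have h4 := norm_sub_le (∫ y in y₁..y₂, F (((-T : ℝ) : ℂ) + y * I)) (∫ y in y₁..y₂, F (T + y * I))
  rw [div_mul_eq_mul_div, one_mul, div_le_div_iff₀ (by positivity) hT]
  nlinarith

/-- `f(z) exp (-2π i l z)`. -/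
def modulated (f : ℂ → ℂ) (l : ℝ) (z : ℂ) : ℂ := f z * exp (-2 * Real.pi * I * l * z)

/-- The Fourier-Bohr coefficient of `f`, computed on the line of height `c + 1`. -/
def bohrCoeff (f : ℂ → ℂ) (c l : ℝ) : ℂ :=
  bohrMean fun x : ℝ => modulated f l (x + (c + 1 : ℝ) * I)

theorem exp_modulation (l x y : ℝ) :
    exp (-2 * Real.pi * I * l * (x + y * I)) = Real.exp (2 * Real.pi * l * y) * character (-l) x := by
  unfold character
  rw [Complex.ofReal_exp, ← Complex.exp_add]
  congr 1
  push_cast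
  ring_nf
  rw [I_sq]
  ring

theorem norm_exp_modulation (l : ℝ) (z : ℂ) :
    ‖exp (-2 * Real.pi * I * l * z)‖ = Real.exp (2 * Real.pi * l * z.im) := by
  rw [Complex.norm_exp]
  congr 1
  simp

theorem modulated_line (f : ℂ → ℂ) (l x y : ℝ) :
    modulated f l (x + y * I) =
      Real.exp (2 * Real.pi * l * y) * (f (x + y * I) * character (-l) x) := by
  rw [modulated, exp_modulation]
  ring

theorem conj_trigPoly {N : ℕ} (θ : Fin N → ℝ) (p : Fin N → ℂ) (x : ℝ) :
    conj (trigPoly θ p x) = ∑ n, conj (p n) * character (-θ n) x := by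
  unfold trigPoly
  rw [map_sum]
  refine Finset.sum_congr rfl fun n _ => ?_
  rw [map_mul, ← conj_character]
  rfl

namespace TemperedAP

variable {f : ℂ → ℂ} {c : ℝ}

theorem bochnerAP_modulated (hf : TemperedAP f c) {y : ℝ} (hy : c < y) (l : ℝ) :
    BochnerAP fun x : ℝ => modulated f l (x + y * I) := by
  simp_rw [modulated_line]
  exact (BochnerAP.const _).mul ((hf.bochnerAP_line hy).mul (bochnerAP_character _))

/-- Almost periodicity is available only above c, but the mean bound may be given at height c
itself; this is why the contour is shifted from c + 1 and the square-root growth is needed. -/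
theorem tendsto_bohrCoeff (hf : TemperedAP f c) {y : ℝ} (hy : c ≤ y) (l : ℝ) :
    Tendsto (fun T : ℝ => (1 / (2 * T) : ℂ) * ∫ x in (-T)..T, modulated f l (x + y * I)) atTop
      (𝓝 (bohrCoeff f c l)) := by
  have h0 := (hf.bochnerAP_modulated (y := c + 1) (by linarith) l).tendsto_symm_mean
  obtain ⟨K, hK, hKf⟩ := hf.exists_sqrt_growth
  have hd : DifferentiableOn ℂ (modulated f l) upperHalf := by
    unfold modulated
    exact hf.differentiableOn.mul (Differentiable.differentiableOn (by fun_prop))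
  have hbd : ∀ Y : ℝ, ∀ z : ℂ, c ≤ z.im → z.im ≤ Y →
      ‖modulated f l z‖ ≤ (K * Real.exp (2 * Real.pi * |l| * Y)) * √(1 + |z.re|) := by
    intro Y z hz hz'
    rw [modulated, norm_mul, norm_exp_modulation]
    have h1 : Real.exp (2 * Real.pi * l * z.im) ≤ Real.exp (2 * Real.pi * |l| * Y) := by
      rw [Real.exp_le_exp]
      have : 0 ≤ z.im := hf.pos.le.trans hz
      have hp := Real.pi_pos
      calc 2 * Real.pi * l * z.im ≤ 2 * Real.pi * |l| * z.im := by gcongr; exact le_abs_self l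
        _ ≤ _ := by gcongr
    calc _ ≤ (K * √(1 + |z.re|)) * Real.exp (2 * Real.pi * |l| * Y) := by
          gcongr
          exact hKf z hz
      _ = _ := by ring
  rcases le_total y (c + 1) with h | h
  · have h1 := tendsto_mean_sub_mean hd (hf.pos.trans_le hy) h
      (fun z hz hz' => hbd (c + 1) z (hy.trans hz) hz')
    have h2 := h1.add h0
    rw [zero_add] at h2
    refine h2.congr fun T => ?_
    ring
  · have h1 := tendsto_mean_sub_mean hd (y₁ := c + 1) (by linarith [hf.pos]) h
      (fun z hz hz' => hbd y z (by linarith) hz')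
    have h2 := h0.sub h1
    rw [sub_zero] at h2
    refine h2.congr fun T => ?_
    ring

theorem hasFourierBohrCoeffs (hf : TemperedAP f c) : HasFourierBohrCoeffs f c (bohrCoeff f c) :=
  fun l _ hy => hf.tendsto_bohrCoeff hy.le l

theorem norm_bohrCoeff_le (hf : TemperedAP f c) {h C : ℝ} (hh : c < h)
    (hC : ∀ z : ℂ, h ≤ z.im → ‖f z‖ ≤ C) (l : ℝ) {y : ℝ} (hy : h ≤ y) :
    ‖bohrCoeff f c l‖ ≤ C * Real.exp (2 * Real.pi * l * y) := by
  refine le_of_tendsto (hf.tendsto_bohrCoeff (hh.le.trans hy) l).norm ?_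
  filter_upwards [eventually_gt_atTop 0] with T hT
  have h1 : ‖∫ x in (-T)..T, modulated f l (x + y * I)‖ ≤
      (C * Real.exp (2 * Real.pi * l * y)) * |T - -T| := by
    refine intervalIntegral.norm_integral_le_of_norm_le_const fun x _ => ?_
    rw [modulated, norm_mul, norm_exp_modulation]
    have him : ((x : ℂ) + y * I).im = y := by simp
    rw [him]
    gcongr
    exact hC _ (by rw [him]; exact hy)
  have h3 : ‖(1 / (2 * T) : ℂ)‖ = 1 / (2 * T) := by
    rw [show (1 / (2 * T) : ℂ) = ((1 / (2 * T) : ℝ) : ℂ) by push_cast; rfl, Complex.norm_real,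
      Real.norm_of_nonneg (by positivity)]
  rw [norm_mul, h3, one_div, inv_mul_le_iff₀ (by positivity)]
  rw [abs_of_pos (by linarith)] at h1
  linarith

/-- The height in `norm_bohrCoeff_le` is free, and the bound decays exponentially in it when l < 0.
-/
theorem bohrCoeff_eq_zero_of_neg (hf : TemperedAP f c) {l : ℝ} (hl : l < 0) :
    bohrCoeff f c l = 0 := by
  obtain ⟨C, hC0, hC⟩ := hf.exists_bound (h := c + 1) (by linarith)
  have hlim : Tendsto (fun y : ℝ => C * Real.exp (2 * Real.pi * l * y)) atTop (𝓝 0) := by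
    rw [← mul_zero C]
    refine (Real.tendsto_exp_atBot.comp ?_).const_mul C
    exact tendsto_id.const_mul_atTop_of_neg (by have := Real.pi_pos; nlinarith)
  have := ge_of_tendsto hlim (by
    filter_upwards [eventually_ge_atTop (c + 1)] with y hy using
      hf.norm_bohrCoeff_le (by linarith) hC l hy)
  exact norm_le_zero_iff.1 this

theorem tendsto_mean_mul_conj_trigPoly (hf : TemperedAP f c) {y : ℝ} (hy : c ≤ y) {N : ℕ}
    (θ : Fin N → ℝ) (p : Fin N → ℂ) :
    Tendsto (fun T : ℝ => (1 / (2 * T) : ℂ) *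
        ∫ x in (-T)..T, f (x + y * I) * conj (trigPoly θ p x)) atTop
      (𝓝 (∑ n, conj (p n) * Real.exp (-(2 * Real.pi * θ n * y)) * bohrCoeff f c (θ n))) := by
  have hcont := hf.continuous_line (hf.pos.trans_le hy)
  have h1 := tendsto_finsetSum Finset.univ fun n (_ : n ∈ Finset.univ) =>
    (hf.tendsto_bohrCoeff hy (θ n)).const_mul (conj (p n) * Real.exp (-(2 * Real.pi * θ n * y)))
  refine h1.congr fun T => ?_
  have h2 : ∀ x : ℝ, f (x + y * I) * conj (trigPoly θ p x) =
      ∑ n, (conj (p n) * Real.exp (-(2 * Real.pi * θ n * y))) * modulated f (θ n) (x + y * I) := by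
    intro x
    rw [conj_trigPoly, Finset.mul_sum]
    refine Finset.sum_congr rfl fun n _ => ?_
    have h3 : ((Real.exp (-(2 * Real.pi * θ n * y)) : ℝ) : ℂ) *
        (Real.exp (2 * Real.pi * θ n * y) : ℝ) = 1 := by
      rw [← Complex.ofReal_mul, ← Real.exp_add]; simp
    rw [modulated_line]
    linear_combination (-(f (x + y * I) * conj (p n) * character (-θ n) x)) * h3
  simp_rw [h2]
  rw [intervalIntegral.integral_finsetSum, Finset.mul_sum]
  · refine Finset.sum_congr rfl fun n _ => ?_
    rw [intervalIntegral.integral_const_mul]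
    ring
  · intro n _
    refine Continuous.intervalIntegrable ?_ _ _
    simp_rw [modulated_line]
    exact continuous_const.mul (continuous_const.mul (hcont.mul (continuous_character _)))

theorem limsup_mean_eq (hf : TemperedAP f c) {y : ℝ} (hy : c ≤ y) {N : ℕ}
    (θ : Fin N → ℝ) (p : Fin N → ℂ) :
    limsup (fun T : ℝ => ((‖(1 / (2 * T) : ℂ) *
        ∫ x in (-T)..T, f (x + y * I) * conj (trigPoly θ p x)‖ : ℝ) : EReal)) atTop =
      ((‖∑ n, conj (p n) * Real.exp (-(2 * Real.pi * θ n * y)) * bohrCoeff f c (θ n)‖ : ℝ) :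
        EReal) :=
  ((continuous_coe_real_ereal.tendsto _).comp
    (hf.tendsto_mean_mul_conj_trigPoly hy θ p).norm).limsup_eq

/-- Test polynomials with unimodular coefficients turn the local mean bound into absolute
summability of the coefficients. -/
theorem sum_norm_bohrCoeff_le (hf : TemperedAP f c) {y M B : ℝ} (hy : c ≤ y)
    (hB : ∀ (N : ℕ) (θ : Fin N → ℝ) (p : Fin N → ℂ), Function.Injective θ →
      (∀ n, θ n ∈ Set.Icc 0 M) →
      limsup (fun T : ℝ => ((‖(1 / (2 * T) : ℂ) *
          ∫ x in (-T)..T, f (x + y * I) * conj (trigPoly θ p x)‖ : ℝ) : EReal)) atTop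
        ≤ ((B * ‖p‖ : ℝ) : EReal)) (hB0 : 0 ≤ B) (S : Finset ℝ) (hS : ∀ l ∈ S, l ∈ Set.Icc 0 M) :
    ∑ l ∈ S, ‖bohrCoeff f c l‖ ≤ B * Real.exp (2 * Real.pi * M * y) := by
  set θ : Fin S.card → ℝ := fun n => (S.equivFin.symm n : ℝ) with hθ
  have hy0 : 0 < y := hf.pos.trans_le hy
  have hp := Real.pi_pos
  -- The phase of each coefficient, equal to 0 by the convention for division by zero where the
  -- coefficient vanishes. Every term of the mean becomes a nonnegative real.
  set p : Fin S.card → ℂ := fun n =>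
    bohrCoeff f c (θ n) / (‖bohrCoeff f c (θ n)‖ : ℝ) with hpdef
  have hθi : Function.Injective θ := Subtype.val_injective.comp S.equivFin.symm.injective
  have hθm : ∀ n, θ n ∈ Set.Icc 0 M := fun n => hS _ (S.equivFin.symm n).2
  have h1 := hB _ θ p hθi hθm
  rw [hf.limsup_mean_eq hy, EReal.coe_le_coe_iff] at h1
  have hp1 : ‖p‖ ≤ 1 := by
    refine (pi_norm_le_iff_of_nonneg zero_le_one).2 fun n => ?_
    rw [hpdef]
    dsimp only
    rw [norm_div, Complex.norm_real, norm_norm]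
    exact div_self_le_one _
  have h2 : ∀ n, conj (p n) * Real.exp (-(2 * Real.pi * θ n * y)) * bohrCoeff f c (θ n) =
      ((Real.exp (-(2 * Real.pi * θ n * y)) * ‖bohrCoeff f c (θ n)‖ : ℝ) : ℂ) := by
    intro n
    rw [hpdef]
    dsimp only
    by_cases h0 : bohrCoeff f c (θ n) = 0
    · simp [h0]
    have h0' : ((‖bohrCoeff f c (θ n)‖ : ℝ) : ℂ) ≠ 0 := by
      exact_mod_cast norm_ne_zero_iff.2 h0
    rw [map_div₀, conj_ofReal]
    have h3 := Complex.conj_mul' (bohrCoeff f c (θ n))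
    push_cast
    field_simp
    linear_combination h3
  simp_rw [h2] at h1
  rw [← Complex.ofReal_sum, Complex.norm_real, Real.norm_of_nonneg (by positivity)] at h1
  have h4 : ∑ l ∈ S, ‖bohrCoeff f c l‖ = ∑ n, ‖bohrCoeff f c (θ n)‖ := by
    rw [← Finset.sum_coe_sort S (fun l => ‖bohrCoeff f c l‖)]
    exact (Equiv.sum_comp S.equivFin.symm (fun l : S => ‖bohrCoeff f c l‖)).symm
  have h5 : ∀ n, Real.exp (-(2 * Real.pi * M * y)) ≤ Real.exp (-(2 * Real.pi * θ n * y)) := by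
    intro n
    rw [Real.exp_le_exp, neg_le_neg_iff]
    gcongr
    exact (hθm n).2
  have h6 : Real.exp (-(2 * Real.pi * M * y)) * ∑ n, ‖bohrCoeff f c (θ n)‖ ≤ B := by
    rw [Finset.mul_sum]
    refine le_trans (Finset.sum_le_sum fun n _ => ?_) (h1.trans (mul_le_of_le_one_right hB0 hp1))
    exact mul_le_mul_of_nonneg_right (h5 n) (norm_nonneg _)
  rw [h4]
  rw [Real.exp_neg, inv_mul_le_iff₀ (Real.exp_pos _)] at h6
  linarith

theorem locallySummable_bohrCoeff (hf : TemperedAP f c) {y : ℝ} (hy : c ≤ y)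
    (h : LocalMeanBound f y) : LocallySummable (bohrCoeff f c) := by
  have hsum : ∀ T : ℝ, 0 < T → Summable fun l : Set.Icc (-T) T => ‖bohrCoeff f c l‖ := by
    intro T hT
    obtain ⟨B, hB0, hB⟩ := h T hT
    refine summable_of_sum_le (c := B * Real.exp (2 * Real.pi * T * y)) (fun _ => norm_nonneg _)
      fun u => ?_
    classical
    have h1 := hf.sum_norm_bohrCoeff_le hy hB hB0.le
      ((u.map (Function.Embedding.subtype _)).filter (0 ≤ ·)) (by
        intro l hl
        rw [Finset.mem_filter, Finset.mem_map] at hl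
        obtain ⟨⟨a, _, rfl⟩, h0⟩ := hl
        exact ⟨h0, a.2.2⟩)
    refine le_trans (le_of_eq ?_) h1
    rw [Finset.sum_filter_of_ne, Finset.sum_map]
    · rfl
    · intro l _ hl
      by_contra h0
      exact hl (by rw [hf.bohrCoeff_eq_zero_of_neg (not_le.1 h0), norm_zero])
  refine ⟨?_, hsum⟩
  have hcov : Function.support (bohrCoeff f c) ⊆
      ⋃ n : ℕ, Subtype.val '' (Function.support fun l : Set.Icc (-(n + 1 : ℝ)) (n + 1) =>
        ‖bohrCoeff f c l‖) := by
    intro l hl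
    obtain ⟨n, hn⟩ := exists_nat_ge |l|
    refine Set.mem_iUnion.2 ⟨n, ⟨l, abs_le.1 (hn.trans (by linarith))⟩, ?_, rfl⟩
    simpa using hl
  refine Set.Countable.mono hcov (Set.countable_iUnion fun n => Set.Countable.image ?_ _)
  exact (hsum (n + 1) (by positivity)).countable_support

theorem localMeanBound_of_locallySummable (hf : TemperedAP f c)
    (h : LocallySummable (bohrCoeff f c)) {y : ℝ} (hy : c ≤ y) : LocalMeanBound f y := by
  intro M hM
  have hs := h.2 M hM
  -- The added 1 keeps the constant positive even if all coefficients vanish.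
  refine ⟨(∑' l : Set.Icc (-M) M, ‖bohrCoeff f c l‖) + 1,
    add_pos_of_nonneg_of_pos (tsum_nonneg fun _ => norm_nonneg _) one_pos,
    fun N θ p hθ hθM => ?_⟩
  rw [hf.limsup_mean_eq hy, EReal.coe_le_coe_iff]
  have hy0 : 0 < y := hf.pos.trans_le hy
  have hp := Real.pi_pos
  have h1 : ∀ n, ‖conj (p n) * Real.exp (-(2 * Real.pi * θ n * y)) * bohrCoeff f c (θ n)‖ ≤
      ‖p‖ * ‖bohrCoeff f c (θ n)‖ := by
    intro n
    rw [norm_mul, norm_mul, RCLike.norm_conj, Complex.norm_real,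
      Real.norm_of_nonneg (Real.exp_pos _).le]
    have h2 : Real.exp (-(2 * Real.pi * θ n * y)) ≤ 1 := by
      rw [Real.exp_le_one_iff, neg_nonpos]
      have := (hθM n).1
      positivity
    gcongr
    calc ‖p n‖ * Real.exp (-(2 * Real.pi * θ n * y)) ≤ ‖p n‖ * 1 := by gcongr
      _ ≤ ‖p‖ := by rw [mul_one]; exact norm_le_pi_norm p n
  refine (norm_sum_le _ _).trans ((Finset.sum_le_sum fun n _ => h1 n).trans ?_)
  rw [← Finset.mul_sum, mul_comm]
  gcongr
  let e : Fin N ↪ Set.Icc (-M) M :=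
    ⟨fun n => ⟨θ n, by linarith [(hθM n).1], (hθM n).2⟩, fun a b hab =>
      hθ (congrArg Subtype.val hab)⟩
  have h3 := hs.sum_le_tsum (Finset.univ.map e) (fun _ _ => norm_nonneg _)
  rw [Finset.sum_map] at h3
  have h4 : ∑ n, ‖bohrCoeff f c (θ n)‖ = ∑ n, ‖bohrCoeff f c (e n)‖ := rfl
  linarith

theorem localMeanBound_iff (hf : TemperedAP f c) :
    (∃ y : ℝ, c ≤ y ∧ LocalMeanBound f y) ↔ LocallySummable (bohrCoeff f c) :=
  ⟨fun ⟨_, hy, h⟩ => hf.locallySummable_bohrCoeff hy h,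
    fun h => ⟨c, le_rfl, hf.localMeanBound_of_locallySummable h le_rfl⟩⟩

end TemperedAP

namespace BochnerAP

variable {g h : ℝ → ℂ}

theorem bohrMean_const_mul (c : ℂ) (hg : BochnerAP g) :
    bohrMean (fun x => c * g x) = c * bohrMean g := by
  refine tendsto_nhds_unique ((BochnerAP.const c).mul hg).tendsto_bohrMean
    ((hg.tendsto_bohrMean.const_mul c).congr fun T => ?_)
  rw [intervalIntegral.integral_const_mul]
  ring

theorem bohrMean_sub (hg : BochnerAP g) (hh : BochnerAP h) :
    bohrMean (fun x => g x - h x) = bohrMean g - bohrMean h := by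
  refine tendsto_nhds_unique (hg.sub hh).tendsto_bohrMean
    ((hg.tendsto_bohrMean.sub hh.tendsto_bohrMean).congr fun T => ?_)
  rw [intervalIntegral.integral_sub (hg.continuous.intervalIntegrable _ _)
    (hh.continuous.intervalIntegrable _ _), mul_sub]

theorem bohrMean_sum {ι : Type*} (s : Finset ι) {g : ι → ℝ → ℂ} (hg : ∀ i ∈ s, BochnerAP (g i)) :
    bohrMean (fun x => ∑ i ∈ s, g i x) = ∑ i ∈ s, bohrMean (g i) := by
  refine tendsto_nhds_unique (BochnerAP.sum s hg).tendsto_bohrMean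
    ((tendsto_finsetSum s fun i hi => (hg i hi).tendsto_bohrMean).congr fun T => ?_)
  rw [intervalIntegral.integral_finsetSum
    (fun i hi => (hg i hi).continuous.intervalIntegrable _ _), Finset.mul_sum]

theorem norm_inv_mul_integral_le {B T : ℝ} (hT : 0 < T) (hB : ∀ x, ‖g x‖ ≤ B) (a : ℝ) :
    ‖(T : ℂ)⁻¹ * ∫ x in a..(a + T), g x‖ ≤ B := by
  have : ‖∫ x in a..(a + T), g x‖ ≤ B * |a + T - a| :=
    intervalIntegral.norm_integral_le_of_norm_le_const fun x _ => hB x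
  rw [add_sub_cancel_left, abs_of_pos hT] at this
  rw [norm_mul, norm_inv, Complex.norm_real, Real.norm_of_nonneg hT.le, inv_mul_le_iff₀ hT]
  linarith

theorem norm_bohrMean_le (hg : BochnerAP g) {B : ℝ} (hB : ∀ x, ‖g x‖ ≤ B) : ‖bohrMean g‖ ≤ B := by
  refine le_of_tendsto hg.tendsto_bohrMean.norm ?_
  filter_upwards [eventually_gt_atTop 0] with T hT
  simpa using norm_inv_mul_integral_le hT hB 0

theorem tendsto_mean_translate (hg : BochnerAP g) (a : ℝ) :
    Tendsto (fun T : ℝ => (T : ℂ)⁻¹ * ∫ x in a..(a + T), g x) atTop (𝓝 (bohrMean g)) := by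
  rw [Metric.tendsto_atTop]
  intro ε hε
  obtain ⟨T₀, hT₀, h⟩ := hg.exists_norm_integral_sub_mean_le (ε := ε / 2) (by linarith)
  refine ⟨T₀, fun T hT => ?_⟩
  have hT0 : 0 < T := by linarith
  have hTc : (T : ℂ) ≠ 0 := by exact_mod_cast hT0.ne'
  have e : (T : ℂ)⁻¹ * (∫ x in a..(a + T), g x) - bohrMean g =
      (T : ℂ)⁻¹ * ((∫ x in a..(a + T), g x) - T * bohrMean g) := by
    field_simp
  rw [dist_eq_norm, e, norm_mul, norm_inv, Complex.norm_real, Real.norm_of_nonneg hT0.le,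
    inv_mul_lt_iff₀ hT0]
  have := h T hT a
  nlinarith

end BochnerAP

theorem bohrMean_character {l : ℝ} (hl : l ≠ 0) : bohrMean (character l) = 0 := by
  refine tendsto_nhds_unique (bochnerAP_character l).tendsto_bohrMean ?_
  have hl' : (2 * Real.pi * I * l : ℂ) ≠ 0 := by
    simp [Real.pi_ne_zero, hl]
  have h1 : ∀ T : ℝ, (∫ x in (0 : ℝ)..T, character l x) =
      (character l T - 1) / (2 * Real.pi * I * l) := by
    intro T
    unfold character
    rw [integral_exp_mul_complex hl']
    simp
  simp_rw [h1]
  refine squeeze_zero_norm' (a := fun T : ℝ => (2 / ‖(2 * Real.pi * I * l : ℂ)‖) / T) ?_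
    (tendsto_const_nhds.div_atTop tendsto_id)
  filter_upwards [eventually_gt_atTop 0] with T hT
  rw [norm_mul, norm_inv, Complex.norm_real, Real.norm_of_nonneg hT.le, norm_div,
    ← div_eq_inv_mul]
  gcongr
  refine (norm_sub_le _ _).trans ?_
  rw [norm_character, norm_one]
  norm_num

theorem bohrMean_one : bohrMean (fun _ => 1) = 1 := by
  refine tendsto_nhds_unique (BochnerAP.const 1).tendsto_bohrMean
    (tendsto_const_nhds.congr' ?_)
  filter_upwards [eventually_gt_atTop 0] with T hT
  have hTc : (T : ℂ) ≠ 0 := by exact_mod_cast hT.ne'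
  simp [hTc]

/-! ### Absolutely convergent exponential series -/

/-- The series `∑ b l exp (2π i l z)`. -/
def expSeries (b : ℝ → ℂ) (z : ℂ) : ℂ := ∑' l : ℝ, b l * exp (2 * Real.pi * I * l * z)

section ExpSeries

variable {b : ℝ → ℂ}

theorem norm_expSeries_term (b : ℝ → ℂ) (l : ℝ) (z : ℂ) :
    ‖b l * exp (2 * Real.pi * I * l * z)‖ = ‖b l‖ * Real.exp (-(2 * Real.pi * l * z.im)) := by
  rw [norm_mul, Complex.norm_exp]
  congr 2
  simp

theorem norm_expSeries_term_le (hneg : ∀ l < 0, b l = 0) (l : ℝ) {z : ℂ} (hz : 0 ≤ z.im) :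
    ‖b l * exp (2 * Real.pi * I * l * z)‖ ≤ ‖b l‖ := by
  rw [norm_expSeries_term]
  rcases lt_or_ge l 0 with hl | hl
  · simp [hneg l hl]
  · have hp := Real.pi_pos
    exact mul_le_of_le_one_right (norm_nonneg _)
      (Real.exp_le_one_iff.2 (neg_nonpos.2 (by positivity)))

theorem differentiableOn_expSeries (hb : Summable fun l => ‖b l‖) (hneg : ∀ l < 0, b l = 0) :
    DifferentiableOn ℂ (expSeries b) upperHalf :=
  differentiableOn_tsum_of_summable_norm hb
    (fun l => Differentiable.differentiableOn (by fun_prop)) isOpen_upperHalf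
    fun l _ hz => norm_expSeries_term_le hneg l (le_of_lt hz)

theorem expSeries_term_line (b : ℝ → ℂ) (l x y : ℝ) :
    b l * exp (2 * Real.pi * I * l * (x + y * I)) =
      (b l * Real.exp (-(2 * Real.pi * l * y))) * character l x := by
  unfold character
  rw [Complex.ofReal_exp, mul_assoc (b l), ← Complex.exp_add]
  congr 2
  push_cast
  ring_nf
  rw [I_sq]
  ring

theorem expSeries_tendstoUniformly (hb : Summable fun l => ‖b l‖) (hneg : ∀ l < 0, b l = 0)
    {y : ℝ} (hy : 0 ≤ y) :
    TendstoUniformly (fun (s : Finset ℝ) (x : ℝ) => ∑ l ∈ s,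
      (b l * Real.exp (-(2 * Real.pi * l * y))) * character l x)
      (fun x => expSeries b (x + y * I)) atTop := by
  have := tendstoUniformly_tsum (f := fun (l : ℝ) (x : ℝ) =>
    b l * exp (2 * Real.pi * I * l * (x + y * I))) hb
    fun l x => norm_expSeries_term_le hneg l (by simpa using hy)
  simp_rw [expSeries_term_line] at this
  unfold expSeries
  simp_rw [expSeries_term_line]
  exact this

theorem bochnerAP_expSeries (hb : Summable fun l => ‖b l‖) (hneg : ∀ l < 0, b l = 0)
    {y : ℝ} (hy : 0 ≤ y) : BochnerAP fun x : ℝ => expSeries b (x + y * I) := by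
  refine BochnerAP.of_uniform_approx fun ε hε => ?_
  obtain ⟨s, hs⟩ := (Metric.tendstoUniformly_iff.1 (expSeries_tendstoUniformly hb hneg hy) ε
    hε).exists
  exact ⟨_, BochnerAP.sum s fun l _ => (BochnerAP.const _).mul (bochnerAP_character l),
    fun x => (hs x).le⟩

/-- The mean is continuous for uniform convergence, and on a partial sum containing k orthogonality
of the characters leaves only the term of frequency k. -/
theorem bohrMean_expSeries (hb : Summable fun l => ‖b l‖) (hneg : ∀ l < 0, b l = 0)
    {y : ℝ} (hy : 0 ≤ y) (k : ℝ) :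
    bohrMean (fun x : ℝ => expSeries b (x + y * I) * character (-k) x) =
      b k * Real.exp (-(2 * Real.pi * k * y)) := by
  have hu := Metric.tendstoUniformly_iff.1 (expSeries_tendstoUniformly hb hneg hy)
  have hap := (bochnerAP_expSeries hb hneg hy).mul (bochnerAP_character (-k))
  have hsum : ∀ s : Finset ℝ, BochnerAP fun x : ℝ => (∑ l ∈ s,
      (b l * Real.exp (-(2 * Real.pi * l * y))) * character l x) * character (-k) x := fun s =>
    (BochnerAP.sum s fun l _ => (BochnerAP.const _).mul (bochnerAP_character l)).mul
      (bochnerAP_character (-k))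
  refine eq_of_forall_dist_le fun ε hε => ?_
  obtain ⟨s, hs, hks⟩ := ((hu ε hε).and (eventually_ge_atTop {k})).exists
  have hk : k ∈ s := hks (Finset.mem_singleton_self k)
  have h1 : bohrMean (fun x : ℝ => (∑ l ∈ s,
      (b l * Real.exp (-(2 * Real.pi * l * y))) * character l x) * character (-k) x) =
      b k * Real.exp (-(2 * Real.pi * k * y)) := by
    have e : (fun x : ℝ => (∑ l ∈ s,
        (b l * Real.exp (-(2 * Real.pi * l * y))) * character l x) * character (-k) x) =
        fun x => ∑ l ∈ s, (b l * Real.exp (-(2 * Real.pi * l * y))) * character (l + -k) x := by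
      ext x
      rw [Finset.sum_mul]
      refine Finset.sum_congr rfl fun l _ => ?_
      rw [character_add_left, mul_assoc]
    rw [e, BochnerAP.bohrMean_sum s fun l _ => (BochnerAP.const _).mul (bochnerAP_character _),
      Finset.sum_eq_single k]
    · rw [BochnerAP.bohrMean_const_mul _ (bochnerAP_character _), add_neg_cancel]
      have : character 0 = fun _ => 1 := by ext; simp
      rw [this, bohrMean_one, mul_one]
    · intro l _ hl
      rw [BochnerAP.bohrMean_const_mul _ (bochnerAP_character _), bohrMean_character, mul_zero]
      exact fun h => hl (by linarith)
    · exact fun h => absurd hk h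
  rw [← h1, dist_eq_norm, ← hap.bohrMean_sub (hsum s)]
  refine (hap.sub (hsum s)).norm_bohrMean_le fun x => ?_
  rw [← sub_mul, norm_mul, norm_character, mul_one, ← dist_eq_norm]
  exact (hs x).le

end ExpSeries

/-! ### Horizontal averages of `f` -/

/-- The horizontal average of `f` against the kernel `k`. -/
def smear (k : ℝ → ℂ) (f : ℂ → ℂ) (z : ℂ) : ℂ := ∫ s : ℝ, k s * f (z + s)

namespace TemperedAP

variable {f : ℂ → ℂ} {c : ℝ} {k : ℝ → ℂ}

theorem exists_deriv_growth (hf : TemperedAP f c) {η : ℝ} (hη : 0 < η) :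
    ∃ C : ℝ, 0 < C ∧ ∀ z : ℂ, η ≤ z.im → ‖deriv f z‖ ≤ C * (1 + ‖z‖) ^ 2 := by
  obtain ⟨C, hC0, hC⟩ := hf.growth (η / 2) (by linarith)
  refine ⟨C * (1 + η / 2) ^ 2 / (η / 2), by positivity, fun z hz => ?_⟩
  have him : ∀ w ∈ Metric.closedBall z (η / 2), η / 2 ≤ w.im := by
    intro w hw
    rw [Metric.mem_closedBall, dist_eq_norm] at hw
    have h1 := (abs_le.1 (Complex.abs_im_le_norm (w - z))).1
    rw [Complex.sub_im] at h1
    linarith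
  have h1 : ‖deriv f z‖ ≤ C * ((1 + η / 2) * (1 + ‖z‖)) ^ 2 / (η / 2) := by
    refine Complex.norm_deriv_le_of_forall_mem_sphere_norm_le (by linarith) ?_ fun w hw => ?_
    · refine DifferentiableOn.diffContOnCl fun w hw => ?_
      have := him w (Metric.closure_ball_subset_closedBall hw)
      exact (hf.differentiableAt (by linarith)).differentiableWithinAt
    · refine (hC w (him w (Metric.sphere_subset_closedBall hw))).trans ?_
      rw [mem_sphere_iff_norm] at hw
      have h2 : ‖w‖ ≤ ‖z‖ + η / 2 := by
        have := norm_add_le (w - z) z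
        rw [sub_add_cancel] at this
        linarith
      have h3 := norm_nonneg z
      gcongr
      nlinarith
  refine h1.trans (le_of_eq ?_)
  ring

theorem one_add_norm_add_le (z : ℂ) (s : ℝ) : 1 + ‖z + s‖ ≤ (1 + ‖z‖) * (1 + |s|) := by
  have h1 := norm_add_le z (s : ℂ)
  rw [Complex.norm_real, Real.norm_eq_abs] at h1
  have := mul_nonneg (norm_nonneg z) (abs_nonneg s)
  nlinarith

theorem continuous_horizontal (hf : TemperedAP f c) {z : ℂ} (hz : 0 < z.im) :
    Continuous fun s : ℝ => f (z + s) := by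
  rw [continuous_iff_continuousAt]
  intro s
  have h : ContinuousAt f (z + s) := (hf.differentiableAt (by simpa using hz)).continuousAt
  exact h.comp (f := fun s : ℝ => z + (s : ℂ)) (Continuous.continuousAt (by fun_prop))

theorem continuous_deriv_horizontal (hf : TemperedAP f c) {z : ℂ} (hz : 0 < z.im) :
    Continuous fun s : ℝ => deriv f (z + s) := by
  rw [continuous_iff_continuousAt]
  intro s
  have h : ContinuousAt (deriv f) (z + s) :=
    ((hf.differentiableOn.deriv isOpen_upperHalf).differentiableAt
      (isOpen_upperHalf.mem_nhds (by simpa [upperHalf] using hz))).continuousAt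
  exact h.comp (f := fun s : ℝ => z + (s : ℂ)) (Continuous.continuousAt (by fun_prop))

theorem integrable_smear (hf : TemperedAP f c) (hk : Continuous k)
    (hk2 : Integrable fun s => (1 + |s|) ^ 2 * ‖k s‖) {z : ℂ} (hz : 0 < z.im) :
    Integrable fun s : ℝ => k s * f (z + s) := by
  obtain ⟨C, hC0, hC⟩ := hf.growth z.im hz
  refine (hk2.const_mul (C * (1 + ‖z‖) ^ 2)).mono'
    (hk.mul (hf.continuous_horizontal hz)).aestronglyMeasurable (Eventually.of_forall fun s => ?_)
  rw [norm_mul]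
  have h1 := hC (z + s) (by simp)
  calc ‖k s‖ * ‖f (z + s)‖ ≤ ‖k s‖ * (C * ((1 + ‖z‖) * (1 + |s|)) ^ 2) := by
        gcongr
        exact h1.trans (by gcongr; exact one_add_norm_add_le z s)
    _ = _ := by ring

theorem differentiableOn_smear (hf : TemperedAP f c) (hk : Continuous k)
    (hk2 : Integrable fun s => (1 + |s|) ^ 2 * ‖k s‖) :
    DifferentiableOn ℂ (smear k f) upperHalf := by
  intro z hz
  have hz' : 0 < z.im := hz
  obtain ⟨C, hC0, hC⟩ := hf.exists_deriv_growth (η := z.im / 2) (by linarith)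
  have him : ∀ w ∈ Metric.ball z (z.im / 2), z.im / 2 < w.im := by
    intro w hw
    rw [Metric.mem_ball, dist_eq_norm] at hw
    have h1 := (abs_le.1 (Complex.abs_im_le_norm (w - z))).1
    rw [Complex.sub_im] at h1
    linarith
  refine (hasDerivAt_integral_of_dominated_loc_of_deriv_le (μ := volume)
    (s := Metric.ball z (z.im / 2)) (F := fun (w : ℂ) (s : ℝ) => k s * f (w + s))
    (F' := fun (w : ℂ) (s : ℝ) => k s * deriv f (w + s))
    (bound := fun s => C * (1 + (‖z‖ + z.im / 2)) ^ 2 * ((1 + |s|) ^ 2 * ‖k s‖))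
    (Metric.ball_mem_nhds z (by linarith)) ?_ (hf.integrable_smear hk hk2 hz)
    (hk.mul (hf.continuous_deriv_horizontal hz)).aestronglyMeasurable ?_
    (hk2.const_mul _) ?_).2.differentiableAt.differentiableWithinAt
  · filter_upwards [isOpen_upperHalf.mem_nhds hz] with w hw
    exact (hk.mul (hf.continuous_horizontal hw)).aestronglyMeasurable
  · refine Eventually.of_forall fun s w hw => ?_
    rw [norm_mul]
    have h1 := hC (w + s) (by simpa using (him w hw).le)
    have h2 : ‖w‖ ≤ ‖z‖ + z.im / 2 := by
      rw [Metric.mem_ball, dist_eq_norm] at hw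
      have := norm_add_le (w - z) z
      rw [sub_add_cancel] at this
      linarith
    calc ‖k s‖ * ‖deriv f (w + s)‖
        ≤ ‖k s‖ * (C * ((1 + (‖z‖ + z.im / 2)) * (1 + |s|)) ^ 2) := by
          gcongr
          refine h1.trans ?_
          gcongr
          exact (one_add_norm_add_le w s).trans (by gcongr)
      _ = _ := by ring
  · refine Eventually.of_forall fun s w hw => ?_
    have h1 : HasDerivAt f (deriv f (w + s)) (w + s) :=
      (hf.differentiableAt (by have := him w hw; simp; linarith)).hasDerivAt
    exact (h1.comp_add_const w (s : ℂ)).const_mul (k s)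

theorem integrable_kernel_of_weighted (hk : Continuous k)
    (hk2 : Integrable fun s => (1 + |s|) ^ 2 * ‖k s‖) : Integrable k := by
  refine hk2.mono' hk.aestronglyMeasurable (Eventually.of_forall fun s => ?_)
  have : 1 ≤ (1 + |s|) ^ 2 := one_le_pow₀ (by linarith [abs_nonneg s])
  exact le_mul_of_one_le_left (norm_nonneg _) this

/-- Averaging against an integrable kernel enlarges uniform distances by at most its L¹ norm, so a
finer net of translates of f serves for the average. -/
theorem bochnerAP_smear (hf : TemperedAP f c) (hk : Continuous k)
    (hk2 : Integrable fun s => (1 + |s|) ^ 2 * ‖k s‖) {y : ℝ} (hy : c < y) :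
    BochnerAP fun x : ℝ => smear k f (x + y * I) := by
  have hy0 := hf.pos.trans hy
  have hki := integrable_kernel_of_weighted hk hk2
  refine ⟨?_, fun ε hε => ?_⟩
  · rw [continuous_iff_continuousAt]
    intro x
    have h : ContinuousAt (smear k f) (x + y * I) :=
      ((hf.differentiableOn_smear hk hk2).differentiableAt
        (isOpen_upperHalf.mem_nhds (by simpa [upperHalf] using hy0))).continuousAt
    exact h.comp (f := fun x : ℝ => (x : ℂ) + y * I) (Continuous.continuousAt (by fun_prop))
  · set N := ∫ s, ‖k s‖ with hN
    have hN0 : 0 ≤ N := integral_nonneg fun s => norm_nonneg _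
    obtain ⟨s, hs⟩ := (hf.bochnerAP_line hy).exists_net (ε / (N + 1)) (by positivity)
    refine ⟨s, fun t => ?_⟩
    obtain ⟨t', ht', h⟩ := hs t
    refine ⟨t', ht', fun x => ?_⟩
    rw [dist_eq_norm, smear, smear, ← integral_sub
      (hf.integrable_smear hk hk2 (by simpa using hy0))
      (hf.integrable_smear hk hk2 (by simpa using hy0))]
    refine (norm_integral_le_of_norm_le (hki.norm.mul_const (ε / (N + 1)))
      (Eventually.of_forall fun r => ?_)).trans ?_
    · rw [← mul_sub, norm_mul]
      have h1 := h (x + r)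
      rw [dist_eq_norm] at h1
      have e : ∀ t : ℝ, ((x + t : ℝ) : ℂ) + y * I + r = ((x + r + t : ℝ) : ℂ) + y * I := fun t => by
        push_cast; ring
      rw [e, e]
      gcongr
    · rw [integral_mul_const, ← hN, mul_div_assoc', div_le_iff₀ (by positivity)]
      nlinarith

/-- Fubini turns the truncated mean into an average over s of means on [s, s + T]. These are
uniformly bounded and converge to a limit independent of s, so dominated convergence applies. -/
theorem bohrMean_smear (hf : TemperedAP f c) (hk : Continuous k)
    (hk2 : Integrable fun s => (1 + |s|) ^ 2 * ‖k s‖) {y : ℝ} (hy : c < y) (l : ℝ) :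
    bohrMean (fun x : ℝ => smear k f (x + y * I) * character (-l) x) =
      (∫ s, k s * character l s) * bohrMean fun x : ℝ => f (x + y * I) * character (-l) x := by
  have hy0 := hf.pos.trans hy
  have hki := integrable_kernel_of_weighted hk hk2
  set g : ℝ → ℂ := fun x => f (x + y * I) * character (-l) x with hg
  have hgap : BochnerAP g := (hf.bochnerAP_line hy).mul (bochnerAP_character (-l))
  obtain ⟨B, hB, hgB⟩ := hgap.exists_bound
  have hgc := hgap.continuous
  have hlim : Tendsto (fun T : ℝ => ∫ s, (k s * character l s) *
      ((T : ℂ)⁻¹ * ∫ x in s..(s + T), g x)) atTop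
      (𝓝 (∫ s, (k s * character l s) * bohrMean g)) := by
    refine tendsto_integral_filter_of_dominated_convergence (fun s => ‖k s‖ * B) ?_ ?_
      (hki.norm.mul_const B) (Eventually.of_forall fun s =>
        (hgap.tendsto_mean_translate s).const_mul _)
    · refine Eventually.of_forall fun T => Continuous.aestronglyMeasurable ?_
      have e : ∀ s : ℝ, (∫ x in s..(s + T), g x) = ∫ x in (0 : ℝ)..T, g (x + s) := fun s => by
        rw [intervalIntegral.integral_comp_add_right, zero_add, add_comm]
      simp_rw [e]
      exact (hk.mul (continuous_character l)).mul (continuous_const.mul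
        (intervalIntegral.continuous_parametric_intervalIntegral_of_continuous' (by fun_prop) _ _))
    · filter_upwards [eventually_gt_atTop 0] with T hT
      refine Eventually.of_forall fun s => ?_
      rw [norm_mul, norm_mul, norm_character, mul_one]
      gcongr
      exact BochnerAP.norm_inv_mul_integral_le hT hgB s
  rw [integral_mul_const] at hlim
  refine tendsto_nhds_unique
    ((hf.bochnerAP_smear hk hk2 hy).mul (bochnerAP_character (-l))).tendsto_bohrMean
    (hlim.congr fun T => ?_)
  have e1 : ∀ x : ℝ, smear k f (x + y * I) * character (-l) x =
      ∫ s, (k s * character l s) * g (x + s) := by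
    intro x
    rw [smear, ← integral_mul_const]
    congr 1
    ext s
    have h1 : character l s * character (-l) s = 1 := by
      rw [← character_add_left, add_neg_cancel, character_zero_left]
    have e2 : (x : ℂ) + y * I + s = ((x + s : ℝ) : ℂ) + y * I := by push_cast; ring
    rw [e2, hg]
    dsimp only
    rw [character_add_right]
    linear_combination (-(k s * f (((x + s : ℝ) : ℂ) + y * I) * character (-l) x)) * h1
  simp_rw [e1]
  rw [intervalIntegral_integral_swap]
  · rw [← integral_const_mul]
    congr 1
    ext s
    rw [intervalIntegral.integral_const_mul, intervalIntegral.integral_comp_add_right, zero_add,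
      add_comm T s]
    ring
  · have : IsFiniteMeasure (volume.restrict (Set.uIoc 0 T)) :=
      ⟨by rw [Measure.restrict_apply_univ, Set.uIoc, Real.volume_Ioc]; exact ENNReal.ofReal_lt_top⟩
    have h1 : Integrable (fun p : ℝ × ℝ => B * ‖k p.2‖)
        ((volume.restrict (Set.uIoc 0 T)).prod volume) :=
      (hki.norm.comp_snd _).const_mul B
    refine h1.mono' (Continuous.aestronglyMeasurable ?_) (Eventually.of_forall fun p => ?_)
    · simp only [Function.uncurry_def]
      fun_prop
    · simp only [Function.uncurry_def]
      rw [norm_mul, norm_mul, norm_character, mul_one, mul_comm]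
      gcongr
      exact hgB _

end TemperedAP

/-! ### The Fourier summation formula -/

theorem LocallySummable.summable_mul {a φ : ℝ → ℂ} (ha : LocallySummable a) {R B : ℝ}
    (hR : ∀ l, R < |l| → φ l = 0) (hB : ∀ l, ‖φ l‖ ≤ B) : Summable fun l => ‖a l * φ l‖ := by
  have hR' : 0 < |R| + 1 := by positivity
  have h1 : Summable ((Set.Icc (-(|R| + 1)) (|R| + 1)).indicator fun l => ‖a l‖) :=
    summable_subtype_iff_indicator.1 (ha.2 _ hR')
  have hB0 : 0 ≤ B := (norm_nonneg _).trans (hB 0)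
  refine Summable.of_nonneg_of_le (fun _ => norm_nonneg _) (fun l => ?_) (h1.mul_right B)
  by_cases hl : l ∈ Set.Icc (-(|R| + 1)) (|R| + 1)
  · rw [Set.indicator_of_mem hl, norm_mul]
    gcongr
    exact hB l
  · rw [Set.indicator_of_notMem hl, hR l, mul_zero, norm_zero, zero_mul]
    rw [Set.mem_Icc, ← abs_le, not_le] at hl
    linarith [le_abs_self R]

theorem exists_radius_of_hasCompactSupport {φ : ℝ → ℂ} (hc : HasCompactSupport φ) :
    ∃ R : ℝ, ∀ l, R < |l| → φ l = 0 := by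
  obtain ⟨R, hR⟩ := hc.isCompact.isBounded.subset_closedBall 0
  refine ⟨R, fun l hl => ?_⟩
  by_contra h
  have := hR (subset_tsupport φ h)
  rw [Metric.mem_closedBall, dist_zero_right, Real.norm_eq_abs] at this
  linarith

theorem schwartz_weighted_integrable (k : SchwartzMap ℝ ℂ) :
    Integrable fun s : ℝ => (1 + |s|) ^ 2 * ‖k s‖ := by
  have h1 := (k.integrable (μ := volume)).norm
  have h2 := k.integrable_pow_mul volume 1
  have h3 := k.integrable_pow_mul volume 2
  refine ((h1.add (h2.const_mul 2)).add h3).congr (Eventually.of_forall fun s => ?_)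
  simp only [Pi.add_apply, Real.norm_eq_abs]
  ring

theorem schwartz_exists_bound (k : SchwartzMap ℝ ℂ) :
    ∃ C : ℝ, ∀ x : ℝ, ‖k x‖ ≤ C * (1 + x ^ 2)⁻¹ := by
  obtain ⟨C₀, -, h₀⟩ := k.decay 0 0
  obtain ⟨C₂, -, h₂⟩ := k.decay 2 0
  refine ⟨C₀ + C₂, fun x => ?_⟩
  have h1 := h₀ x
  have h2 := h₂ x
  simp only [norm_iteratedFDeriv_zero, pow_zero, one_mul, Real.norm_eq_abs, sq_abs] at h1 h2
  rw [← div_eq_mul_inv, le_div_iff₀ (by positivity)]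
  linarith

theorem integral_fourier_mul_character (φ : SchwartzMap ℝ ℂ) (l : ℝ) :
    ∫ s, 𝓕 (φ : ℝ → ℂ) s * character l s = φ l := by
  have h1 : 𝓕⁻ (𝓕 (φ : ℝ → ℂ)) = φ :=
    Continuous.fourierInv_fourier_eq φ.continuous φ.integrable (𝓕 φ).integrable
  conv_rhs => rw [← h1]
  rw [Real.fourierInv_eq']
  congr 1
  ext s
  rw [smul_eq_mul, mul_comm, character_eq]
  congr 3
  simp
  ring

/-- With ψ(x) = conj φ(-x), the conjugate of the average of f against 𝓕 ψ is the average of conj f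
against 𝓕 φ; the two averages then combine into one of 2 Re f. -/
theorem conj_fourier_conj_neg (φ : ℝ → ℂ) (s : ℝ) :
    conj (𝓕 (fun x => conj (φ (-x))) s) = 𝓕 φ s := by
  rw [fourier_eq_integral_character, fourier_eq_integral_character, ← integral_conj,
    ← integral_neg_eq_self]
  congr 1
  ext x
  rw [map_mul, conj_conj, neg_neg, conj_character, neg_neg]
  congr 1
  simp [character]

/-- One formula replaces the three cases: away from 0 at most one summand survives, and at 0 both
are present, whence the factor 2. -/
theorem antipodalCoeffs_eq {E : ℝ → ℂ} (hneg : ∀ l < 0, E l = 0) (l : ℝ) :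
    antipodalCoeffs E l = E l + conj (E (-l)) := by
  unfold antipodalCoeffs
  split_ifs with h1 h2
  · rw [hneg (-l) (by linarith), map_zero, add_zero]
  · rw [h2, neg_zero, add_conj_eq]
  · rw [hneg l (lt_of_le_of_ne (not_lt.1 h1) h2), zero_add]

theorem antipodal_antipodalCoeffs {E : ℝ → ℂ} (hneg : ∀ l < 0, E l = 0) :
    Antipodal (antipodalCoeffs E) := fun l => by
  rw [antipodalCoeffs_eq hneg, antipodalCoeffs_eq hneg, neg_neg, map_add, conj_conj, add_comm]

theorem LocallySummable.conj_neg {E : ℝ → ℂ} (h : LocallySummable E) :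
    LocallySummable fun l => conj (E (-l)) := by
  constructor
  · have : (Function.support fun l => conj (E (-l))) = Neg.neg ⁻¹' Function.support E := by
      ext l
      simp
    rw [this]
    exact h.1.preimage neg_injective
  · intro T hT
    let e : Set.Icc (-T) T ≃ Set.Icc (-T) T :=
      { toFun := fun l => ⟨-l, by linarith [l.2.2], by linarith [l.2.1]⟩
        invFun := fun l => ⟨-l, by linarith [l.2.2], by linarith [l.2.1]⟩
        left_inv := fun l => by simp
        right_inv := fun l => by simp }
    refine ((e.summable_iff).2 (h.2 T hT)).congr fun l => ?_
    simp [e]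

theorem LocallySummable.add {E F : ℝ → ℂ} (hE : LocallySummable E) (hF : LocallySummable F) :
    LocallySummable fun l => E l + F l := by
  refine ⟨(hE.1.union hF.1).mono (Function.support_add E F), fun T hT => ?_⟩
  exact Summable.of_nonneg_of_le (fun _ => norm_nonneg _) (fun _ => norm_add_le _ _)
    ((hE.2 T hT).add (hF.2 T hT))

theorem locallySummable_antipodalCoeffs {E : ℝ → ℂ} (h : LocallySummable E)
    (hneg : ∀ l < 0, E l = 0) : LocallySummable (antipodalCoeffs E) := by
  have : antipodalCoeffs E = fun l => E l + conj (E (-l)) := funext (antipodalCoeffs_eq hneg)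
  rw [this]
  exact h.add h.conj_neg

namespace TemperedAP

variable {f : ℂ → ℂ} {c : ℝ}

theorem bohrMean_line (hf : TemperedAP f c) {y : ℝ} (hy : c < y) (l : ℝ) :
    bohrMean (fun x : ℝ => f (x + y * I) * character (-l) x) =
      bohrCoeff f c l * Real.exp (-(2 * Real.pi * l * y)) := by
  have h1 : bohrCoeff f c l = bohrMean fun x : ℝ => modulated f l (x + y * I) :=
    tendsto_nhds_unique (hf.tendsto_bohrCoeff hy.le l)
      (hf.bochnerAP_modulated hy l).tendsto_symm_mean
  simp_rw [modulated_line] at h1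
  rw [BochnerAP.bohrMean_const_mul _ ((hf.bochnerAP_line hy).mul (bochnerAP_character _))] at h1
  have h3 : ((Real.exp (-(2 * Real.pi * l * y)) : ℝ) : ℂ) *
      (Real.exp (2 * Real.pi * l * y) : ℝ) = 1 := by
    rw [← Complex.ofReal_mul, ← Real.exp_add]; simp
  rw [h1]
  linear_combination (-(bohrMean fun x : ℝ => f (x + y * I) * character (-l) x)) * h3

theorem contDiff_line {D : ℂ → ℂ} (hD : DifferentiableOn ℂ D upperHalf) {y : ℝ} (hy : 0 < y) :
    ContDiff ℝ ∞ fun x : ℝ => D (x + y * I) := by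
  have h1 : ContDiffOn ℝ ∞ D upperHalf :=
    (hD.contDiffOn isOpen_upperHalf).restrict_scalars ℝ
  refine h1.comp_contDiff (f := fun x : ℝ => (x : ℂ) + y * I)
    (Complex.ofRealCLM.contDiff.add contDiff_const) fun x => ?_
  simpa [upperHalf] using hy

/-- The summation formula for `f`: averages against a Fourier transform are absolutely convergent
exponential series. -/
theorem smear_eq_expSeries (hf : TemperedAP f c) (hE : LocallySummable (bohrCoeff f c))
    (φ : SchwartzMap ℝ ℂ) (hφ : HasCompactSupport φ) {z : ℂ} (hz : z ∈ upperHalf) :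
    smear (𝓕 (φ : ℝ → ℂ)) f z = expSeries (fun l => bohrCoeff f c l * φ l) z := by
  have hk : Continuous (𝓕 (φ : ℝ → ℂ)) := (𝓕 φ).continuous
  have hk2 : Integrable fun s => (1 + |s|) ^ 2 * ‖𝓕 (φ : ℝ → ℂ) s‖ :=
    schwartz_weighted_integrable (𝓕 φ)
  obtain ⟨R, hR⟩ := exists_radius_of_hasCompactSupport hφ
  obtain ⟨B, hB⟩ := φ.continuous.bounded_above_of_compact_support hφ
  have hb : Summable fun l => ‖bohrCoeff f c l * φ l‖ := hE.summable_mul hR hB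
  have hneg : ∀ l < 0, bohrCoeff f c l * φ l = 0 := fun l hl => by
    rw [hf.bohrCoeff_eq_zero_of_neg hl, zero_mul]
  set D : ℂ → ℂ := fun z =>
    smear (𝓕 (φ : ℝ → ℂ)) f z - expSeries (fun l => bohrCoeff f c l * φ l) z with hD
  have hDd : DifferentiableOn ℂ D upperHalf :=
    (hf.differentiableOn_smear hk hk2).sub (differentiableOn_expSeries hb hneg)
  -- Above height c both functions are almost periodic with coefficients E(l) φ(l) e^{-2πly} on the
  -- line of height y. Below c almost periodicity is unavailable and the identity theorem takes
  -- over.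
  have hline : ∀ y : ℝ, c < y → ∀ x : ℝ, D (x + y * I) = 0 := by
    intro y hy
    have hy0 := hf.pos.trans hy
    have hs := hf.bochnerAP_smear hk hk2 hy
    have he := bochnerAP_expSeries hb hneg hy0.le
    have h0 := (hs.sub he).eq_zero_of_coeff_eq_zero (contDiff_line hDd hy0) (fun l => by
      have hl : l = -(-l) := (neg_neg l).symm
      rw [hl]
      generalize -l = l
      simp_rw [sub_mul]
      rw [BochnerAP.bohrMean_sub (hs.mul (bochnerAP_character _))
        (he.mul (bochnerAP_character _)), hf.bohrMean_smear hk hk2 hy,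
        bohrMean_expSeries hb hneg hy0.le, hf.bohrMean_line hy, integral_fourier_mul_character]
      ring)
    exact fun x => congrFun h0 x
  have hI : ((c + 1 : ℝ) * I : ℂ) ∈ upperHalf := by
    have := hf.pos
    simp [upperHalf]
    linarith
  have hconn : IsPreconnected upperHalf := (convex_halfSpace_im_gt 0).isPreconnected
  have h0 := (hDd.analyticOnNhd isOpen_upperHalf).eqOn_zero_of_preconnected_of_eventuallyEq_zero
    hconn hI (by
      have hopen : IsOpen {z : ℂ | c < z.im} := isOpen_lt continuous_const Complex.continuous_im
      filter_upwards [hopen.mem_nhds (show c < ((c + 1 : ℝ) * I : ℂ).im by simp)] with w hw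
      have := hline w.im hw w.re
      rwa [Complex.re_add_im] at this)
  exact sub_eq_zero.1 (h0 hz)

theorem tendsto_expSeries_zero {b : ℝ → ℂ} (hb : Summable fun l => ‖b l‖)
    (hneg : ∀ l < 0, b l = 0) :
    Tendsto (fun y : ℝ => expSeries b (y * I)) (𝓝[>] 0) (𝓝 (∑' l, b l)) := by
  refine tendsto_tsum_of_dominated_convergence hb (fun l => ?_) ?_
  · have hc : Continuous fun y : ℝ => b l * exp (2 * Real.pi * I * l * (y * I)) := by fun_prop
    have := hc.tendsto 0
    simp only [ofReal_zero, zero_mul, mul_zero, Complex.exp_zero, mul_one] at this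
    exact this.mono_left nhdsWithin_le_nhds
  · filter_upwards [self_mem_nhdsWithin] with y hy l
    exact norm_expSeries_term_le hneg l (by simpa using (le_of_lt hy : (0 : ℝ) ≤ y))

/-- `μ` and the antipodal extension of the Fourier-Bohr coefficients satisfy the Fourier summation
formula. -/
theorem hasSum_antipodalCoeffs (hf : TemperedAP f c) (hE : LocallySummable (bohrCoeff f c))
    {μ : RealMeasure} (hμ : μ.Tame) (hK : KernelIdentity f μ) (φ : SchwartzMap ℝ ℂ)
    (hφ : HasCompactSupport φ) :
    HasSum (fun l => antipodalCoeffs (bohrCoeff f c) l * φ l) (μ.integral (𝓕 (φ : ℝ → ℂ))) := by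
  have hnegE : ∀ l < 0, bohrCoeff f c l = 0 := fun l hl => hf.bohrCoeff_eq_zero_of_neg hl
  have hψs : ContDiff ℝ ∞ fun x => conj (φ (-x)) :=
    Complex.conjCLE.contDiff.comp ((φ.smooth ⊤).comp contDiff_neg)
  have hψc : HasCompactSupport fun x => conj (φ (-x)) :=
    HasCompactSupport.comp_left (g := conj) (hφ.comp_homeomorph (Homeomorph.neg ℝ)) (map_zero _)
  set ψ : SchwartzMap ℝ ℂ := hψc.toSchwartzMap hψs with hψ
  have hψf : (ψ : ℝ → ℂ) = fun x => conj (φ (-x)) := rfl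
  have hk : ∀ χ : SchwartzMap ℝ ℂ, Continuous (𝓕 (χ : ℝ → ℂ)) := fun χ => (𝓕 χ).continuous
  have hsum : ∀ χ : SchwartzMap ℝ ℂ, HasCompactSupport χ →
      Summable fun l => ‖bohrCoeff f c l * χ l‖ := by
    intro χ hχ
    obtain ⟨R, hR⟩ := exists_radius_of_hasCompactSupport hχ
    obtain ⟨B, hB⟩ := χ.continuous.bounded_above_of_compact_support hχ
    exact hE.summable_mul hR hB
  have hlim : ∀ χ : SchwartzMap ℝ ℂ, HasCompactSupport χ →
      Tendsto (fun y : ℝ => smear (𝓕 (χ : ℝ → ℂ)) f (y * I)) (𝓝[>] 0)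
        (𝓝 (∑' l, bohrCoeff f c l * χ l)) := by
    intro χ hχ
    refine (tendsto_expSeries_zero (hsum χ hχ) fun l hl => by
      rw [hnegE l hl, zero_mul]).congr' ?_
    filter_upwards [self_mem_nhdsWithin] with y hy
    exact (hf.smear_eq_expSeries hE χ hχ (by simpa [upperHalf] using hy)).symm
  obtain ⟨C, hC⟩ := schwartz_exists_bound (𝓕 φ)
  have hbdry := hK.tendsto_boundary hμ (hk φ) hC
  have hlim2 := (hlim φ hφ).add ((Complex.continuous_conj.tendsto _).comp (hlim ψ hψc))
  -- 2 Re f is f plus its conjugate: the first gives the sum over the coefficients, the second,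
  -- through ψ, its antipodal reflection.
  have heq : μ.integral (𝓕 (φ : ℝ → ℂ)) =
      (∑' l, bohrCoeff f c l * φ l) + conj (∑' l, bohrCoeff f c l * ψ l) := by
    refine tendsto_nhds_unique hbdry (hlim2.congr' ?_)
    filter_upwards [self_mem_nhdsWithin] with y hy
    have hy' : 0 < ((y : ℂ) * I).im := by simpa using hy
    have h1 := hf.integrable_smear (hk φ) (schwartz_weighted_integrable (𝓕 φ)) hy'
    have h2 := hf.integrable_smear (hk ψ) (schwartz_weighted_integrable (𝓕 ψ)) hy'
    simp only [Function.comp_apply, smear]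
    rw [← integral_conj, ← integral_add h1 (by
      exact Complex.conjCLE.toContinuousLinearMap.integrable_comp h2)]
    congr 1
    ext s
    rw [map_mul, hψf, conj_fourier_conj_neg, ← mul_add, add_conj_eq, add_comm (y * I : ℂ)]
  have h1 : HasSum (fun l => bohrCoeff f c l * φ l) (∑' l, bohrCoeff f c l * φ l) :=
    (hsum φ hφ).of_norm.hasSum
  have h2 : HasSum (fun l => conj (bohrCoeff f c (-l) * ψ (-l)))
      (conj (∑' l, bohrCoeff f c l * ψ l)) := by
    have h3 : HasSum (fun l => bohrCoeff f c l * ψ l) (∑' l, bohrCoeff f c l * ψ l) :=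
      (hsum ψ hψc).of_norm.hasSum
    have h4 := ((Equiv.neg ℝ).hasSum_iff).2 h3
    exact Complex.hasSum_conj.2 (by simpa [Function.comp_def] using h4)
  rw [heq]
  refine (h1.add h2).congr_fun fun l => ?_
  rw [antipodalCoeffs_eq hnegE, hψf, map_mul, conj_conj, neg_neg, add_mul]

theorem isRealAntipodalFSPair (hf : TemperedAP f c) (hE : LocallySummable (bohrCoeff f c))
    {μ : RealMeasure} (hμ : μ.Tame) (hK : KernelIdentity f μ) :
    IsRealAntipodalFSPair μ (antipodalCoeffs (bohrCoeff f c)) := by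
  have hneg : ∀ l < 0, bohrCoeff f c l = 0 := fun l hl => hf.bohrCoeff_eq_zero_of_neg hl
  refine ⟨⟨fun φ => ?_, locallySummable_antipodalCoeffs hE hneg, fun φ hφ hφc => ?_⟩,
    antipodal_antipodalCoeffs hneg⟩
  · obtain ⟨C, hC⟩ := schwartz_exists_bound φ
    exact hμ.integrable_of_le φ.continuous hC
  · exact hf.hasSum_antipodalCoeffs hE hμ hK (hφc.toSchwartzMap hφ) hφc

end TemperedAP

/-! ### Mollification -/

/-- A bump of radius `(n + 1)⁻¹` around the origin. -/
def shrinkingBump (n : ℕ) : ContDiffBump (0 : ℝ) :=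
  ⟨1 / (2 * (n + 1)), 1 / (n + 1), by positivity, by
    rw [div_lt_div_iff₀ (by positivity) (by positivity)]
    have : (0 : ℝ) ≤ n := Nat.cast_nonneg n
    linarith⟩

/-- The convolution of `ψ` with a normalized bump of radius `(n + 1)⁻¹`. -/
def mollify (ψ : ℝ → ℂ) (n : ℕ) (x : ℝ) : ℂ :=
  ∫ t, (((shrinkingBump n).normed volume t : ℝ) : ℂ) * ψ (x - t)

theorem tendsto_rOut_shrinkingBump : Tendsto (fun n => (shrinkingBump n).rOut) atTop (𝓝 0) :=
  tendsto_one_div_add_atTop_nhds_zero_nat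

theorem mollify_eq_convolution (ψ : ℝ → ℂ) (n : ℕ) :
    mollify ψ n = MeasureTheory.convolution ((shrinkingBump n).normed volume) ψ
      (ContinuousLinearMap.lsmul ℝ ℝ) volume := by
  ext x
  simp [mollify, MeasureTheory.convolution_def]

theorem mollify_eq_convolution_mul (ψ : ℝ → ℂ) (n : ℕ) :
    mollify ψ n = MeasureTheory.convolution
      (fun t => (((shrinkingBump n).normed volume t : ℝ) : ℂ)) ψ
      (ContinuousLinearMap.mul ℂ ℂ) volume := by
  ext x
  simp [mollify, MeasureTheory.convolution_def]

section Mollify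

variable {ψ : ℝ → ℂ}

theorem tendsto_mollify (hψ : Continuous ψ) (x : ℝ) :
    Tendsto (fun n => mollify ψ n x) atTop (𝓝 (ψ x)) := by
  simp_rw [mollify_eq_convolution]
  exact ContDiffBump.convolution_tendsto_right_of_continuous tendsto_rOut_shrinkingBump hψ x

theorem contDiff_mollify (hψ : Continuous ψ) (n : ℕ) : ContDiff ℝ ∞ (mollify ψ n) := by
  rw [mollify_eq_convolution]
  exact (shrinkingBump n).hasCompactSupport_normed.contDiff_convolution_left _
    (shrinkingBump n).contDiff_normed hψ.locallyIntegrable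

theorem integrable_bump (n : ℕ) :
    Integrable fun t => (((shrinkingBump n).normed volume t : ℝ) : ℂ) :=
  (shrinkingBump n).integrable_normed.ofReal

theorem integral_norm_bump (n : ℕ) :
    ∫ t, ‖(((shrinkingBump n).normed volume t : ℝ) : ℂ)‖ = 1 := by
  rw [← (shrinkingBump n).integral_normed (μ := volume)]
  congr 1
  ext t
  rw [Complex.norm_real, Real.norm_of_nonneg ((shrinkingBump n).nonneg_normed t)]

theorem norm_mollify_le {B : ℝ} (hB : ∀ x, ‖ψ x‖ ≤ B) (n : ℕ) (x : ℝ) : ‖mollify ψ n x‖ ≤ B := by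
  refine (norm_integral_le_of_norm_le ((integrable_bump n).norm.mul_const B)
    (Eventually.of_forall fun t => ?_)).trans ?_
  · rw [norm_mul]
    gcongr
    exact hB _
  · rw [integral_mul_const, integral_norm_bump, one_mul]

theorem mollify_eq_zero {R : ℝ} (hR : ∀ x, R < |x| → ψ x = 0) (n : ℕ) {x : ℝ}
    (hx : R + 1 < |x|) : mollify ψ n x = 0 := by
  refine integral_eq_zero_of_ae (Eventually.of_forall fun t => ?_)
  by_cases ht : t ∈ Function.support ((shrinkingBump n).normed (volume : Measure ℝ))
  · rw [ContDiffBump.support_normed_eq, Metric.mem_ball, dist_zero_right, Real.norm_eq_abs] at ht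
    have h1 : (shrinkingBump n).rOut ≤ 1 := by
      change 1 / ((n : ℝ) + 1) ≤ 1
      rw [div_le_one (by positivity)]
      have : (0 : ℝ) ≤ n := Nat.cast_nonneg n
      linarith
    have h2 := abs_sub_abs_le_abs_sub x t
    simp only [Pi.zero_apply]
    rw [hR _ (by linarith), mul_zero]
  · rw [Function.notMem_support] at ht
    simp [ht]

theorem fourier_mollify (hψ : Integrable ψ) (n : ℕ) (t : ℝ) :
    𝓕 (mollify ψ n) t =
      𝓕 (fun t => (((shrinkingBump n).normed volume t : ℝ) : ℂ)) t * 𝓕 ψ t := by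
  rw [mollify_eq_convolution_mul]
  exact Real.fourier_mul_convolution_eq (integrable_bump n) hψ t

theorem norm_fourier_bump_le (n : ℕ) (t : ℝ) :
    ‖𝓕 (fun t => (((shrinkingBump n).normed volume t : ℝ) : ℂ)) t‖ ≤ 1 := by
  rw [fourier_eq_integral_character, ← integral_norm_bump n]
  refine (norm_integral_le_integral_norm _).trans (le_of_eq ?_)
  simp_rw [norm_mul, norm_character, one_mul]

/-- The Fourier transform of the bump at t is the mollified character evaluated at 0. -/
theorem tendsto_fourier_bump (t : ℝ) :
    Tendsto (fun n => 𝓕 (fun t => (((shrinkingBump n).normed volume t : ℝ) : ℂ)) t) atTop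
      (𝓝 1) := by
  have h := tendsto_mollify (continuous_character t) 0
  have h0 : character t 0 = 1 := by simp [character]
  rw [h0] at h
  refine h.congr fun n => ?_
  rw [fourier_eq_integral_character, mollify]
  congr 1
  ext x
  rw [mul_comm]
  congr 1
  simp [character]

end Mollify

namespace TemperedAP

variable {f : ℂ → ℂ} {c : ℝ}

/-- The summation formula extends to continuous compactly supported functions with quadratically
decaying Fourier transform. -/
theorem tsum_antipodalCoeffs_eq (hf : TemperedAP f c) (hE : LocallySummable (bohrCoeff f c))
    {μ : RealMeasure} (hμ : μ.Tame) (hK : KernelIdentity f μ) {ψ : ℝ → ℂ} (hψ : Continuous ψ)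
    {R : ℝ} (hR : ∀ x, R < |x| → ψ x = 0) {C : ℝ} (hC : ∀ t, ‖𝓕 ψ t‖ ≤ C * (1 + t ^ 2)⁻¹) :
    ∑' l, antipodalCoeffs (bohrCoeff f c) l * ψ l = μ.integral (𝓕 ψ) := by
  have hc : HasCompactSupport ψ := by
    refine HasCompactSupport.intro (isCompact_Icc (a := -R) (b := R)) fun x hx => hR x ?_
    rw [Set.mem_Icc, ← abs_le] at hx
    exact not_le.1 hx
  have hmc : ∀ n, HasCompactSupport (mollify ψ n) := fun n => by
    refine HasCompactSupport.intro (isCompact_Icc (a := -(R + 1)) (b := R + 1)) fun x hx =>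
      mollify_eq_zero hR n ?_
    rw [Set.mem_Icc, ← abs_le] at hx
    exact not_le.1 hx
  obtain ⟨B, hB⟩ := hψ.bounded_above_of_compact_support hc
  have hint : Integrable ψ := hψ.integrable_of_hasCompactSupport hc
  have hsum : ∀ n, ∑' l, antipodalCoeffs (bohrCoeff f c) l * mollify ψ n l =
      μ.integral (𝓕 (mollify ψ n)) := fun n =>
    (hf.hasSum_antipodalCoeffs hE hμ hK ((hmc n).toSchwartzMap (contDiff_mollify hψ n))
      (hmc n)).tsum_eq
  have hcont : ∀ n, Continuous (𝓕 (mollify ψ n)) := fun n =>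
    (𝓕 ((hmc n).toSchwartzMap (contDiff_mollify hψ n))).continuous
  have ha := locallySummable_antipodalCoeffs hE fun l hl => hf.bohrCoeff_eq_zero_of_neg hl
  -- A common majorant: all mollifications are supported in [-(R + 1), R + 1] and bounded by B.
  set χ : ℝ → ℂ := fun l => if R + 1 < |l| then 0 else (B : ℂ) with hχ
  have hB0 : 0 ≤ B := (norm_nonneg _).trans (hB 0)
  have hχs := ha.summable_mul (φ := χ) (R := R + 1) (B := B) (fun l hl => by simp [hχ, hl])
    (fun l => by
      rw [hχ]
      dsimp only
      split_ifs
      · simpa using hB0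
      · rw [Complex.norm_real, Real.norm_of_nonneg hB0])
  have hl : Tendsto (fun n => ∑' l, antipodalCoeffs (bohrCoeff f c) l * mollify ψ n l) atTop
      (𝓝 (∑' l, antipodalCoeffs (bohrCoeff f c) l * ψ l)) := by
    refine tendsto_tsum_of_dominated_convergence hχs
      (fun l => (tendsto_mollify hψ l).const_mul _) (Eventually.of_forall fun n l => ?_)
    rw [norm_mul, norm_mul]
    gcongr
    rw [hχ]
    dsimp only
    split_ifs with h
    · rw [mollify_eq_zero hR n h]
    · rw [Complex.norm_real, Real.norm_of_nonneg hB0]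
      exact norm_mollify_le hB n l
  have hr : Tendsto (fun n => μ.integral (𝓕 (mollify ψ n))) atTop (𝓝 (μ.integral (𝓕 ψ))) := by
    refine RealMeasure.tendsto_integral_of_dominated (b := fun t => C * (1 + t ^ 2)⁻¹)
      (Eventually.of_forall fun n => (hcont n).aestronglyMeasurable)
      (Integrable.const_mul hμ C) (Eventually.of_forall fun n t => ?_) fun t => ?_
    · rw [fourier_mollify hint, norm_mul]
      exact (mul_le_of_le_one_left (norm_nonneg _) (norm_fourier_bump_le n t)).trans (hC t)
    · simp_rw [fourier_mollify hint]
      simpa using (tendsto_fourier_bump t).mul_const (𝓕 ψ t)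
  exact tendsto_nhds_unique hl (hr.congr fun n => (hsum n).symm)

end TemperedAP

/-! ### The Cesàro kernel -/

/-- The term -1/s does not depend on T; the other is O(1/T) when Re s ≤ 0. -/
theorem integral_fejer_exp {T : ℝ} (hT : 0 < T) {s : ℂ} (hs : s ≠ 0) :
    ∫ x in (0 : ℝ)..T, (1 - x / T : ℂ) * exp (s * x) =
      -1 / s + (exp (s * T) - 1) / (s ^ 2 * T) := by
  have hTc : (T : ℂ) ≠ 0 := by exact_mod_cast hT.ne'
  have hd : ∀ x ∈ Set.uIcc 0 T, HasDerivAt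
      (fun x : ℝ => ((1 - x / T) / s + 1 / (s ^ 2 * T) : ℂ) * exp (s * x))
      ((1 - x / T : ℂ) * exp (s * x)) x := by
    intro x _
    have h0 : HasDerivAt (fun x : ℝ => (x : ℂ)) 1 x := Complex.ofRealCLM.hasDerivAt
    have h1 : HasDerivAt (fun x : ℝ => ((1 - x / T) / s + 1 / (s ^ 2 * T) : ℂ))
        (-(1 / T) / s) x :=
      (((h0.div_const (T : ℂ)).const_sub 1).div_const s).add_const _
    have h2 : HasDerivAt (fun x : ℝ => exp (s * x)) (exp (s * x) * (s * 1)) x :=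
      (h0.const_mul s).cexp
    refine (h1.mul h2).congr_deriv ?_
    field_simp
    ring
  rw [intervalIntegral.integral_eq_sub_of_hasDerivAt hd
    (Continuous.intervalIntegrable (by fun_prop) _ _)]
  simp only [ofReal_zero, mul_zero, Complex.exp_zero, zero_div, sub_zero, mul_one]
  field_simp
  ring

/-- The tent function on `[-T, T]` modulated by `exp (2π i l z)` on the right half-line and by
`exp (2π i l (conj w))` on the left one. -/
def cesaroKernel (T : ℝ) (z w : ℂ) (l : ℝ) : ℂ :=
  ((max (1 - |l| / T) 0 : ℝ) : ℂ) *
    if 0 ≤ l then exp (2 * Real.pi * I * l * z) else exp (2 * Real.pi * I * l * conj w)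

section CesaroKernel

variable {T : ℝ} {z w : ℂ}

theorem continuous_cesaroKernel (T : ℝ) (z w : ℂ) : Continuous (cesaroKernel T z w) := by
  unfold cesaroKernel
  refine (continuous_ofReal.comp (by fun_prop)).mul ?_
  refine Continuous.if_le (by fun_prop) (by fun_prop) continuous_const continuous_id
    fun x hx => ?_
  simp [← hx]

theorem cesaroKernel_eq_zero (hT : 0 < T) {l : ℝ} (hl : T ≤ |l|) : cesaroKernel T z w l = 0 := by
  have : max (1 - |l| / T) 0 = 0 := by
    rw [max_eq_right]
    rw [sub_nonpos, one_le_div hT]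
    exact hl
  rw [cesaroKernel, this, ofReal_zero, zero_mul]

theorem cesaroKernel_of_nonneg (hT : 0 < T) {l : ℝ} (h0 : 0 ≤ l) (hl : l ≤ T) :
    cesaroKernel T z w l = (1 - l / T : ℂ) * exp (2 * Real.pi * I * l * z) := by
  have : max (1 - |l| / T) 0 = 1 - l / T := by
    rw [abs_of_nonneg h0, max_eq_left]
    rw [sub_nonneg, div_le_one hT]
    exact hl
  rw [cesaroKernel, this, if_pos h0]
  push_cast
  rfl

theorem cesaroKernel_of_nonpos (hT : 0 < T) {l : ℝ} (h0 : l ≤ 0) (hl : -T ≤ l) :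
    cesaroKernel T z w l = (1 + l / T : ℂ) * exp (2 * Real.pi * I * l * conj w) := by
  have : max (1 - |l| / T) 0 = 1 + l / T := by
    rw [abs_of_nonpos h0, neg_div, sub_neg_eq_add, max_eq_left]
    have : -1 ≤ l / T := by rw [le_div_iff₀ hT]; linarith
    linarith
  rw [cesaroKernel, this]
  push_cast
  rcases h0.lt_or_eq with h | h
  · rw [if_neg (not_le.2 h)]
  · simp [h]

/-- The two halves of the tent contribute -1/(2πi(z - t)) and 1/(2πi(conj w - t)), which combine by
partial fractions into the kernel of the representation. Either term alone decays only like 1/t,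
which is not enough for the weight (1 + t²)⁻¹; this is why z and w are treated together. -/
theorem fourier_cesaroKernel (hT : 0 < T) (hz : 0 < z.im) (hw : 0 < w.im) (t : ℝ) :
    𝓕 (cesaroKernel T z w) t =
      (z - conj w) / (2 * Real.pi * I) * (1 / ((z - t) * (conj w - t))) +
      ((exp (2 * Real.pi * I * (z - t) * T) - 1) / ((2 * Real.pi * I * (z - t)) ^ 2 * T) +
        (exp (-(2 * Real.pi * I * (conj w - t)) * T) - 1) /
          ((2 * Real.pi * I * (conj w - t)) ^ 2 * T)) := by
  have hz0 := sub_ofReal_ne_zero hz.ne' t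
  have hw0 := conj_sub_ofReal_ne_zero hw.ne' t
  have hp : (2 * Real.pi * I : ℂ) ≠ 0 := by simp [Real.pi_ne_zero]
  have hcont : Continuous fun x => character (-t) x * cesaroKernel T z w x :=
    (continuous_character _).mul (continuous_cesaroKernel _ _ _)
  have hsupp : Function.support (fun x => character (-t) x * cesaroKernel T z w x) ⊆
      Set.Ioc (-T) T := by
    intro x hx
    by_contra h
    refine hx ?_
    dsimp only
    rw [cesaroKernel_eq_zero hT, mul_zero]
    by_contra h'
    rw [not_le, abs_lt] at h'
    exact h ⟨h'.1, h'.2.le⟩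
  rw [fourier_eq_integral_character,
    ← intervalIntegral.integral_eq_integral_of_support_subset hsupp,
    ← intervalIntegral.integral_add_adjacent_intervals (hcont.intervalIntegrable (-T) 0)
      (hcont.intervalIntegrable 0 T)]
  have h1 : (∫ x in (0 : ℝ)..T, character (-t) x * cesaroKernel T z w x) =
      ∫ x in (0 : ℝ)..T, (1 - x / T : ℂ) * exp (2 * Real.pi * I * (z - t) * x) := by
    refine intervalIntegral.integral_congr fun x hx => ?_
    rw [Set.uIcc_of_le hT.le] at hx
    rw [cesaroKernel_of_nonneg hT hx.1 hx.2, character, mul_left_comm, ← Complex.exp_add]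
    congr 2
    push_cast
    ring
  have h2 : (∫ x in (-T)..0, character (-t) x * cesaroKernel T z w x) =
      ∫ x in (0 : ℝ)..T, (1 - x / T : ℂ) * exp (-(2 * Real.pi * I * (conj w - t)) * x) := by
    have h3 : (∫ x in (-T)..0, character (-t) x * cesaroKernel T z w x) =
        ∫ x in (-T)..0, (fun x : ℝ => (1 - x / T : ℂ) *
          exp (-(2 * Real.pi * I * (conj w - t)) * x)) (-x) := by
      refine intervalIntegral.integral_congr fun x hx => ?_
      rw [Set.uIcc_of_le (by linarith)] at hx
      dsimp only
      rw [cesaroKernel_of_nonpos hT hx.2 hx.1, character, mul_left_comm, ← Complex.exp_add]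
      push_cast
      congr 2
      · ring
      · ring
    rw [h3]
    refine (intervalIntegral.integral_comp_neg (a := -T) (b := 0) (fun x : ℝ => (1 - x / T : ℂ) *
      exp (-(2 * Real.pi * I * (conj w - t)) * x))).trans ?_
    rw [neg_zero, neg_neg]
  rw [h1, h2, integral_fejer_exp hT (mul_ne_zero hp hz0),
    integral_fejer_exp hT (neg_ne_zero.2 (mul_ne_zero hp hw0))]
  rw [neg_sq]
  field_simp
  ring

theorem norm_exp_sub_one_le {s : ℂ} (hs : s.re ≤ 0) : ‖exp s - 1‖ ≤ 2 := by
  refine (norm_sub_le _ _).trans ?_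
  rw [Complex.norm_exp, norm_one]
  have := Real.exp_le_one_iff.2 hs
  linarith

theorem norm_cesaro_remainder_le (hT : 0 < T) {u : ℂ} (hu : u ≠ 0) {s : ℂ} (hs : s.re ≤ 0) :
    ‖(exp s - 1) / ((2 * Real.pi * I * u) ^ 2 * T)‖ ≤ (‖u‖ ^ 2)⁻¹ / T := by
  have h0 : 0 < ‖u‖ := norm_pos_iff.2 hu
  have h1 : ‖(2 * Real.pi * I * u) ^ 2 * (T : ℂ)‖ = 4 * Real.pi ^ 2 * ‖u‖ ^ 2 * T := by
    rw [norm_mul, norm_pow, norm_mul, norm_mul, norm_mul, Complex.norm_real, Complex.norm_real,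
      Complex.norm_I, Real.norm_of_nonneg hT.le, Real.norm_of_nonneg Real.pi_pos.le,
      Complex.norm_ofNat]
    ring
  rw [norm_div, h1, div_le_iff₀ (by have := Real.pi_pos; positivity)]
  refine (norm_exp_sub_one_le hs).trans ?_
  have : (‖u‖ ^ 2)⁻¹ / T * (4 * Real.pi ^ 2 * ‖u‖ ^ 2 * T) = 4 * Real.pi ^ 2 := by
    field_simp
  rw [this]
  nlinarith [Real.pi_gt_three]

end CesaroKernel

/-! ### Cesàro summation of the exponential series -/

namespace TemperedAP

variable {f : ℂ → ℂ} {c : ℝ}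

/-- Antipodality turns the negative frequencies into the conjugate of a sum over positive ones,
taken at w. -/
theorem tsum_cesaroKernel {a : ℝ → ℂ} (ha : LocallySummable a) (hanti : Antipodal a) {T : ℝ}
    (hT : 0 < T) {z w : ℂ} :
    ∑' l, a l * cesaroKernel T z w l = a 0 + cesaroSum a T z + conj (cesaroSum a T w) := by
  have hc : HasCompactSupport (cesaroKernel T z w) := by
    refine HasCompactSupport.intro (isCompact_Icc (a := -T) (b := T)) fun x hx =>
      cesaroKernel_eq_zero hT ?_
    rw [Set.mem_Icc, ← abs_le] at hx
    exact (not_le.1 hx).le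
  obtain ⟨B, hB⟩ := (continuous_cesaroKernel T z w).bounded_above_of_compact_support hc
  have hs : Summable fun l => a l * cesaroKernel T z w l :=
    (ha.summable_mul (R := T) (fun l hl => cesaroKernel_eq_zero hT hl.le) hB).of_norm
  set F : ℝ → ℂ := fun l => a l * cesaroKernel T z w l with hF
  have hdec : ∀ l, F l = ({0} : Set ℝ).indicator F l + (Set.Ioo 0 T).indicator F l +
      (Set.Ioo (-T) 0).indicator F l := by
    intro l
    by_cases h0 : T ≤ |l|
    · have : F l = 0 := by simp only [hF, cesaroKernel_eq_zero hT h0, mul_zero]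
      simp [Set.indicator_apply, this]
    rw [not_le, abs_lt] at h0
    rcases lt_trichotomy l 0 with h | h | h
    · simp [h, h.ne, h.not_gt, h0.1]
    · simp [h]
    · simp [h, h.ne', h.not_gt, h0.2]
  have h0 : ∑' l, ({0} : Set ℝ).indicator F l = a 0 := by
    rw [tsum_eq_single 0]
    · simp [hF, cesaroKernel]
    · intro l hl
      simp [hl]
  have h1 : ∑' l, (Set.Ioo 0 T).indicator F l = cesaroSum a T z := by
    rw [← tsum_subtype, cesaroSum]
    refine tsum_congr fun l => ?_
    simp only [hF]
    rw [cesaroKernel_of_nonneg hT l.2.1.le l.2.2.le]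
    ring
  have h2 : ∑' l, (Set.Ioo (-T) 0).indicator F l = conj (cesaroSum a T w) := by
    have hw : cesaroSum a T w = ∑' l, (Set.Ioo 0 T).indicator
        (fun l : ℝ => a l * (1 - (l : ℂ) / T) * exp (2 * Real.pi * I * (l : ℂ) * w)) l := by
      rw [← tsum_subtype, cesaroSum]
    rw [hw, Complex.conj_tsum, ← (Equiv.neg ℝ).tsum_eq]
    refine tsum_congr fun l => ?_
    simp only [Equiv.neg_apply, Set.indicator_apply]
    by_cases hl : l ∈ Set.Ioo 0 T
    · rw [if_pos hl, if_pos ⟨neg_lt_neg hl.2, neg_lt_zero.2 hl.1⟩]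
      simp only [hF]
      rw [cesaroKernel_of_nonpos hT (by linarith [hl.1]) (by linarith [hl.2]), hanti, map_mul,
        map_mul, ← Complex.exp_conj]
      simp [Complex.conj_ofNat, neg_div, sub_eq_add_neg]
      ring
    · rw [if_neg hl, if_neg (fun h => hl ⟨neg_lt_zero.1 h.2, neg_lt_neg_iff.1 h.1⟩), map_zero]
  rw [tsum_congr hdec, Summable.tsum_add ((hs.indicator _).add (hs.indicator _)) (hs.indicator _),
    Summable.tsum_add (hs.indicator _) (hs.indicator _), h0, h1, h2]

/-- Rate of convergence of the Cesàro means of the exponential series. -/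
theorem norm_cesaroSum_add_conj_sub_le (hf : TemperedAP f c)
    (hE : LocallySummable (bohrCoeff f c)) {μ : RealMeasure} (hμ : μ.Tame)
    (hK : KernelIdentity f μ) {T : ℝ} (hT : 0 < T) {z w : ℂ} (hz : z ∈ upperHalf)
    (hw : w ∈ upperHalf) :
    ‖antipodalCoeffs (bohrCoeff f c) 0 + cesaroSum (antipodalCoeffs (bohrCoeff f c)) T z +
        conj (cesaroSum (antipodalCoeffs (bohrCoeff f c)) T w) - (f z + conj (f w))‖ ≤
      (kernelConst z + kernelConst w) * (∫ t, (1 + t ^ 2)⁻¹ ∂μ.variation) / T := by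
  have hz' : 0 < z.im := hz
  have hw' : 0 < w.im := hw
  have hp := Real.pi_pos
  have hneg : ∀ l < 0, bohrCoeff f c l = 0 := fun l hl => hf.bohrCoeff_eq_zero_of_neg hl
  set r : ℝ → ℂ := fun t =>
    (exp (2 * Real.pi * I * (z - t) * T) - 1) / ((2 * Real.pi * I * (z - t)) ^ 2 * T) +
      (exp (-(2 * Real.pi * I * (conj w - t)) * T) - 1) /
        ((2 * Real.pi * I * (conj w - t)) ^ 2 * T) with hr
  have hTc : (T : ℂ) ≠ 0 := by exact_mod_cast hT.ne'
  have hpc : (2 * Real.pi * I : ℂ) ≠ 0 := by simp [Real.pi_ne_zero]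
  have hrc : Continuous r := by
    refine Continuous.add ?_ ?_
    · refine Continuous.div (by fun_prop) (by fun_prop) fun t => ?_
      exact mul_ne_zero (pow_ne_zero 2 (mul_ne_zero hpc (sub_ofReal_ne_zero hz'.ne' t))) hTc
    · refine Continuous.div (by fun_prop) (by fun_prop) fun t => ?_
      exact mul_ne_zero (pow_ne_zero 2 (mul_ne_zero hpc (conj_sub_ofReal_ne_zero hw'.ne' t))) hTc
  have hrb : ∀ t, ‖r t‖ ≤ (kernelConst z + kernelConst w) / T * (1 + t ^ 2)⁻¹ := by
    intro t
    have h1 := norm_cesaro_remainder_le hT (sub_ofReal_ne_zero hz'.ne' t)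
      (s := 2 * Real.pi * I * (z - t) * T) (by
        have e : (2 * Real.pi * I * (z - t) * T).re = -(2 * Real.pi * T * z.im) := by
          simp; ring
        rw [e, neg_nonpos]; positivity)
    have h2 := norm_cesaro_remainder_le hT (conj_sub_ofReal_ne_zero hw'.ne' t)
      (s := -(2 * Real.pi * I * (conj w - t)) * T) (by
        have e : (-(2 * Real.pi * I * (conj w - t)) * T).re = -(2 * Real.pi * T * w.im) := by
          simp; ring
        rw [e, neg_nonpos]; positivity)
    rw [norm_conj_sub] at h2
    have h3 := inv_norm_sub_sq_le hz' t
    have h4 := inv_norm_sub_sq_le hw' t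
    calc ‖r t‖ ≤ (‖z - t‖ ^ 2)⁻¹ / T + (‖w - t‖ ^ 2)⁻¹ / T :=
          (norm_add_le _ _).trans (add_le_add h1 h2)
      _ ≤ kernelConst z * (1 + t ^ 2)⁻¹ / T + kernelConst w * (1 + t ^ 2)⁻¹ / T := by
          unfold kernelConst
          gcongr
      _ = _ := by ring
  have hkc := continuous_kernel hz' hw'
  have hkb := norm_kernel_le hz' hw'
  have hF : 𝓕 (cesaroKernel T z w) = fun t => (z - conj w) / (2 * Real.pi * I) *
      (1 / ((z - t) * (conj w - t))) + r t :=
    funext fun t => fourier_cesaroKernel hT hz' hw' t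
  have hsum := hf.tsum_antipodalCoeffs_eq hE hμ hK (continuous_cesaroKernel T z w) (R := T)
    (fun l hl => cesaroKernel_eq_zero hT hl.le)
    (C := ‖(z - conj w) / (2 * Real.pi * I)‖ * (kernelConst z + kernelConst w) +
      (kernelConst z + kernelConst w) / T) (fun t => by
        rw [hF]
        refine (norm_add_le _ _).trans ?_
        rw [norm_mul, add_mul]
        exact add_le_add ((mul_le_mul_of_nonneg_left (hkb t) (norm_nonneg _)).trans
          (le_of_eq (by ring))) (hrb t))
  rw [tsum_cesaroKernel (locallySummable_antipodalCoeffs hE hneg)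
    (antipodal_antipodalCoeffs hneg) hT, hF,
    RealMeasure.integral_add' ((hμ.integrable_of_le hkc hkb).const_mul _)
      (hμ.integrable_of_le hrc hrb), RealMeasure.integral_const_mul'] at hsum
  have hne : z - conj w ≠ 0 := by
    intro h
    have := congrArg Complex.im h
    simp at this
    linarith
  have hid := hK z hz w hw
  rw [div_eq_iff hne] at hid
  have e : (z - conj w) / (2 * Real.pi * I) *
      (μ.integral fun t : ℝ => 1 / ((z - t) * (conj w - t))) = f z + conj (f w) := by
    rw [hid]; ring
  rw [hsum, e, add_sub_cancel_left]
  refine (hμ.norm_integral_le hrc hrb).trans (le_of_eq ?_)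
  ring

end TemperedAP

theorem tendsto_cesaroSum_atTop {a : ℝ → ℂ} (ha : LocallySummable a) {T : ℝ} (hT : 0 < T) :
    Tendsto (fun Y : ℝ => cesaroSum a T (Y * I)) atTop (𝓝 0) := by
  have hs : Summable fun l : Set.Ioo (0 : ℝ) T => ‖a l‖ := by
    have hsub : Set.Ioo (0 : ℝ) T ⊆ Set.Icc (-T) T := fun l hl =>
      ⟨by linarith [hl.1], hl.2.le⟩
    have h : Summable ((fun l : Set.Icc (-T) T => ‖a l‖) ∘ Set.inclusion hsub) :=
      Summable.comp_injective (ha.2 T hT) (Set.inclusion_injective hsub)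
    exact h
  have hn : ∀ (l : Set.Ioo (0 : ℝ) T) (Y : ℝ),
      ‖exp (2 * Real.pi * I * ((l : ℝ) : ℂ) * (Y * I))‖ = Real.exp (-(2 * Real.pi * l) * Y) := by
    intro l Y
    rw [Complex.norm_exp]
    congr 1
    simp
  have h0 : (0 : ℂ) = ∑' _ : Set.Ioo (0 : ℝ) T, (0 : ℂ) := tsum_zero.symm
  rw [h0]
  have hp := Real.pi_pos
  refine tendsto_tsum_of_dominated_convergence hs (fun l => ?_) ?_
  · have h1 : Tendsto (fun Y : ℝ => exp (2 * Real.pi * I * ((l : ℝ) : ℂ) * (Y * I))) atTop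
        (𝓝 0) := by
      rw [tendsto_zero_iff_norm_tendsto_zero]
      simp_rw [hn]
      refine Real.tendsto_exp_atBot.comp (tendsto_id.const_mul_atTop_of_neg ?_)
      have := l.2.1
      rw [neg_lt_zero]
      positivity
    simpa using h1.const_mul (a l * (1 - ((l : ℝ) : ℂ) / T))
  · filter_upwards [eventually_ge_atTop 0] with Y hY l
    have hl0 := l.2.1
    have hl1 := l.2.2
    have h2 : ‖(1 - ((l : ℝ) : ℂ) / T)‖ ≤ 1 := by
      rw [← Complex.ofReal_one, ← Complex.ofReal_div, ← Complex.ofReal_sub, Complex.norm_real,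
        Real.norm_eq_abs, abs_le]
      have h3 : (l : ℝ) / T ≤ 1 := (div_le_one hT).2 hl1.le
      have h4 : 0 ≤ (l : ℝ) / T := by positivity
      constructor <;> linarith
    have h5 : Real.exp (-(2 * Real.pi * l) * Y) ≤ 1 := by
      rw [Real.exp_le_one_iff, neg_mul, neg_nonpos]
      positivity
    rw [norm_mul, norm_mul, hn, mul_assoc]
    exact mul_le_of_le_one_right (norm_nonneg _) (mul_le_one₀ h2 (Real.exp_pos _).le h5)

theorem tendsto_expSeries_atTop {b : ℝ → ℂ} (hb : Summable fun l => ‖b l‖)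
    (hneg : ∀ l < 0, b l = 0) :
    Tendsto (fun Y : ℝ => expSeries b (Y * I)) atTop (𝓝 (b 0)) := by
  have h0 : b 0 = ∑' l : ℝ, if l = 0 then b 0 else 0 := by rw [tsum_ite_eq]
  rw [h0]
  have hp := Real.pi_pos
  refine tendsto_tsum_of_dominated_convergence hb (fun l => ?_) ?_
  · split_ifs with h
    · simp [h]
    rcases lt_or_gt_of_ne h with h | h
    · simp [hneg l h]
    rw [tendsto_zero_iff_norm_tendsto_zero]
    simp_rw [norm_expSeries_term]
    have h1 : Tendsto (fun Y : ℝ => Real.exp (-(2 * Real.pi * l) * Y)) atTop (𝓝 0) :=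
      Real.tendsto_exp_atBot.comp (tendsto_id.const_mul_atTop_of_neg
        (by rw [neg_lt_zero]; positivity))
    have h2 := h1.const_mul ‖b l‖
    rw [mul_zero] at h2
    refine h2.congr fun Y => ?_
    simp
  · filter_upwards [eventually_ge_atTop 0] with Y hY l
    exact norm_expSeries_term_le hneg l (by simpa using hY)

namespace TemperedAP

variable {f : ℂ → ℂ} {c : ℝ}

/-- With φ(0) = 1, the average of f against 𝓕 φ is an absolutely convergent series, whose limit at
iY is its constant term. Since f' = O(1/Y) at height Y, the averaging changes f(iY) by o(1). -/
theorem tendsto_vertical (hf : TemperedAP f c) (hE : LocallySummable (bohrCoeff f c)) :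
    Tendsto (fun Y : ℝ => f (Y * I)) atTop (𝓝 (bohrCoeff f c 0)) := by
  have hs : ContDiff ℝ ∞ fun x : ℝ => ((cutoff 1 one_pos x : ℝ) : ℂ) :=
    Complex.ofRealCLM.contDiff.comp (cutoff 1 one_pos).contDiff
  have hc : HasCompactSupport fun x : ℝ => ((cutoff 1 one_pos x : ℝ) : ℂ) :=
    (cutoff 1 one_pos).hasCompactSupport.comp_left (g := Complex.ofReal) ofReal_zero
  set φ : SchwartzMap ℝ ℂ := hc.toSchwartzMap hs with hφ
  have hφ0 : φ 0 = 1 := by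
    change ((cutoff 1 one_pos 0 : ℝ) : ℂ) = 1
    rw [cutoff_eq_one one_pos (by simp), ofReal_one]
  have hk : Continuous (𝓕 (φ : ℝ → ℂ)) := (𝓕 φ).continuous
  have hk2 : Integrable fun s => (1 + |s|) ^ 2 * ‖𝓕 (φ : ℝ → ℂ) s‖ :=
    schwartz_weighted_integrable (𝓕 φ)
  have hki := integrable_kernel_of_weighted hk hk2
  obtain ⟨R, hR⟩ := exists_radius_of_hasCompactSupport hc
  obtain ⟨B, hB⟩ := φ.continuous.bounded_above_of_compact_support hc
  have h1 : Tendsto (fun Y : ℝ => smear (𝓕 (φ : ℝ → ℂ)) f (Y * I)) atTop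
      (𝓝 (bohrCoeff f c 0)) := by
    have h2 := tendsto_expSeries_atTop (hE.summable_mul hR hB) fun l hl => by
      rw [hf.bohrCoeff_eq_zero_of_neg hl, zero_mul]
    change Tendsto _ _ (𝓝 (bohrCoeff f c 0 * φ 0)) at h2
    rw [hφ0, mul_one] at h2
    refine h2.congr' ?_
    filter_upwards [eventually_gt_atTop 0] with Y hY
    exact (hf.smear_eq_expSeries hE φ hc (by simpa [upperHalf] using hY)).symm
  obtain ⟨K, hK0, hK⟩ := hf.exists_deriv_bound (h := c + 1) (by linarith)
  set N := ∫ s, (1 + |s|) ^ 2 * ‖𝓕 (φ : ℝ → ℂ) s‖ with hN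
  have h3 : Tendsto (fun Y : ℝ => smear (𝓕 (φ : ℝ → ℂ)) f (Y * I) - f (Y * I)) atTop (𝓝 0) := by
    have h4 : Tendsto (fun Y : ℝ => N * K / (Y - (c + 1))) atTop (𝓝 0) :=
      tendsto_const_nhds.div_atTop (tendsto_atTop_add_const_right _ _ tendsto_id)
    refine squeeze_zero_norm' ?_ h4
    filter_upwards [eventually_gt_atTop (c + 1)] with Y hY
    have hc0 := hf.pos
    have hYim : ((Y : ℂ) * I).im = Y := by simp
    have hYpos : 0 < ((Y : ℂ) * I).im := by rw [hYim]; linarith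
    have hone : ∫ s, 𝓕 (φ : ℝ → ℂ) s * f (Y * I) = f (Y * I) := by
      have := integral_fourier_mul_character φ 0
      simp only [character_zero_left, mul_one, hφ0] at this
      rw [integral_mul_const, this, one_mul]
    have hlip : ∀ s : ℝ, ‖f (Y * I + s) - f (Y * I)‖ ≤ K / (Y - (c + 1)) * |s| := by
      intro s
      have := Convex.norm_image_sub_le_of_norm_deriv_le (𝕜 := ℂ) (f := f)
        (s := {z : ℂ | Y ≤ z.im}) (C := K / (Y - (c + 1))) (x := Y * I) (y := Y * I + s)
        (fun z hz => hf.differentiableAt (by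
          have hz' : Y ≤ z.im := hz
          linarith))
        (fun z hz => by
          have hz' : Y ≤ z.im := hz
          refine (hK z (by linarith)).trans ?_
          have : 0 < Y - (c + 1) := by linarith
          gcongr)
        (convex_halfSpace_im_ge Y) (by simp) (by simp)
      rwa [add_sub_cancel_left, Complex.norm_real, Real.norm_eq_abs] at this
    rw [smear, ← hone, ← integral_sub (hf.integrable_smear hk hk2 hYpos) (hki.mul_const _)]
    refine (norm_integral_le_of_norm_le (hk2.mul_const (K / (Y - (c + 1))))
      (Eventually.of_forall fun s => ?_)).trans ?_
    · rw [← mul_sub, norm_mul]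
      have hpos : 0 ≤ K / (Y - (c + 1)) := div_nonneg hK0.le (by linarith)
      have hs1 : |s| ≤ (1 + |s|) ^ 2 := by nlinarith [abs_nonneg s]
      calc _ ≤ ‖𝓕 (φ : ℝ → ℂ) s‖ * (K / (Y - (c + 1)) * |s|) := by gcongr; exact hlip s
        _ ≤ ‖𝓕 (φ : ℝ → ℂ) s‖ * (K / (Y - (c + 1)) * (1 + |s|) ^ 2) := by gcongr
        _ = _ := by ring
    · rw [integral_mul_const, ← hN, mul_div_assoc]
  have h5 := h1.sub h3
  rw [sub_zero] at h5
  exact h5.congr fun Y => by ring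

/-- In the estimate for two points w = iY is sent to infinity: the sum at w disappears, conj f(w)
tends to conj E(0), and `kernelConst` at iY stays at most 5 for Y ≥ 1. -/
theorem norm_cesaroSum_sub_le (hf : TemperedAP f c) (hE : LocallySummable (bohrCoeff f c))
    {μ : RealMeasure} (hμ : μ.Tame) (hK : KernelIdentity f μ) {T : ℝ} (hT : 0 < T) {z : ℂ}
    (hz : z ∈ upperHalf) :
    ‖bohrCoeff f c 0 + cesaroSum (antipodalCoeffs (bohrCoeff f c)) T z - f z‖ ≤
      (kernelConst z + 5) * (∫ t, (1 + t ^ 2)⁻¹ ∂μ.variation) / T := by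
  have hneg : ∀ l < 0, bohrCoeff f c l = 0 := fun l hl => hf.bohrCoeff_eq_zero_of_neg hl
  set a := antipodalCoeffs (bohrCoeff f c) with ha
  have hals : LocallySummable a := locallySummable_antipodalCoeffs hE hneg
  have hlim : Tendsto (fun Y : ℝ => a 0 + cesaroSum a T z + conj (cesaroSum a T (Y * I)) -
      (f z + conj (f (Y * I)))) atTop
      (𝓝 (a 0 + cesaroSum a T z + conj 0 - (f z + conj (bohrCoeff f c 0)))) :=
    (((Complex.continuous_conj.tendsto _).comp (tendsto_cesaroSum_atTop hals hT)).const_add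
      _).sub (((Complex.continuous_conj.tendsto _).comp (hf.tendsto_vertical hE)).const_add _)
  have e : a 0 + cesaroSum a T z + conj 0 - (f z + conj (bohrCoeff f c 0)) =
      bohrCoeff f c 0 + cesaroSum a T z - f z := by
    rw [ha, antipodalCoeffs_eq hneg, neg_zero, map_zero]
    ring
  rw [e] at hlim
  refine le_of_tendsto hlim.norm ?_
  filter_upwards [eventually_ge_atTop 1] with Y hY
  have hYu : (Y * I : ℂ) ∈ upperHalf := by
    simp only [upperHalf, Set.mem_ofPred_eq]
    simp
    linarith
  refine (hf.norm_cesaroSum_add_conj_sub_le hE hμ hK hT hz hYu).trans ?_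
  have hW : 0 ≤ ∫ t, (1 + t ^ 2)⁻¹ ∂μ.variation := integral_nonneg fun t => by positivity
  have hkc : kernelConst (Y * I) ≤ 5 := by
    have h1 : ‖(Y : ℂ) * I‖ = Y := by
      rw [norm_mul, Complex.norm_I, mul_one, Complex.norm_real, Real.norm_of_nonneg (by linarith)]
    have h2 : ((Y : ℂ) * I).im = Y := by simp
    rw [kernelConst, h1, h2]
    have h3 : (2 * Y ^ 2 + 1) / Y ^ 2 ≤ 3 := by
      rw [div_le_iff₀ (by positivity)]
      nlinarith
    linarith
  gcongr

/-- `kernelConst` is bounded on compact subsets of the half-plane, so the rate 1/T is uniform there.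
-/
theorem tendstoUniformlyOn_cesaroSum (hf : TemperedAP f c) (hE : LocallySummable (bohrCoeff f c))
    {μ : RealMeasure} (hμ : μ.Tame) (hK : KernelIdentity f μ) {K : Set ℂ} (hKc : IsCompact K)
    (hKu : K ⊆ upperHalf) :
    TendstoUniformlyOn (fun (T : ℝ) (z : ℂ) => (bohrCoeff f c 0).im * I +
      1 / 2 * antipodalCoeffs (bohrCoeff f c) 0 +
      cesaroSum (antipodalCoeffs (bohrCoeff f c)) T z) f atTop K := by
  have hcont : ContinuousOn kernelConst K := by
    unfold kernelConst
    refine continuousOn_const.add (ContinuousOn.div (by fun_prop) (by fun_prop) fun z hz => ?_)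
    have : 0 < z.im := hKu hz
    positivity
  obtain ⟨C, hC⟩ := hKc.exists_bound_of_continuousOn hcont
  set W := ∫ t, (1 + t ^ 2)⁻¹ ∂μ.variation with hW
  have hW0 : 0 ≤ W := integral_nonneg fun t => by positivity
  have e : (bohrCoeff f c 0).im * I + 1 / 2 * antipodalCoeffs (bohrCoeff f c) 0 =
      bohrCoeff f c 0 := by
    have h1 : antipodalCoeffs (bohrCoeff f c) 0 = ((2 * (bohrCoeff f c 0).re : ℝ) : ℂ) := by
      simp [antipodalCoeffs]
    rw [h1]
    conv_rhs => rw [← Complex.re_add_im (bohrCoeff f c 0)]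
    push_cast
    ring
  rw [Metric.tendstoUniformlyOn_iff]
  intro ε hε
  have hlim : Tendsto (fun T : ℝ => (C + 5) * W / T) atTop (𝓝 0) :=
    tendsto_const_nhds.div_atTop tendsto_id
  filter_upwards [hlim.eventually_lt_const hε, eventually_gt_atTop 0] with T hTε hT z hz
  rw [dist_comm, dist_eq_norm, e]
  refine (hf.norm_cesaroSum_sub_le hE hμ hK hT (hKu hz)).trans_lt (lt_of_le_of_lt ?_ hTε)
  have := (Real.le_norm_self _).trans (hC z hz)
  gcongr

end TemperedAP

end FourierSummation

end

/-! ### The theorem -/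

theorem theorem2 (f : ℂ → ℂ) (hf : DifferentiableOn ℂ f FourierSummation.upperHalf)
    (c₁ : ℝ) (hc₁ : 0 < c₁)
    (hII : FourierSummation.AlmostPeriodicUpper fun z => f (z + c₁ * I))
    (hIV : FourierSummation.ExpBoundedTypeZero f) :
    ((∃ c₂ : ℝ, c₁ ≤ c₂ ∧ FourierSummation.LocalMeanBound f c₂) →
      ∃ c : ℝ, 0 ≤ c ∧ ∃ E : ℝ → ℂ,
        FourierSummation.HasFourierBohrCoeffs f c E ∧
        (∀ l : ℝ, l < 0 → E l = 0) ∧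
        FourierSummation.LocallySummable E ∧
        (∃! μ : FourierSummation.RealMeasure,
          μ.degree ≤ 2 ∧ FourierSummation.KernelIdentity f μ) ∧
        (∀ μ : FourierSummation.RealMeasure,
          μ.degree ≤ 2 → FourierSummation.KernelIdentity f μ →
          FourierSummation.IsRealAntipodalFSPair μ (FourierSummation.antipodalCoeffs E)) ∧
        (∀ K : Set ℂ, IsCompact K → K ⊆ FourierSummation.upperHalf →
          TendstoUniformlyOn
            (fun (T : ℝ) (z : ℂ) => (E 0).im * I + 1 / 2 * FourierSummation.antipodalCoeffs E 0 +
              FourierSummation.cesaroSum (FourierSummation.antipodalCoeffs E) T z)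
            f atTop K)) ∧
    (∃ c : ℝ, 0 ≤ c ∧ ∃ E : ℝ → ℂ,
      FourierSummation.HasFourierBohrCoeffs f c E ∧
      ((∃ c₂ : ℝ, c₁ ≤ c₂ ∧ FourierSummation.LocalMeanBound f c₂) ↔
        FourierSummation.LocallySummable E)) := by
  obtain ⟨μ, hμ, hK⟩ := FourierSummation.exists_tame_kernelIdentity hf hIV
  have hap : FourierSummation.TemperedAP f c₁ :=
    ⟨hc₁, hf, hII, fun η hη => FourierSummation.KernelIdentity.growth hμ hK hη⟩
  -- The height c₁ and the coefficients `bohrCoeff f c₁` serve in both halves of the statement.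
  refine ⟨fun hB => ?_, c₁, hc₁.le, FourierSummation.bohrCoeff f c₁, hap.hasFourierBohrCoeffs,
    hap.localMeanBound_iff⟩
  have hE := hap.localMeanBound_iff.1 hB
  refine ⟨c₁, hc₁.le, FourierSummation.bohrCoeff f c₁, hap.hasFourierBohrCoeffs,
    fun l hl => hap.bohrCoeff_eq_zero_of_neg hl, hE,
    ⟨μ, ⟨(FourierSummation.RealMeasure.tame_iff _).1 hμ, hK⟩, fun ν hν =>
      FourierSummation.KernelIdentity.unique
        ((FourierSummation.RealMeasure.tame_iff _).2 hν.1) hμ hν.2 hK⟩,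
    fun ν hν hKν =>
      hap.isRealAntipodalFSPair hE ((FourierSummation.RealMeasure.tame_iff _).2 hν) hKν,
    fun K hKc hKu => hap.tendstoUniformlyOn_cesaroSum hE hμ hK hKc hKu⟩
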